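/- **Setting.** Let $d_1,d_2\ge 1$ and $\langle\Theta,A\rangle=\mathrm{tr}(\Theta^\top A)$. The arm set $\mathcal A\subset\mathbb R^{d_1\times d_2}$ satisfies $\|A\|_{\mathrm{op}}\le 1$ for all $A\in\mathcal A$. The unknown $\Theta^*\in\mathbb R^{d_1\times d_2}$ has rank at most $r$ ($r\ge1$) and $\max_{A\in\mathcal A}|\langle\Theta^*,A\rangle|\le R_{\max}$, with $R_{\max}>0$. In round $t=1,\dots,T$ the learner pulls $A_t$ and observes $Y_t=\langle\Theta^*,A_t\rangle+\eta_t$, where, conditionally on $A_t$ and on the arms and rewards of the earlier rounds, $\eta_t$ has mean zero and is $\sigma$-subgaussian ($\mathbb E[e^{s\eta_t}\mid\cdot]\le e^{\sigma^2s^2/2}$ for all $s$), $\sigma>0$. The regret is $\mathrm{Reg}(T)=\sum_{t=1}^T\big(\sup_{A\in\mathcal A}\langle\Theta^*,A\rangle-\langle\Theta^*,A_t\rangle\big)$. **Design.** For a distribution $\pi$ on $\mathcal A$ let $Q(\pi)=\mathbb E_{A\sim\pi}[\mathrm{vec}(A)\mathrm{vec}(A)^\top]$. For invertible $Q$ let $$B(Q)=\max\Big\{\lambda_{\max}\Big(\sum_{i=1}^{d_2}D_i^{(\mathrm{col})}\Big),\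 \lambda_{\max}\Big(\sum_{j=1}^{d_1}D_j^{(\mathrm{row})}\Big)\Big\},$$ where $D_i^{(\mathrm{col})}\in\mathbb R^{d_1\times d_1}$ (resp. $D_j^{(\mathrm{row})}\in\mathbb R^{d_2\times d_2}$) is the principal submatrix of $Q^{-1}$ on the coordinates of $\mathrm{vec}(A)$ that belong to column $i$ (resp. row $j$) of $A$. Let $B_{\min}(\mathcal A)=\inf_\pi B(Q(\pi))$ over the distributions $\pi$ on $\mathcal A$ with $Q(\pi)$ invertible, and let $\pi^*$ attain it. **Estimator.** Let $\varphi(x)=\mathrm{sign}(x)\ln(1+|x|+x^2/2)$, applied spectrally to symmetric matrices, and $\mathcal H(M)=\begin{pmatrix}0&M\\M^\top&0\end{pmatrix}$. LowPopArt, given samples $(X_i,Y_i)_{i=1}^n$, $Q$, a pilot $\Theta_0$, a pilot error bound $R_0$, $\sigma$ and a failure rate $\delta'$, forms the matrices $M_i$ with $\mathrm{vec}(M_i)=Q^{-1}(Y_i-\langle\Theta_0,X_i\rangle)\mathrm{vec}(X_i)$ and $$\Theta_1=\Theta_0+\frac1{n\nu}\Big(\sum_{i=1}^n\varphi(\nu\mathcal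 H(M_i))\Big)_{\text{upper right }d_1\times d_2\text{ block}},\qquad \nu=\sqrt{\frac{\ln(2(d_1+d_2)/\delta')}{(\sigma^2+R_0^2)B(Q)n}},$$ and returns $\Theta_1$ with all its singular values that are at most $2\sqrt{(\sigma^2+R_0^2)B(Q)\ln(2(d_1+d_2)/\delta')/n}$ replaced by $0$. Warm-LowPopArt, given $n$ samples and a failure rate $\delta$, runs LowPopArt on the first $\lfloor n/2\rfloor$ samples with pilot $0$, $R_0=R_{\max}$, $\delta'=\delta/2$, and then on the remaining samples with the result as pilot, $R_0=\sigma$, $\delta'=\delta/2$. **Algorithm (LPA-ETC).** Put $$n_0=\min\Big\{T,\ \Big\lceil\Big(\tfrac{\sigma^2r^2B_{\min}(\mathcal A)T^2}{R_{\max}^2}\Big)^{1/3}\Big\rceil\Big\}.$$ In rounds $t\le n_0$ draw $A_t\sim\pi^*$ independently of the past; let $\hat\Theta$ be the output of Warm-LowPopArt on these $n_0$ samples with $Q=Q(\pi^*)$; in rounds $t>n_0$ pull any $A_t\in\arg\max_{A\in\mathcal A}\langle\hat\Theta,A\rangle$. **Theorem.** There is an absolute constant $C>0$ such that for every $\delta\in(0,1)$,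 writing $L=\ln\frac{4(d_1+d_2)}{\delta}$, if $$T\ \ge\ C\,L^{3/2}\,r^2B_{\min}(\mathcal A)\Big(\frac{\sigma+R_{\max}}{\sigma}\Big)^4,$$ then with probability at least $1-\delta$ the regret of LPA-ETC satisfies $$\mathrm{Reg}(T)\ \le\ C\,\sqrt{L}\,\big(\sigma^2R_{\max}r^2B_{\min}(\mathcal A)T^2\big)^{1/3}.$$ -/

import Mathlib

open MeasureTheory

noncomputable section

namespace LowRankBandit

variable {d₁ d₂ : ℕ}

/-- Matrices carry the product σ-algebra of their entries, which is the Borel σ-algebra. -/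
instance instMeasurableSpaceMatrix : MeasurableSpace (Matrix (Fin d₁) (Fin d₂) ℝ) :=
  inferInstanceAs (MeasurableSpace (Fin d₁ → Fin d₂ → ℝ))

/-- The trace inner product `⟨Θ, A⟩ = tr (Θᵀ A)`. -/
def frobInner (Θ A : Matrix (Fin d₁) (Fin d₂) ℝ) : ℝ := (Θ.transpose * A).trace

open scoped Matrix.Norms.L2Operator in
/-- The operator norm (largest singular value) of a real matrix. -/
def opNorm (A : Matrix (Fin d₁) (Fin d₂) ℝ) : ℝ := ‖A‖

/-! ### Experimental design -/

/-- `Q(π) = E_{A ∼ π} [vec(A) vec(A)ᵀ]`, where `vec` stacks the columns: the entry of `vec A` at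
`(j, i)` is `A i j`, so the first component of an index is the column. -/
def covMatrix (π : Measure (Matrix (Fin d₁) (Fin d₂) ℝ)) :
    Matrix (Fin d₂ × Fin d₁) (Fin d₂ × Fin d₁) ℝ :=
  Matrix.of fun p q => ∫ A, Matrix.vec A p * Matrix.vec A q ∂π

/-- The largest eigenvalue of a real symmetric matrix. -/
def lambdaMax {n : ℕ} (M : Matrix (Fin n) (Fin n) ℝ) : ℝ := sSup (spectrum ℝ M)

/-- `D_i^(col)`: the `i`-th diagonal `d₁ × d₁` block of `Q⁻¹`. -/
def colBlock (Q : Matrix (Fin d₂ × Fin d₁) (Fin d₂ × Fin d₁) ℝ) (i : Fin d₂) :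
    Matrix (Fin d₁) (Fin d₁) ℝ :=
  Q⁻¹.submatrix (fun k => (i, k)) (fun k => (i, k))

/-- `D_j^(row)`: the `d₂ × d₂` submatrix of `Q⁻¹` on the coordinates of the `j`-th row; it is the
analogue of `D_j^(col)` for the transposed matrices. -/
def rowBlock (Q : Matrix (Fin d₂ × Fin d₁) (Fin d₂ × Fin d₁) ℝ) (j : Fin d₁) :
    Matrix (Fin d₂) (Fin d₂) ℝ :=
  Q⁻¹.submatrix (fun k => (k, j)) (fun k => (k, j))

/-- `B(Q) = max (λ_max (∑ᵢ D_i^(col)), λ_max (∑ⱼ D_j^(row)))`, for invertible `Q`. -/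
def designB (Q : Matrix (Fin d₂ × Fin d₁) (Fin d₂ × Fin d₁) ℝ) : ℝ :=
  max (lambdaMax (∑ i, colBlock Q i)) (lambdaMax (∑ j, rowBlock Q j))

/-- A probability distribution on the arm set `𝒜` whose covariance `Q(π)` is nonsingular
(the other distributions have `B(Q(π)) = ∞`). -/
structure IsDesign (𝒜 : Set (Matrix (Fin d₁) (Fin d₂) ℝ))
    (π : Measure (Matrix (Fin d₁) (Fin d₂) ℝ)) : Prop where
  isProbabilityMeasure : IsProbabilityMeasure π
  ae_mem : ∀ᵐ A ∂π, A ∈ 𝒜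
  posDef : (covMatrix π).PosDef

/-- `B_min(𝒜)`: the infimum of `B(Q(π))` over the probability distributions on `𝒜`. -/
def Bmin (𝒜 : Set (Matrix (Fin d₁) (Fin d₂) ℝ)) : ℝ :=
  sInf {b | ∃ π, IsDesign 𝒜 π ∧ b = designB (covMatrix π)}

/-- `π` solves the experimental design problem `min_π B(Q(π))`. -/
def IsOptimalDesign (𝒜 : Set (Matrix (Fin d₁) (Fin d₂) ℝ))
    (π : Measure (Matrix (Fin d₁) (Fin d₂) ℝ)) : Prop :=
  IsDesign 𝒜 π ∧ ∀ π', IsDesign 𝒜 π' → designB (covMatrix π) ≤ designB (covMatrix π')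

/-! ### The low-rank estimator -/

/-- Catoni's influence function: `log (1 + x + x²/2)` for `x ≥ 0`, `-log (1 - x + x²/2)` for
`x < 0`. -/
def influence (x : ℝ) : ℝ :=
  if 0 ≤ x then Real.log (1 + x + x ^ 2 / 2) else -Real.log (1 - x + x ^ 2 / 2)

/-- The Hermitian dilation of `M`, with blocks `0, M; Mᵀ, 0`. -/
def dilation (M : Matrix (Fin d₁) (Fin d₂) ℝ) : Matrix (Fin d₁ ⊕ Fin d₂) (Fin d₁ ⊕ Fin d₂) ℝ :=
  Matrix.fromBlocks 0 M M.transpose 0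

/-- Hard thresholding of singular values: if `M = ∑ⱼ σⱼ uⱼ vⱼᵀ` is a singular value decomposition,
then this is `∑_{j : τ < σⱼ} σⱼ uⱼ vⱼᵀ`. Here `cfc` is the spectral calculus for the symmetric
matrix `Mᵀ M = ∑ⱼ σⱼ² vⱼ vⱼᵀ`, so that the second factor is `∑_{j : τ < σⱼ} vⱼ vⱼᵀ`. -/
def hardThreshold (τ : ℝ) (M : Matrix (Fin d₁) (Fin d₂) ℝ) : Matrix (Fin d₁) (Fin d₂) ℝ :=
  M * cfc (fun x : ℝ => if τ < √x then (1 : ℝ) else 0) (M.transpose * M)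

/-- The one-sample estimator `reshape (Q⁻¹ (Y - ⟨Θ₀, X⟩) vec(X))` of `Θ* - Θ₀`. -/
def oneSample (Q : Matrix (Fin d₂ × Fin d₁) (Fin d₂ × Fin d₁) ℝ)
    (Θ₀ X : Matrix (Fin d₁) (Fin d₂) ℝ) (y : ℝ) : Matrix (Fin d₁) (Fin d₂) ℝ :=
  Matrix.of fun i j => (Q⁻¹.mulVec ((y - frobInner Θ₀ X) • X.vec)) (j, i)

/-- The scale `√(ln (2 (d₁ + d₂) / δ) / ((σ² + R₀²) B(Q) n))` in the robust mean. -/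
def scaleParam (n : ℕ) (Q : Matrix (Fin d₂ × Fin d₁) (Fin d₂ × Fin d₁) ℝ) (σ R₀ δ : ℝ) : ℝ :=
  √(Real.log (2 * (d₁ + d₂) / δ) / ((σ ^ 2 + R₀ ^ 2) * designB Q * n))

/-- The threshold `2 √((σ² + R₀²) B(Q) ln (2 (d₁ + d₂) / δ) / n)`. -/
def threshold (n : ℕ) (Q : Matrix (Fin d₂ × Fin d₁) (Fin d₂ × Fin d₁) ℝ) (σ R₀ δ : ℝ) : ℝ :=
  2 * √((σ ^ 2 + R₀ ^ 2) * designB Q * Real.log (2 * (d₁ + d₂) / δ) / n)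

/-- The estimator before thresholding: the pilot `Θ₀` plus the robust mean
`(1 / (n ν)) (∑_{i ∈ s} φ(ν ℋ(Mᵢ)))_{ht}` of the one-sample estimators `Mᵢ`, where `n = |s|`, `φ` is
the influence function applied spectrally and `ht` takes the upper right block. -/
def robustMean (s : Finset ℕ) (X : ℕ → Matrix (Fin d₁) (Fin d₂) ℝ) (Y : ℕ → ℝ)
    (Q : Matrix (Fin d₂ × Fin d₁) (Fin d₂ × Fin d₁) ℝ) (Θ₀ : Matrix (Fin d₁) (Fin d₂) ℝ)
    (σ R₀ δ : ℝ) : Matrix (Fin d₁) (Fin d₂) ℝ :=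
  Θ₀ + ((s.card : ℝ) * scaleParam s.card Q σ R₀ δ)⁻¹ •
    (∑ i ∈ s, cfc influence
      (scaleParam s.card Q σ R₀ δ • dilation (oneSample Q Θ₀ (X i) (Y i)))).toBlocks₁₂

/-- LowPopArt on the samples `(X i, Y i)`, `i ∈ s`, with population covariance `Q`, pilot estimator
`Θ₀`, pilot error bound `R₀`, noise level `σ` and failure rate `δ`. -/
def lowPopArt (s : Finset ℕ) (X : ℕ → Matrix (Fin d₁) (Fin d₂) ℝ) (Y : ℕ → ℝ)
    (Q : Matrix (Fin d₂ × Fin d₁) (Fin d₂ × Fin d₁) ℝ) (Θ₀ : Matrix (Fin d₁) (Fin d₂) ℝ)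
    (σ R₀ δ : ℝ) : Matrix (Fin d₁) (Fin d₂) ℝ :=
  hardThreshold (threshold s.card Q σ R₀ δ) (robustMean s X Y Q Θ₀ σ R₀ δ)

/-- Warm-LowPopArt on the samples `(X i, Y i)`, `i < n`: the first half of the samples gives a pilot
estimator (starting from `0`, with error bound `Rmax`), the second half refines it with pilot error
bound `σ`; each call has failure rate `δ / 2`. -/
def warmLowPopArt (n : ℕ) (X : ℕ → Matrix (Fin d₁) (Fin d₂) ℝ) (Y : ℕ → ℝ)
    (Q : Matrix (Fin d₂ × Fin d₁) (Fin d₂ × Fin d₁) ℝ) (σ Rmax δ : ℝ) :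
    Matrix (Fin d₁) (Fin d₂) ℝ :=
  lowPopArt (Finset.Ico (n / 2) n) X Y Q
    (lowPopArt (Finset.range (n / 2)) X Y Q 0 σ Rmax (δ / 2)) σ σ (δ / 2)

/-! ### The bandit and the explore-then-commit algorithm -/

variable {Ω : Type*} [MeasurableSpace Ω]

/-- The reward `Y_t = ⟨Θ*, A_t⟩ + η_t`. -/
def reward (Θstar : Matrix (Fin d₁) (Fin d₂) ℝ) (A : ℕ → Ω → Matrix (Fin d₁) (Fin d₂) ℝ)
    (η : ℕ → Ω → ℝ) (t : ℕ) (ω : Ω) : ℝ :=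
  frobInner Θstar (A t ω) + η t ω

/-- The σ-algebra generated by the arms and the rewards of the rounds before `t`. -/
@[reducible]
def history (A : ℕ → Ω → Matrix (Fin d₁) (Fin d₂) ℝ) (Y : ℕ → Ω → ℝ) (t : ℕ) :
    MeasurableSpace Ω :=
  ⨆ (s : ℕ) (_ : s < t), (MeasurableSpace.comap (A s) inferInstance ⊔
    MeasurableSpace.comap (Y s) inferInstance)

/-- The noise of the rounds `t < T` is zero-mean and `σ`-subgaussian, conditionally on the history
and on the arm of the round. -/
structure IsSubgaussianNoise (μ : Measure Ω) (T : ℕ) (σ : ℝ)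
    (Θstar : Matrix (Fin d₁) (Fin d₂) ℝ) (A : ℕ → Ω → Matrix (Fin d₁) (Fin d₂) ℝ)
    (η : ℕ → Ω → ℝ) : Prop where
  measurable : ∀ t < T, Measurable (η t)
  integrable : ∀ t < T, Integrable (η t) μ
  condExp_eq_zero : ∀ t < T,
    μ[η t | history A (reward Θstar A η) t ⊔ MeasurableSpace.comap (A t) inferInstance] =ᵐ[μ] 0
  integrable_exp : ∀ t < T, ∀ s : ℝ, Integrable (fun ω => Real.exp (s * η t ω)) μ
  condExp_exp_le : ∀ t < T, ∀ s : ℝ, ∀ᵐ ω ∂μ,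
    (μ[fun ω => Real.exp (s * η t ω) |
      history A (reward Θstar A η) t ⊔ MeasurableSpace.comap (A t) inferInstance]) ω
        ≤ Real.exp (σ ^ 2 * s ^ 2 / 2)

/-- The number of exploration rounds: `(σ² r² B_min(𝒜) T² / R_max²)^(1/3)`, rounded up and capped by
the horizon `T`. -/
def explorationLength (𝒜 : Set (Matrix (Fin d₁) (Fin d₂) ℝ)) (T r : ℕ) (σ Rmax : ℝ) : ℕ :=
  min T ⌈(σ ^ 2 * r ^ 2 * Bmin 𝒜 * T ^ 2 / Rmax ^ 2) ^ (1 / 3 : ℝ)⌉₊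

/-- The arms `A 0, …, A (T - 1)` are pulled by LPA-ETC with design `π`: in each of the first `n₀`
rounds the arm is drawn from `π` independently of the past, and in the remaining rounds it maximizes
`⟨Θhat, ·⟩` over `𝒜`, where `Θhat` is the Warm-LowPopArt estimator computed from the first `n₀`
rounds (ties are broken arbitrarily). -/
structure IsLPAETC (μ : Measure Ω) (𝒜 : Set (Matrix (Fin d₁) (Fin d₂) ℝ))
    (π : Measure (Matrix (Fin d₁) (Fin d₂) ℝ)) (T n₀ : ℕ) (σ Rmax δ : ℝ)
    (A : ℕ → Ω → Matrix (Fin d₁) (Fin d₂) ℝ) (Y : ℕ → Ω → ℝ) : Prop where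
  measurable : ∀ t < T, Measurable (A t)
  explore_law : ∀ t < n₀, μ.map (A t) = π
  explore_indep : ∀ t < n₀,
    ProbabilityTheory.Indep (MeasurableSpace.comap (A t) inferInstance) (history A Y t) μ
  commit : ∀ t, n₀ ≤ t → t < T → ∀ ω, A t ω ∈ 𝒜 ∧ ∀ A' ∈ 𝒜,
    frobInner (warmLowPopArt n₀ (fun s => A s ω) (fun s => Y s ω) (covMatrix π) σ Rmax δ) A' ≤
      frobInner (warmLowPopArt n₀ (fun s => A s ω) (fun s => Y s ω) (covMatrix π) σ Rmax δ)
        (A t ω)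

/-- The (pseudo-)regret `∑_{t < T} (max_{A' ∈ 𝒜} ⟨Θ*, A'⟩ - ⟨Θ*, A_t⟩)`. -/
def regret (𝒜 : Set (Matrix (Fin d₁) (Fin d₂) ℝ)) (Θstar : Matrix (Fin d₁) (Fin d₂) ℝ) (T : ℕ)
    (A : ℕ → Ω → Matrix (Fin d₁) (Fin d₂) ℝ) (ω : Ω) : ℝ :=
  ∑ t ∈ Finset.range T, (sSup (frobInner Θstar '' 𝒜) - frobInner Θstar (A t ω))

end LowRankBandit

end

set_option linter.unusedSectionVars false

/-! If Θhat predicts every arm up to ε, then explore-then-commit has regret at most 2·Rmax·n₀ +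
2·T·ε. The point is that ε is of order r √(σ² B L / n₀) without any Rmax, and n₀ is chosen to
balance the two terms.

Estimation. The one-sample matrices are unbiased for Θ* − Θ₀. The second moment of their dilations
is at most (σ² + R₀²) B(Q) in the Loewner order, because whitening turns the mean of D² into the
column and row block sums of Q⁻¹ (`IsDesign.expMat_sampleDilation_sq`). Catoni's function satisfies
e^{φ(A)} ≤ 1 + A + A²/2, so two moments are enough to control a trace exponential: each round
multiplies its expectation by at most e^{ν²v/2}, where v = (σ² + R₀²) B(Q)
(`integral_trace_exp_add_influence_le`). Markov's inequality and the oddness of φ give an operator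
norm bound (`measure_opNorm_robustMean_gt_le`).

The matrix step needs a Jensen inequality of Lieb type, `integral_trace_exp_add_le`. It comes from
joint convexity of the quantum relative entropy. Taylor's formula for x log x writes the entropy as
an integral of suprema of functionals linear in the pair (X, Y), so it has a linear support at every
pair of positive definite matrices; the Gibbs variational principle does the rest.

Low rank. Hard thresholding at the error level τ does not raise the rank above that of Θ* and costs
another τ in operator norm. Trace duality then gives an error of 4rτ on every arm
(`abs_frobInner_hardThreshold_sub_le`).

Warm start. The horizon condition makes the first half long enough for a pilot error of at most σ.
The second half then runs with R₀ = σ, so its variance proxy is 2σ²B and Rmax has disappeared. -/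

namespace LowRankBandit

/-! ### Trace inequalities for symmetric matrices: Klein, Gibbs, monotonicity of tr exp. -/

section SpectralTrace

open Matrix

variable {n : Type*} [Fintype n] [DecidableEq n]

/-- The orthogonal matrix of eigenvectors of a real symmetric matrix. -/
noncomputable def eigU {A : Matrix n n ℝ} (hA : A.IsHermitian) : Matrix n n ℝ :=
  (hA.eigenvectorUnitary : Matrix n n ℝ)

lemma eigU_transpose_mul {A : Matrix n n ℝ} (hA : A.IsHermitian) : (eigU hA)ᵀ * eigU hA = 1 := by
  have h := Unitary.coe_star_mul_self hA.eigenvectorUnitary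
  rwa [Matrix.star_eq_conjTranspose, conjTranspose_eq_transpose_of_trivial] at h

lemma eigU_mul_transpose {A : Matrix n n ℝ} (hA : A.IsHermitian) : eigU hA * (eigU hA)ᵀ = 1 := by
  have h := Unitary.coe_mul_star_self hA.eigenvectorUnitary
  rwa [Unitary.coe_star, Matrix.star_eq_conjTranspose, conjTranspose_eq_transpose_of_trivial] at h

lemma cfc_eq_eigU {A : Matrix n n ℝ} (hA : A.IsHermitian) (f : ℝ → ℝ) :
    cfc f A = eigU hA * diagonal (fun i => f (hA.eigenvalues i)) * (eigU hA)ᵀ := by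
  rw [hA.cfc_eq, Matrix.IsHermitian.cfc, Unitary.conjStarAlgAut_apply,
    Matrix.star_eq_conjTranspose, conjTranspose_eq_transpose_of_trivial]
  rfl

lemma eq_eigU {A : Matrix n n ℝ} (hA : A.IsHermitian) :
    A = eigU hA * diagonal hA.eigenvalues * (eigU hA)ᵀ := by
  conv_lhs => rw [hA.spectral_theorem, Unitary.conjStarAlgAut_apply,
    Matrix.star_eq_conjTranspose, conjTranspose_eq_transpose_of_trivial]
  rfl

lemma continuousOn_spectrum {A : Matrix n n ℝ} (f : ℝ → ℝ) : ContinuousOn f (spectrum ℝ A) :=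
  (Matrix.finite_real_spectrum).continuousOn f

lemma isHermitian_cfc (f : ℝ → ℝ) (A : Matrix n n ℝ) : (cfc f A).IsHermitian :=
  cfc_predicate f A

lemma cfc_comp_matrix {A : Matrix n n ℝ} (hA : A.IsHermitian) (g f : ℝ → ℝ) :
    cfc (fun x => g (f x)) A = cfc g (cfc f A) :=
  cfc_comp g f A hA ((Matrix.finite_real_spectrum.image f).continuousOn g)
    (continuousOn_spectrum f)

lemma cfc_id_matrix {A : Matrix n n ℝ} (hA : A.IsHermitian) : cfc (fun x : ℝ => x) A = A := by
  rw [cfc_eq_eigU hA]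
  exact (eq_eigU hA).symm

lemma cfc_log_exp {A : Matrix n n ℝ} (hA : A.IsHermitian) :
    cfc Real.log (cfc Real.exp A) = A := by
  rw [← cfc_comp_matrix hA]
  simp only [Real.log_exp]
  exact cfc_id_matrix hA

lemma cfc_one_matrix {A : Matrix n n ℝ} (hA : A.IsHermitian) : cfc (fun _ => (1 : ℝ)) A = 1 := by
  rw [cfc_eq_eigU hA, diagonal_one, mul_one, eigU_mul_transpose]

lemma posSemidef_cfc {A : Matrix n n ℝ} (hA : A.IsHermitian) {f : ℝ → ℝ}
    (hf : ∀ i, 0 ≤ f (hA.eigenvalues i)) : (cfc f A).PosSemidef := by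
  rw [cfc_eq_eigU hA, ← conjTranspose_eq_transpose_of_trivial]
  exact (PosSemidef.diagonal hf).mul_mul_conjTranspose_same _

lemma posDef_cfc {A : Matrix n n ℝ} (hA : A.IsHermitian) {f : ℝ → ℝ}
    (hf : ∀ i, 0 < f (hA.eigenvalues i)) : (cfc f A).PosDef := by
  rw [cfc_eq_eigU hA, ← conjTranspose_eq_transpose_of_trivial]
  refine (PosDef.diagonal hf).mul_mul_conjTranspose_same ?_
  intro x y hxy
  have h := congrArg (fun v => v ᵥ* (eigU hA)ᵀ) hxy
  simpa [Matrix.vecMul_vecMul, eigU_mul_transpose] using h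

lemma posDef_cfc_exp {A : Matrix n n ℝ} (hA : A.IsHermitian) : (cfc Real.exp A).PosDef :=
  posDef_cfc hA fun _ => Real.exp_pos _

lemma posSemidef_cfc_sub {A : Matrix n n ℝ} (hA : A.IsHermitian) {f g : ℝ → ℝ}
    (hfg : ∀ i, f (hA.eigenvalues i) ≤ g (hA.eigenvalues i)) :
    (cfc g A - cfc f A).PosSemidef := by
  rw [← cfc_sub _ _ _ (continuousOn_spectrum _) (continuousOn_spectrum _)]
  exact posSemidef_cfc hA fun i => sub_nonneg.2 (hfg i)

lemma trace_diag_sandwich (q z : Matrix n n ℝ) (x : n → ℝ) :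
    (zᵀ * diagonal x * q).trace = ∑ i, ∑ j, x i * z i j * q i j := by
  simp only [Matrix.trace, Matrix.diag, Matrix.mul_apply (M := zᵀ * diagonal x), mul_diagonal,
    transpose_apply]
  rw [Finset.sum_comm]
  refine Finset.sum_congr rfl fun i _ => Finset.sum_congr rfl fun j _ => ?_
  ring

lemma trace_diag_sandwich' (q z : Matrix n n ℝ) (y : n → ℝ) :
    (zᵀ * q * diagonal y).trace = ∑ i, ∑ j, y j * z i j * q i j := by
  simp only [Matrix.trace, Matrix.diag, mul_diagonal]
  simp only [Matrix.mul_apply, transpose_apply, Finset.sum_mul]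
  rw [Finset.sum_comm]
  refine Finset.sum_congr rfl fun i _ => Finset.sum_congr rfl fun j _ => ?_
  ring

/-- The trace of a product of two symmetric matrices in terms of their eigenvalues and of the
overlaps of their eigenvectors. -/
lemma trace_mul_eigU (U V : Matrix n n ℝ) (x y : n → ℝ) :
    ((U * diagonal x * Uᵀ) * (V * diagonal y * Vᵀ)).trace =
      ∑ i, ∑ j, (Uᵀ * V) i j ^ 2 * (x i * y j) := by
  have h1 : ((U * diagonal x * Uᵀ) * (V * diagonal y * Vᵀ)).trace =
      ((Uᵀ * V)ᵀ * diagonal x * ((Uᵀ * V) * diagonal y)).trace := by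
    rw [Matrix.trace_mul_comm (U * diagonal x * Uᵀ), Matrix.mul_assoc V, Matrix.mul_assoc V,
      Matrix.trace_mul_comm V, Matrix.trace_mul_comm, transpose_mul, transpose_transpose]
    rw [Matrix.trace_mul_comm]
    simp only [Matrix.mul_assoc]
    rw [Matrix.trace_mul_comm]
    simp only [Matrix.mul_assoc]
  rw [h1, trace_diag_sandwich]
  refine Finset.sum_congr rfl fun i _ => Finset.sum_congr rfl fun j _ => ?_
  rw [mul_diagonal]
  ring

/-- The weights are squared overlaps of eigenvectors, hence nonnegative. An inequality in two scalar
variables therefore lifts to a trace inequality for a pair of matrices that need not commute. -/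
lemma trace_cfc_mul_cfc {A B : Matrix n n ℝ} (hA : A.IsHermitian) (hB : B.IsHermitian)
    (f g : ℝ → ℝ) :
    (cfc f A * cfc g B).trace = ∑ i, ∑ j, ((eigU hA)ᵀ * eigU hB) i j ^ 2 *
      (f (hA.eigenvalues i) * g (hB.eigenvalues j)) := by
  rw [cfc_eq_eigU hA, cfc_eq_eigU hB, trace_mul_eigU]

lemma trace_mul_nonneg {A B : Matrix n n ℝ} (hA : A.PosSemidef) (hB : B.PosSemidef) :
    0 ≤ (A * B).trace := by
  rw [eq_eigU hA.1, eq_eigU hB.1, trace_mul_eigU]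
  exact Finset.sum_nonneg fun i _ => Finset.sum_nonneg fun j _ =>
    mul_nonneg (sq_nonneg _) (mul_nonneg (hA.eigenvalues_nonneg i) (hB.eigenvalues_nonneg j))

/-! ### Quantum relative entropy -/

/-- The (unnormalised) quantum relative entropy. -/
noncomputable def relEnt (X Y : Matrix n n ℝ) : ℝ :=
  (X * cfc Real.log X).trace - (X * cfc Real.log Y).trace - X.trace + Y.trace

/-- The scalar relative entropy (Bregman divergence of `x log x`). -/
noncomputable def scalarRelEnt (x y : ℝ) : ℝ := x * Real.log x - x * Real.log y - x + y

lemma relEnt_eq_sum {X Y : Matrix n n ℝ} (hX : X.IsHermitian) (hY : Y.IsHermitian) :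
    relEnt X Y = ∑ i, ∑ j, ((eigU hX)ᵀ * eigU hY) i j ^ 2 *
      scalarRelEnt (hX.eigenvalues i) (hY.eigenvalues j) := by
  have e1 : (X * cfc Real.log X).trace =
      (cfc (fun x => x * Real.log x) X * cfc (fun _ => (1 : ℝ)) Y).trace := by
    rw [cfc_one_matrix hY, mul_one, cfc_mul _ _ _ (continuousOn_spectrum _)
      (continuousOn_spectrum _), cfc_id_matrix hX]
  have e2 : (X * cfc Real.log Y).trace = (cfc (fun x : ℝ => x) X * cfc Real.log Y).trace := by
    rw [cfc_id_matrix hX]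
  have e3 : X.trace = (cfc (fun x : ℝ => x) X * cfc (fun _ => (1 : ℝ)) Y).trace := by
    rw [cfc_one_matrix hY, mul_one, cfc_id_matrix hX]
  have e4 : Y.trace = (cfc (fun _ => (1 : ℝ)) X * cfc (fun x : ℝ => x) Y).trace := by
    rw [cfc_one_matrix hX, one_mul, cfc_id_matrix hY]
  rw [relEnt, e1, e2, e3, e4]
  simp only [trace_cfc_mul_cfc hX hY, ← Finset.sum_sub_distrib, ← Finset.sum_add_distrib,
    scalarRelEnt]
  refine Finset.sum_congr rfl fun i _ => Finset.sum_congr rfl fun j _ => ?_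
  ring

lemma segment_pos {x y t : ℝ} (hx : 0 < x) (hy : 0 < y) (ht : t ∈ Set.Icc (0 : ℝ) 1) :
    0 < t * x + (1 - t) * y := by
  rcases ht.1.eq_or_lt with h | h
  · subst h; simpa using hy
  · have : 0 ≤ (1 - t) * y := mul_nonneg (by linarith [ht.2]) hy.le
    have := mul_pos h hx
    linarith

/-- Taylor's formula with integral remainder for ψ(u) = u log u − u on the segment from y to x,
where ψ''(u) = 1/u. The primitive `F` is (1 − t)(x − y) ψ'(u) + ψ(u) at u = t x + (1 − t) y. -/
lemma scalarRelEnt_eq_integral {x y : ℝ} (hx : 0 < x) (hy : 0 < y) :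
    scalarRelEnt x y = ∫ t in (0 : ℝ)..1, (1 - t) * ((x - y) ^ 2 / (t * x + (1 - t) * y)) := by
  set F : ℝ → ℝ := fun t => (1 - t) * (x - y) * Real.log (t * x + (1 - t) * y) +
    ((t * x + (1 - t) * y) * Real.log (t * x + (1 - t) * y) - (t * x + (1 - t) * y)) with hF
  have hd : ∀ t ∈ Set.uIcc (0 : ℝ) 1,
      HasDerivAt F ((1 - t) * ((x - y) ^ 2 / (t * x + (1 - t) * y))) t := by
    intro t ht
    rw [Set.uIcc_of_le zero_le_one] at ht
    have hp := segment_pos hx hy ht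
    have hl : HasDerivAt (fun t : ℝ => t * x + (1 - t) * y) (x - y) t := by
      exact (((hasDerivAt_id t).mul_const x).add
        (((hasDerivAt_id t).const_sub 1).mul_const y)).congr_deriv (by ring)
    have hlog := hl.log hp.ne'
    have h1 := (((hasDerivAt_id t).const_sub 1).mul_const (x - y)).mul hlog
    have h2 := (hl.mul hlog).sub hl
    refine (h1.add h2).congr_deriv ?_
    rw [mul_div_cancel₀ _ hp.ne']
    simp only [id]
    ring
  have hc : IntervalIntegrable (fun t => (1 - t) * ((x - y) ^ 2 / (t * x + (1 - t) * y)))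
      volume 0 1 := by
    apply ContinuousOn.intervalIntegrable
    rw [Set.uIcc_of_le zero_le_one]
    refine ContinuousOn.mul (by fun_prop) (ContinuousOn.div (by fun_prop) (by fun_prop) ?_)
    exact fun t ht => (segment_pos hx hy ht).ne'
  rw [intervalIntegral.integral_eq_sub_of_hasDerivAt hd hc, hF, scalarRelEnt]
  simp only
  ring_nf

lemma scalarRelEnt_nonneg {x y : ℝ} (hx : 0 < x) (hy : 0 < y) : 0 ≤ scalarRelEnt x y := by
  rw [scalarRelEnt_eq_integral hx hy]
  refine intervalIntegral.integral_nonneg zero_le_one fun t ht => ?_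
  exact mul_nonneg (by linarith [ht.2]) (div_nonneg (sq_nonneg _) (segment_pos hx hy ht).le)

/-- Klein's inequality. -/
lemma relEnt_nonneg {X Y : Matrix n n ℝ} (hX : X.PosDef) (hY : Y.PosDef) : 0 ≤ relEnt X Y := by
  rw [relEnt_eq_sum hX.1 hY.1]
  exact Finset.sum_nonneg fun i _ => Finset.sum_nonneg fun j _ =>
    mul_nonneg (sq_nonneg _) (scalarRelEnt_nonneg (hX.eigenvalues_pos i) (hY.eigenvalues_pos j))

/-- The Gibbs variational principle. -/
lemma trace_mul_sub_le_trace_exp {X K : Matrix n n ℝ} (hX : X.PosDef) (hK : K.IsHermitian) :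
    (X * K).trace - (X * cfc Real.log X).trace + X.trace ≤ (cfc Real.exp K).trace := by
  -- Klein's inequality against exp K, whose logarithm is K.
  have h := relEnt_nonneg hX (posDef_cfc_exp hK)
  rw [relEnt, cfc_log_exp hK] at h
  linarith

/-- Monotonicity of the trace exponential. -/
lemma trace_exp_mono {A B : Matrix n n ℝ} (hA : A.IsHermitian) (hB : B.IsHermitian)
    (hAB : (B - A).PosSemidef) : (cfc Real.exp A).trace ≤ (cfc Real.exp B).trace := by
  -- With X = exp A the Gibbs principle reads tr(e^A (B − A)) + tr e^A ≤ tr e^B.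
  have h := trace_mul_sub_le_trace_exp (posDef_cfc_exp hA) hB
  rw [cfc_log_exp hA] at h
  have h2 := trace_mul_nonneg (posDef_cfc_exp hA).posSemidef hAB
  rw [Matrix.mul_sub, Matrix.trace_sub] at h2
  linarith

end SpectralTrace

/-! ### Joint convexity of the relative entropy and a Jensen inequality for tr exp. -/

section LiebJensen

open Matrix

variable {n : Type*} [Fintype n] [DecidableEq n]

lemma trace_conj_orthogonal {V : Matrix n n ℝ} (hV : V * Vᵀ = 1) (W : Matrix n n ℝ) :
    (Vᵀ * W * V).trace = W.trace := by
  rw [Matrix.trace_mul_cycle, hV, Matrix.one_mul]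

/-- The functional of `(X, Y)` whose supremum over `Z` is the integrand of the relative entropy. -/
noncomputable def bracket (t : ℝ) (Z X Y : Matrix n n ℝ) : ℝ :=
  2 * ((Zᵀ * X).trace - (Zᵀ * Y).trace) - t * (Zᵀ * X * Z).trace -
    (1 - t) * (Zᵀ * Z * Y).trace

/-- In the eigenbases of X and Y the functional decouples into one scalar quadratic in each entry of
UᵀZV. For positive definite X, Y and t in [0, 1] these quadratics are concave, so the supremum over
Z can be computed entry by entry. -/
lemma bracket_eq_sum {X Y : Matrix n n ℝ} (hX : X.IsHermitian) (hY : Y.IsHermitian) (t : ℝ)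
    (Z : Matrix n n ℝ) :
    bracket t Z X Y = ∑ i, ∑ j,
      (2 * ((eigU hX)ᵀ * Z * eigU hY) i j * ((eigU hX)ᵀ * eigU hY) i j *
          (hX.eigenvalues i - hY.eigenvalues j) -
        (t * hX.eigenvalues i + (1 - t) * hY.eigenvalues j) *
          ((eigU hX)ᵀ * Z * eigU hY) i j ^ 2) := by
  set U := eigU hX with hU
  set V := eigU hY with hV
  have hUU : U * Uᵀ = 1 := eigU_mul_transpose hX
  have hVV : V * Vᵀ = 1 := eigU_mul_transpose hY
  have hVV' : Vᵀ * V = 1 := eigU_transpose_mul hY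
  have hXe : X = U * diagonal hX.eigenvalues * Uᵀ := eq_eigU hX
  have hYe : Y * V = V * diagonal hY.eigenvalues := by
    conv_lhs => rw [eq_eigU hY, ← hV, Matrix.mul_assoc, hVV', Matrix.mul_one]
  set z := Uᵀ * Z * V with hz
  have hzt : zᵀ = Vᵀ * Zᵀ * U := by
    rw [hz, transpose_mul, transpose_mul, transpose_transpose, Matrix.mul_assoc]
  have e1 : (Zᵀ * X).trace = (zᵀ * diagonal hX.eigenvalues * (Uᵀ * V)).trace := by
    rw [← trace_conj_orthogonal hVV, hzt]
    conv_lhs => rw [hXe]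
    simp only [Matrix.mul_assoc]
  have e2 : (Zᵀ * X * Z).trace = (zᵀ * diagonal hX.eigenvalues * z).trace := by
    rw [← trace_conj_orthogonal hVV, hzt, hz]
    conv_lhs => rw [hXe]
    simp only [Matrix.mul_assoc]
  have e3 : (Zᵀ * Y).trace = (zᵀ * (Uᵀ * V) * diagonal hY.eigenvalues).trace := by
    rw [← trace_conj_orthogonal hVV, hzt]
    have : Vᵀ * (Zᵀ * Y) * V = Vᵀ * Zᵀ * (Y * V) := by simp only [Matrix.mul_assoc]
    rw [this, hYe]
    have : Vᵀ * Zᵀ * U * (Uᵀ * V) * diagonal hY.eigenvalues =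
        Vᵀ * Zᵀ * (U * Uᵀ) * V * diagonal hY.eigenvalues := by simp only [Matrix.mul_assoc]
    rw [this, hUU, Matrix.mul_one, Matrix.mul_assoc]
    simp only [Matrix.mul_assoc]
  have e4 : (Zᵀ * Z * Y).trace = (zᵀ * z * diagonal hY.eigenvalues).trace := by
    rw [← trace_conj_orthogonal hVV, hzt, hz]
    have : Vᵀ * (Zᵀ * Z * Y) * V = Vᵀ * Zᵀ * Z * (Y * V) := by simp only [Matrix.mul_assoc]
    rw [this, hYe]
    have : Vᵀ * Zᵀ * U * (Uᵀ * Z * V) * diagonal hY.eigenvalues =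
        Vᵀ * Zᵀ * (U * Uᵀ) * Z * V * diagonal hY.eigenvalues := by simp only [Matrix.mul_assoc]
    rw [this, hUU, Matrix.mul_one]
    simp only [Matrix.mul_assoc]
  rw [bracket, e1, e2, e3, e4, trace_diag_sandwich, trace_diag_sandwich, trace_diag_sandwich',
    trace_diag_sandwich']
  simp only [Finset.mul_sum, ← Finset.sum_sub_distrib]
  refine Finset.sum_congr rfl fun i _ => Finset.sum_congr rfl fun j _ => ?_
  ring

/-- The integrand of the relative entropy. -/
noncomputable def relEntIntegrand {X Y : Matrix n n ℝ} (hX : X.IsHermitian) (hY : Y.IsHermitian)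
    (t : ℝ) : ℝ :=
  ∑ i, ∑ j, ((eigU hX)ᵀ * eigU hY) i j ^ 2 *
    ((hX.eigenvalues i - hY.eigenvalues j) ^ 2 /
      (t * hX.eigenvalues i + (1 - t) * hY.eigenvalues j))

/-- Complete the square; the maximum over z is at z = q s / w, which is the entry used in
`optimalZ`. -/
lemma quadratic_le_div {w : ℝ} (hw : 0 < w) (z q s : ℝ) :
    2 * z * q * s - w * z ^ 2 ≤ q ^ 2 * (s ^ 2 / w) := by
  have h : q ^ 2 * (s ^ 2 / w) - (2 * z * q * s - w * z ^ 2) = (q * s - w * z) ^ 2 / w := by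
    field_simp
    ring
  have := div_nonneg (sq_nonneg (q * s - w * z)) hw.le
  linarith

lemma bracket_le {X Y : Matrix n n ℝ} (hX : X.PosDef) (hY : Y.PosDef) {t : ℝ}
    (ht : t ∈ Set.Icc (0 : ℝ) 1) (Z : Matrix n n ℝ) :
    bracket t Z X Y ≤ relEntIntegrand hX.1 hY.1 t := by
  rw [bracket_eq_sum hX.1 hY.1, relEntIntegrand]
  exact Finset.sum_le_sum fun i _ => Finset.sum_le_sum fun j _ =>
    quadratic_le_div (segment_pos (hX.eigenvalues_pos i) (hY.eigenvalues_pos j) ht) _ _ _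

/-- The matrix at which the supremum of `bracket` is attained. -/
noncomputable def optimalZ {X Y : Matrix n n ℝ} (hX : X.IsHermitian) (hY : Y.IsHermitian)
    (t : ℝ) : Matrix n n ℝ :=
  eigU hX * Matrix.of (fun i j => ((eigU hX)ᵀ * eigU hY) i j *
    ((hX.eigenvalues i - hY.eigenvalues j) /
      (t * hX.eigenvalues i + (1 - t) * hY.eigenvalues j))) * (eigU hY)ᵀ

lemma bracket_optimalZ {X Y : Matrix n n ℝ} (hX : X.PosDef) (hY : Y.PosDef) {t : ℝ}
    (ht : t ∈ Set.Icc (0 : ℝ) 1) :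
    bracket t (optimalZ hX.1 hY.1 t) X Y = relEntIntegrand hX.1 hY.1 t := by
  rw [bracket_eq_sum hX.1 hY.1, relEntIntegrand]
  have h : (eigU hX.1)ᵀ * optimalZ hX.1 hY.1 t * eigU hY.1 =
      Matrix.of (fun i j => ((eigU hX.1)ᵀ * eigU hY.1) i j *
        ((hX.1.eigenvalues i - hY.1.eigenvalues j) /
          (t * hX.1.eigenvalues i + (1 - t) * hY.1.eigenvalues j))) := by
    rw [optimalZ]
    simp only [Matrix.mul_assoc, eigU_transpose_mul, Matrix.mul_one]
    simp only [← Matrix.mul_assoc, eigU_transpose_mul, Matrix.one_mul]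
  rw [h]
  refine Finset.sum_congr rfl fun i _ => Finset.sum_congr rfl fun j _ => ?_
  have hw := (segment_pos (hX.eigenvalues_pos i) (hY.eigenvalues_pos j) ht).ne'
  simp only [of_apply]
  generalize t * hX.1.eigenvalues i + (1 - t) * hY.1.eigenvalues j = w at *
  field_simp
  ring

lemma continuous_optimalZ {X Y : Matrix n n ℝ} (hX : X.PosDef) (hY : Y.PosDef) :
    Continuous fun t : Set.Icc (0 : ℝ) 1 => optimalZ hX.1 hY.1 t := by
  unfold optimalZ
  refine (Continuous.matrix_mul continuous_const ?_).matrix_mul continuous_const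
  refine continuous_matrix fun i j => ?_
  refine continuous_const.mul (Continuous.div continuous_const (by fun_prop) fun t => ?_)
  exact (segment_pos (hX.eigenvalues_pos i) (hY.eigenvalues_pos j) t.2).ne'

/-- The scalar Taylor formula summed over pairs of eigenvalues. Integrability is recorded because
the integrals of two integrands are compared later. -/
lemma relEnt_eq_integral {X Y : Matrix n n ℝ} (hX : X.PosDef) (hY : Y.PosDef) :
    IntervalIntegrable (fun t => (1 - t) * relEntIntegrand hX.1 hY.1 t) volume 0 1 ∧
    relEnt X Y = ∫ t in (0 : ℝ)..1, (1 - t) * relEntIntegrand hX.1 hY.1 t := by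
  have hi : ∀ i j, IntervalIntegrable (fun t => (1 - t) *
      ((hX.1.eigenvalues i - hY.1.eigenvalues j) ^ 2 /
        (t * hX.1.eigenvalues i + (1 - t) * hY.1.eigenvalues j))) volume 0 1 := by
    intro i j
    apply ContinuousOn.intervalIntegrable
    rw [Set.uIcc_of_le zero_le_one]
    refine ContinuousOn.mul (by fun_prop) (ContinuousOn.div (by fun_prop) (by fun_prop) ?_)
    exact fun t ht => (segment_pos (hX.eigenvalues_pos i) (hY.eigenvalues_pos j) ht).ne'
  have hF : (fun t => (1 - t) * relEntIntegrand hX.1 hY.1 t) = fun t => ∑ i, ∑ j,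
      ((eigU hX.1)ᵀ * eigU hY.1) i j ^ 2 * ((1 - t) *
      ((hX.1.eigenvalues i - hY.1.eigenvalues j) ^ 2 /
        (t * hX.1.eigenvalues i + (1 - t) * hY.1.eigenvalues j))) := by
    funext t
    simp only [relEntIntegrand, Finset.mul_sum]
    refine Finset.sum_congr rfl fun i _ => Finset.sum_congr rfl fun j _ => ?_
    ring
  have hs : ∀ i, IntervalIntegrable (fun t => ∑ j, ((eigU hX.1)ᵀ * eigU hY.1) i j ^ 2 * ((1 - t) *
      ((hX.1.eigenvalues i - hY.1.eigenvalues j) ^ 2 /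
        (t * hX.1.eigenvalues i + (1 - t) * hY.1.eigenvalues j)))) volume 0 1 := fun i => by
    simpa only [Finset.sum_fn] using
      IntervalIntegrable.sum Finset.univ fun j _ => (hi i j).const_mul _
  rw [hF]
  constructor
  · simpa only [Finset.sum_fn] using IntervalIntegrable.sum Finset.univ fun i _ => hs i
  · rw [relEnt_eq_sum hX.1 hY.1, intervalIntegral.integral_finsetSum fun i _ => hs i]
    refine Finset.sum_congr rfl fun i _ => ?_
    rw [intervalIntegral.integral_finsetSum fun j _ => (hi i j).const_mul _]
    refine Finset.sum_congr rfl fun j _ => ?_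
    rw [intervalIntegral.integral_const_mul,
      scalarRelEnt_eq_integral (hX.eigenvalues_pos i) (hY.eigenvalues_pos j)]

lemma trace_integral_mul {α : ℝ → Matrix n n ℝ} (hα : ContinuousOn α (Set.Icc 0 1))
    (X : Matrix n n ℝ) :
    IntervalIntegrable (fun t => (α t * X).trace) volume 0 1 ∧
    ((Matrix.of fun i j => ∫ t in (0 : ℝ)..1, α t i j) * X).trace =
      ∫ t in (0 : ℝ)..1, (α t * X).trace := by
  have hi : ∀ i j, IntervalIntegrable (fun t => α t i j) volume 0 1 := fun i j => by
    apply ContinuousOn.intervalIntegrable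
    rw [Set.uIcc_of_le zero_le_one]
    exact (continuous_id.matrix_elem i j).comp_continuousOn hα
  have hs : ∀ i, IntervalIntegrable (fun t => ∑ j, α t i j * X j i) volume 0 1 := fun i => by
    simpa only [Finset.sum_fn] using
      IntervalIntegrable.sum Finset.univ fun j _ => (hi i j).mul_const (X j i)
  simp only [Matrix.trace, Matrix.diag, Matrix.mul_apply, of_apply]
  constructor
  · simpa only [Finset.sum_fn] using IntervalIntegrable.sum Finset.univ fun i _ => hs i
  · rw [intervalIntegral.integral_finsetSum fun i _ => hs i]
    refine Finset.sum_congr rfl fun i _ => ?_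
    rw [intervalIntegral.integral_finsetSum fun j _ => (hi i j).mul_const _]
    refine Finset.sum_congr rfl fun j _ => ?_
    rw [intervalIntegral.integral_mul_const]

/-- The relative entropy has a linear support functional at every pair of positive definite
matrices. This expresses its joint convexity. -/
lemma exists_relEnt_support {X₀ Y₀ : Matrix n n ℝ} (hX₀ : X₀.PosDef) (hY₀ : Y₀.PosDef) :
    ∃ α β : Matrix n n ℝ, (α * X₀).trace + (β * Y₀).trace = relEnt X₀ Y₀ ∧
      ∀ X Y : Matrix n n ℝ, X.PosDef → Y.PosDef →
        (α * X).trace + (β * Y).trace ≤ relEnt X Y := by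
  -- Freeze Z at the optimiser for the base pair. With Z fixed, `bracket` is linear in (X, Y), with
  -- coefficients `a` and `b` once weighted by 1 − t. Integrating over t gives a linear functional
  -- that is exact at the base pair and lies below the entropy elsewhere by `bracket_le`.
  set Z : ℝ → Matrix n n ℝ := optimalZ hX₀.1 hY₀.1 with hZ
  set a : ℝ → Matrix n n ℝ := fun t => (1 - t) • ((2 : ℝ) • (Z t)ᵀ - t • (Z t * (Z t)ᵀ)) with ha
  set b : ℝ → Matrix n n ℝ :=
    fun t => (1 - t) • (-((2 : ℝ) • (Z t)ᵀ) - (1 - t) • ((Z t)ᵀ * Z t)) with hb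
  have hZc := continuous_optimalZ hX₀ hY₀
  have hac : ContinuousOn a (Set.Icc 0 1) := by
    rw [continuousOn_iff_continuous_domRestrict]
    have h1 : Continuous fun t : Set.Icc (0 : ℝ) 1 => (Z t)ᵀ := hZc.matrix_transpose
    have h2 : Continuous fun t : Set.Icc (0 : ℝ) 1 => Z t * (Z t)ᵀ := hZc.matrix_mul h1
    exact Continuous.smul (f := fun t : Set.Icc (0 : ℝ) 1 => 1 - (t : ℝ)) (by fun_prop)
      (Continuous.sub (Continuous.const_smul h1 (2 : ℝ)) (Continuous.smul continuous_subtype_val h2))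
  have hbc : ContinuousOn b (Set.Icc 0 1) := by
    rw [continuousOn_iff_continuous_domRestrict]
    have h1 : Continuous fun t : Set.Icc (0 : ℝ) 1 => (Z t)ᵀ := hZc.matrix_transpose
    have h2 : Continuous fun t : Set.Icc (0 : ℝ) 1 => (Z t)ᵀ * Z t := h1.matrix_mul hZc
    have h3 : Continuous fun t : Set.Icc (0 : ℝ) 1 => 1 - (t : ℝ) := by fun_prop
    exact h3.smul (Continuous.sub (Continuous.neg (Continuous.const_smul h1 (2 : ℝ))) (h3.smul h2))
  have hab : ∀ t X Y, (a t * X).trace + (b t * Y).trace = (1 - t) * bracket t (Z t) X Y := by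
    intro t X Y
    have : ((Z t)ᵀ * X * Z t).trace = (Z t * (Z t)ᵀ * X).trace := by
      rw [Matrix.trace_mul_comm, Matrix.mul_assoc]
    rw [bracket, this]
    simp only [ha, hb, Matrix.smul_mul, Matrix.sub_mul, Matrix.neg_mul, Matrix.trace_smul,
      Matrix.trace_sub, Matrix.trace_neg, smul_eq_mul]
    ring
  have hint : ∀ X Y, IntervalIntegrable (fun t => (1 - t) * bracket t (Z t) X Y) volume 0 1 ∧
      ((Matrix.of fun i j => ∫ t in (0 : ℝ)..1, a t i j) * X).trace +
        ((Matrix.of fun i j => ∫ t in (0 : ℝ)..1, b t i j) * Y).trace =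
      ∫ t in (0 : ℝ)..1, (1 - t) * bracket t (Z t) X Y := by
    intro X Y
    obtain ⟨i1, e1⟩ := trace_integral_mul hac X
    obtain ⟨i2, e2⟩ := trace_integral_mul hbc Y
    simp only [← hab]
    exact ⟨i1.add i2, by rw [e1, e2, intervalIntegral.integral_add i1 i2]⟩
  refine ⟨_, _, (hint X₀ Y₀).2.trans ?_, fun X Y hX hY => (hint X Y).2.le.trans ?_⟩
  · rw [(relEnt_eq_integral hX₀ hY₀).2]
    refine intervalIntegral.integral_congr fun t ht => ?_
    rw [Set.uIcc_of_le zero_le_one] at ht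
    simp only [hZ]
    rw [bracket_optimalZ hX₀ hY₀ ht]
  · rw [(relEnt_eq_integral hX hY).2]
    refine intervalIntegral.integral_mono_on zero_le_one (hint X Y).1
      (relEnt_eq_integral hX hY).1 fun t ht => ?_
    exact mul_le_mul_of_nonneg_left (bracket_le hX hY ht _) (by linarith [ht.2])

/-! ### Expectations of random matrices -/

/-- The entrywise expectation of a random matrix. -/
noncomputable def expMat {Ω m n : Type*} [MeasurableSpace Ω] (ν : Measure Ω)
    (W : Ω → Matrix m n ℝ) : Matrix m n ℝ :=
  Matrix.of fun i j => ∫ ω, W ω i j ∂ν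

variable {Ω : Type*} [MeasurableSpace Ω] {ν : Measure Ω}

lemma trace_mul_expMat {W : Ω → Matrix n n ℝ} (hW : ∀ i j, Integrable (fun ω => W ω i j) ν)
    (α : Matrix n n ℝ) :
    Integrable (fun ω => (α * W ω).trace) ν ∧
      (α * expMat ν W).trace = ∫ ω, (α * W ω).trace ∂ν := by
  simp only [Matrix.trace, Matrix.diag, Matrix.mul_apply, expMat, of_apply]
  have hi : ∀ i, Integrable (fun ω => ∑ j, α i j * W ω j i) ν := fun i =>
    integrable_finsetSum _ fun j _ => (hW j i).const_mul _
  refine ⟨integrable_finsetSum _ fun i _ => hi i, ?_⟩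
  rw [integral_finsetSum _ fun i _ => hi i]
  refine Finset.sum_congr rfl fun i _ => ?_
  rw [integral_finsetSum _ fun j _ => (hW j i).const_mul _]
  refine Finset.sum_congr rfl fun j _ => ?_
  rw [integral_const_mul]

lemma dotProduct_expMat {m : Type*} [Fintype m] {W : Ω → Matrix m n ℝ}
    (hW : ∀ i j, Integrable (fun ω => W ω i j) ν) (u : m → ℝ) (v : n → ℝ) :
    Integrable (fun ω => u ⬝ᵥ W ω *ᵥ v) ν ∧
      u ⬝ᵥ expMat ν W *ᵥ v = ∫ ω, u ⬝ᵥ W ω *ᵥ v ∂ν := by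
  simp only [dotProduct, mulVec, expMat, of_apply, Finset.mul_sum]
  have hi : ∀ i, Integrable (fun ω => ∑ j, u i * (W ω i j * v j)) ν := fun i =>
    integrable_finsetSum _ fun j _ => ((hW i j).mul_const _).const_mul _
  refine ⟨integrable_finsetSum _ fun i _ => hi i, ?_⟩
  rw [integral_finsetSum _ fun i _ => hi i]
  refine Finset.sum_congr rfl fun i _ => ?_
  rw [integral_finsetSum _ fun j _ => ((hW i j).mul_const _).const_mul _]
  refine Finset.sum_congr rfl fun j _ => ?_
  rw [integral_const_mul, integral_mul_const]

lemma isHermitian_expMat {W : Ω → Matrix n n ℝ} (hW : ∀ ω, (W ω).IsHermitian) :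
    (expMat ν W).IsHermitian := by
  ext i j
  simp only [conjTranspose_apply, star_trivial, expMat, of_apply]
  exact integral_congr_ae (ae_of_all _ fun ω => by simpa using (hW ω).apply i j)

lemma posDef_expMat [IsProbabilityMeasure ν] {W : Ω → Matrix n n ℝ}
    (hi : ∀ i j, Integrable (fun ω => W ω i j) ν) (hW : ∀ ω, (W ω).PosDef) :
    (expMat ν W).PosDef := by
  refine PosDef.of_dotProduct_mulVec_pos (isHermitian_expMat fun ω => (hW ω).1) fun x hx => ?_
  rw [star_trivial, (dotProduct_expMat hi x x).2]
  have hpos : ∀ ω, 0 < x ⬝ᵥ W ω *ᵥ x := fun ω => by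
    simpa using (hW ω).dotProduct_mulVec_pos hx
  rw [integral_pos_iff_support_of_nonneg (fun ω => (hpos ω).le) (dotProduct_expMat hi x x).1]
  have : Function.support (fun ω => x ⬝ᵥ W ω *ᵥ x) = Set.univ :=
    Set.eq_univ_of_forall fun ω => (hpos ω).ne'
  simp [this]

/-- A Jensen inequality for the trace exponential, which follows from Lieb's theorem. -/
theorem integral_trace_exp_add_le [IsProbabilityMeasure ν] {H : Matrix n n ℝ}
    (hH : H.IsHermitian) {S : Ω → Matrix n n ℝ} (hS : ∀ ω, (S ω).IsHermitian)
    (hX : ∀ i j, Integrable (fun ω => cfc Real.exp (H + S ω) i j) ν)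
    (hB : ∀ i j, Integrable (fun ω => cfc Real.exp (S ω) i j) ν) :
    ∫ ω, (cfc Real.exp (H + S ω)).trace ∂ν ≤
      (cfc Real.exp (H + expMat ν (fun ω => cfc Real.exp (S ω)) - 1)).trace := by
  set X : Ω → Matrix n n ℝ := fun ω => cfc Real.exp (H + S ω)
  set B : Ω → Matrix n n ℝ := fun ω => cfc Real.exp (S ω)
  have hXp : ∀ ω, (X ω).PosDef := fun ω => posDef_cfc_exp (hH.add (hS ω))
  have hBp : ∀ ω, (B ω).PosDef := fun ω => posDef_cfc_exp (hS ω)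
  have hX₀ := posDef_expMat hX hXp
  have hB₀ := posDef_expMat hB hBp
  obtain ⟨α, β, heq, hle⟩ := exists_relEnt_support hX₀ hB₀
  -- Since log X = H + S and log B = S, tr X = tr(HX) + tr B − relEnt X B pointwise. Replacing the
  -- entropy by its support at (E X, E B) makes the right side linear, so expectations can be taken
  -- and the entropy reappears at the means.
  have hpt : ∀ ω, (X ω).trace ≤ (H * X ω).trace + (B ω).trace -
      ((α * X ω).trace + (β * B ω).trace) := by
    intro ω
    have h := hle _ _ (hXp ω) (hBp ω)
    have e : relEnt (X ω) (B ω) = (H * X ω).trace - (X ω).trace + (B ω).trace := by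
      rw [relEnt]
      simp only [X, B]
      rw [cfc_log_exp (hH.add (hS ω)), cfc_log_exp (hS ω), Matrix.mul_add, Matrix.trace_add,
        Matrix.trace_mul_comm _ H]
      ring
    linarith
  have tX : Integrable (fun ω => (X ω).trace) ν ∧ (expMat ν X).trace = ∫ ω, (X ω).trace ∂ν := by
    simpa using trace_mul_expMat hX 1
  have tB : Integrable (fun ω => (B ω).trace) ν ∧ (expMat ν B).trace = ∫ ω, (B ω).trace ∂ν := by
    simpa using trace_mul_expMat hB 1
  obtain ⟨iH, eH⟩ := trace_mul_expMat hX H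
  obtain ⟨iα, eα⟩ := trace_mul_expMat hX α
  obtain ⟨iβ, eβ⟩ := trace_mul_expMat hB β
  have h1 : ∫ ω, (X ω).trace ∂ν ≤ (H * expMat ν X).trace + (expMat ν B).trace -
      relEnt (expMat ν X) (expMat ν B) := by
    refine (integral_mono tX.1 ((iH.add tB.1).sub (iα.add iβ)) hpt).trans (le_of_eq ?_)
    rw [← heq, eH, eα, eβ, tB.2]
    exact (integral_sub (iH.add tB.1) (iα.add iβ)).trans
      (congrArg₂ (· - ·) (integral_add iH tB.1) (integral_add iα iβ))
  have hlogh : (cfc Real.log (expMat ν B)).IsHermitian := isHermitian_cfc _ _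
  -- The Gibbs principle with exponent H + log E B eliminates E X.
  have h2 : (H * expMat ν X).trace + (expMat ν B).trace - relEnt (expMat ν X) (expMat ν B) ≤
      (cfc Real.exp (H + cfc Real.log (expMat ν B))).trace := by
    have := trace_mul_sub_le_trace_exp hX₀ (hH.add hlogh)
    rw [Matrix.mul_add, Matrix.trace_add, Matrix.trace_mul_comm _ H] at this
    rw [relEnt]
    linarith
  refine (h1.trans h2).trans (trace_exp_mono (hH.add hlogh)
    ((hH.add hB₀.1).sub Matrix.isHermitian_one) ?_)
  -- log y ≤ y − 1 on the spectrum of E B replaces the matrix logarithm by an expression linear in E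
  -- B.
  have h3 := posSemidef_cfc_sub (f := Real.log) (g := fun x => x - 1) hB₀.1
    fun i => Real.log_le_sub_one_of_pos (hB₀.eigenvalues_pos i)
  rw [cfc_sub (fun x : ℝ => x) (fun _ => (1 : ℝ)) _ (continuousOn_spectrum _)
    (continuousOn_spectrum _), cfc_id_matrix hB₀.1, cfc_one_matrix hB₀.1] at h3
  convert h3 using 1
  abel

end LiebJensen

/-! ### Measurability of the functional calculus. -/

section SpectralMeasurability

open Matrix Filter Topology

variable {n : Type*} [Fintype n] [DecidableEq n]

/-- The functional calculus of `f` is a measurable function of the symmetric matrix. -/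
def SpectrallyMeasurable (n : Type*) [Fintype n] [DecidableEq n] (f : ℝ → ℝ) : Prop :=
  ∀ i j : n, Measurable fun A : {A : n → n → ℝ // (Matrix.of A).IsHermitian} =>
    cfc f (Matrix.of A.1) i j

lemma SpectrallyMeasurable.measurable {f : ℝ → ℝ} (hf : SpectrallyMeasurable n f) {Ω : Type*}
    [MeasurableSpace Ω] {W : Ω → Matrix n n ℝ} (hW : ∀ ω, (W ω).IsHermitian)
    (hm : ∀ i j, Measurable fun ω => W ω i j) (i j : n) : Measurable fun ω => cfc f (W ω) i j := by
  have h : Measurable fun ω =>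
      (⟨fun i j => W ω i j, hW ω⟩ : {A : n → n → ℝ // (Matrix.of A).IsHermitian}) :=
    Measurable.subtype_mk (measurable_pi_lambda _ fun i => measurable_pi_lambda _ fun j => hm i j)
  exact (hf i j).comp h

lemma spectrallyMeasurable_id : SpectrallyMeasurable n fun x => x := fun i j => by
  have : (fun A : {A : n → n → ℝ // (Matrix.of A).IsHermitian} =>
      cfc (fun x : ℝ => x) (Matrix.of A.1) i j) = fun A => A.1 i j := by
    funext A
    rw [cfc_id_matrix A.2, of_apply]
  rw [this]
  exact (measurable_pi_apply j).comp ((measurable_pi_apply i).comp measurable_subtype_coe)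

lemma spectrallyMeasurable_const (c : ℝ) : SpectrallyMeasurable n fun _ => c := fun i j => by
  have : (fun A : {A : n → n → ℝ // (Matrix.of A).IsHermitian} =>
      cfc (fun _ : ℝ => c) (Matrix.of A.1) i j) = fun _ => (c • (1 : Matrix n n ℝ)) i j := by
    funext A
    have h := cfc_const_mul c (fun _ : ℝ => (1 : ℝ)) (Matrix.of A.1) (continuousOn_spectrum _)
    rw [cfc_one_matrix A.2] at h
    rw [← h, mul_one]
  rw [this]
  exact measurable_const

lemma SpectrallyMeasurable.add {f g : ℝ → ℝ} (hf : SpectrallyMeasurable n f)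
    (hg : SpectrallyMeasurable n g) : SpectrallyMeasurable n fun x => f x + g x := fun i j => by
  have : (fun A : {A : n → n → ℝ // (Matrix.of A).IsHermitian} =>
      cfc (fun x : ℝ => f x + g x) (Matrix.of A.1) i j) =
      fun A => cfc f (Matrix.of A.1) i j + cfc g (Matrix.of A.1) i j := by
    funext A
    rw [cfc_add _ _ _ (continuousOn_spectrum _) (continuousOn_spectrum _)]
    rfl
  rw [this]
  exact (hf i j).add (hg i j)

lemma SpectrallyMeasurable.mul {f g : ℝ → ℝ} (hf : SpectrallyMeasurable n f)
    (hg : SpectrallyMeasurable n g) : SpectrallyMeasurable n fun x => f x * g x := fun i j => by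
  have : (fun A : {A : n → n → ℝ // (Matrix.of A).IsHermitian} =>
      cfc (fun x : ℝ => f x * g x) (Matrix.of A.1) i j) =
      fun A => ∑ k, cfc f (Matrix.of A.1) i k * cfc g (Matrix.of A.1) k j := by
    funext A
    rw [cfc_mul _ _ _ (continuousOn_spectrum _) (continuousOn_spectrum _), Matrix.mul_apply]
  rw [this]
  exact Finset.measurable_sum _ fun k _ => (hf i k).mul (hg k j)

/-- For one matrix the calculus sees only finitely many values of the function, so pointwise
convergence suffices. -/
lemma spectrallyMeasurable_of_tendsto {f : ℕ → ℝ → ℝ} {g : ℝ → ℝ}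
    (hf : ∀ k, SpectrallyMeasurable n (f k)) (h : ∀ x, Tendsto (fun k => f k x) atTop (𝓝 (g x))) :
    SpectrallyMeasurable n g := fun i j => by
  refine measurable_of_tendsto_metrizable (fun k => hf k i j) ?_
  rw [tendsto_pi_nhds]
  intro A
  simp only [cfc_eq_eigU A.2]
  simp only [Matrix.mul_apply (N := (eigU A.2)ᵀ), mul_diagonal]
  exact tendsto_finsetSum _ fun l _ => ((h _).const_mul _).mul_const _

lemma spectrallyMeasurable_polynomial (p : Polynomial ℝ) :
    SpectrallyMeasurable n fun x => p.eval x := by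
  induction p using Polynomial.induction_on' with
  | add p q hp hq => simpa only [Polynomial.eval_add] using hp.add hq
  | monomial k a =>
    simp only [Polynomial.eval_monomial]
    refine (spectrallyMeasurable_const a).mul ?_
    induction k with
    | zero => simpa using spectrallyMeasurable_const (n := n) 1
    | succ k ih => simpa only [pow_succ] using ih.mul spectrallyMeasurable_id

/-- Weierstrass polynomials with error 1/(k+1) on [−k, k] converge pointwise on the whole line,
because every point is eventually in the interval. -/
lemma spectrallyMeasurable_of_continuous {f : ℝ → ℝ} (hf : Continuous f) :
    SpectrallyMeasurable n f := by
  have h : ∀ k : ℕ, ∃ p : Polynomial ℝ, ∀ x ∈ Set.Icc (-(k : ℝ)) k,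
      |p.eval x - f x| < 1 / ((k : ℝ) + 1) := fun k =>
    exists_polynomial_near_of_continuousOn _ _ f hf.continuousOn _ (by positivity)
  choose p hp using h
  refine spectrallyMeasurable_of_tendsto (fun k => spectrallyMeasurable_polynomial (p k))
    fun x => ?_
  rw [tendsto_iff_norm_sub_tendsto_zero]
  refine tendsto_of_tendsto_of_tendsto_of_le_of_le' tendsto_const_nhds
    tendsto_one_div_add_atTop_nhds_zero_nat (Eventually.of_forall fun _ => norm_nonneg _) ?_
  filter_upwards [eventually_ge_atTop ⌈|x|⌉₊] with k hk
  have hx : |x| ≤ k := (Nat.le_ceil _).trans (by exact_mod_cast hk)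
  exact (hp k x (abs_le.1 hx)).le

/-- The indicator used by hard thresholding is discontinuous; it is a pointwise limit of continuous
ramps that vanish up to τ. -/
lemma spectrallyMeasurable_indicator_sqrt (τ : ℝ) :
    SpectrallyMeasurable n fun x => if τ < √x then (1 : ℝ) else 0 := by
  refine spectrallyMeasurable_of_tendsto (f := fun k x => min 1 (k * max 0 (√x - τ)))
    (fun k => spectrallyMeasurable_of_continuous (by fun_prop)) fun x => ?_
  split_ifs with h
  · refine tendsto_const_nhds.congr' ?_
    obtain ⟨K, hK⟩ := exists_nat_gt (1 / (√x - τ))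
    filter_upwards [eventually_ge_atTop K] with k hk
    have h0 : 0 < √x - τ := sub_pos.2 h
    rw [max_eq_right h0.le, min_eq_left]
    have : 1 / (√x - τ) ≤ k := hK.le.trans (by exact_mod_cast hk)
    rwa [div_le_iff₀ h0] at this
  · simp [max_eq_left (sub_nonpos.2 (not_lt.1 h))]

end SpectralMeasurability

/-! ### Catoni's influence function. -/

section Influence

lemma one_add_add_sq_pos (x : ℝ) : 0 < 1 + x + x ^ 2 / 2 := by nlinarith [sq_nonneg (1 + x)]

lemma one_sub_add_sq_pos (x : ℝ) : 0 < 1 - x + x ^ 2 / 2 := by nlinarith [sq_nonneg (1 - x)]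

lemma continuous_influence : Continuous influence := by
  unfold influence
  refine Continuous.if_le ?_ ?_ continuous_const continuous_id ?_
  · exact Continuous.log (by fun_prop) fun x => (one_add_add_sq_pos x).ne'
  · exact (Continuous.log (by fun_prop) fun x => (one_sub_add_sq_pos x).ne').neg
  · rintro x rfl
    simp

/-- For x < 0 this is 1 ≤ (1 + x + x²/2)(1 − x + x²/2) = 1 + x⁴/4. -/
lemma exp_influence_le (x : ℝ) : Real.exp (influence x) ≤ 1 + x + x ^ 2 / 2 := by
  unfold influence
  split_ifs with h
  · rw [Real.exp_log (one_add_add_sq_pos x)]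
  · rw [Real.exp_neg, Real.exp_log (one_sub_add_sq_pos x),
      inv_le_iff_one_le_mul₀ (one_sub_add_sq_pos x)]
    nlinarith [sq_nonneg (x ^ 2)]

/-- Oddness is what keeps the robustified samples of dilation form (`cfc_dilation_eq`). -/
lemma influence_neg (x : ℝ) : influence (-x) = -influence x := by
  unfold influence
  rcases lt_trichotomy x 0 with h | rfl | h
  · rw [if_pos (by linarith), if_neg (by linarith)]
    ring_nf
  · simp
  · rw [if_neg (by linarith), if_pos h.le]
    ring_nf

end Influence

/-! ### One round of the matrix Catoni argument. -/

section CatoniStep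

open Matrix

variable {n : Type*} [Fintype n] [DecidableEq n]

/-- Testing against eᵢ ± eⱼ bounds the entry by the mean of two diagonal entries. An integrable
bound on the trace thus makes all entries integrable. -/
lemma abs_entry_le_trace {A : Matrix n n ℝ} (hA : A.PosSemidef) (i j : n) :
    |A i j| ≤ A.trace := by
  have hd : ∀ k, A k k ≤ A.trace := fun k =>
    Finset.single_le_sum (f := fun k => A k k) (fun k _ => hA.diag_nonneg) (Finset.mem_univ k)
  have hsym : A j i = A i j := by simpa using hA.1.apply i j
  have h1 := hA.dotProduct_mulVec_nonneg (Pi.single i 1 + Pi.single j 1)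
  have h2 := hA.dotProduct_mulVec_nonneg (Pi.single i 1 - Pi.single j 1)
  simp only [star_trivial, mulVec_add, mulVec_sub, add_dotProduct, sub_dotProduct, dotProduct_add,
    dotProduct_sub, mulVec_single_one, single_one_dotProduct, col_apply, hsym] at h1 h2
  have := hd i
  have := hd j
  rw [abs_le]
  constructor <;> linarith

lemma integrable_entry_of_trace_le {Ω : Type*} [MeasurableSpace Ω] {ν : Measure Ω}
    {W : Ω → Matrix n n ℝ} (hW : ∀ ω, (W ω).PosSemidef)
    (hm : ∀ i j, Measurable fun ω => W ω i j) {g : Ω → ℝ} (hg : Integrable g ν)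
    (hle : ∀ ω, (W ω).trace ≤ g ω) (i j : n) : Integrable (fun ω => W ω i j) ν :=
  hg.mono' (hm i j).aestronglyMeasurable
    (ae_of_all _ fun ω => (abs_entry_le_trace (hW ω) i j).trans (hle ω))

/-- The crude bound by the sum of the |λᵢ| is enough: it serves only to prove integrability. -/
lemma exists_posSemidef_smul_one_sub {H : Matrix n n ℝ} (hH : H.IsHermitian) :
    ∃ h : ℝ, (h • (1 : Matrix n n ℝ) - H).PosSemidef := by
  refine ⟨∑ i, |hH.eigenvalues i|, ?_⟩
  have h := posSemidef_cfc_sub (f := fun x => x) (g := fun _ => (∑ i, |hH.eigenvalues i|) * 1) hH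
    fun i => by
      rw [mul_one]
      exact (le_abs_self _).trans (Finset.single_le_sum (f := fun i => |hH.eigenvalues i|)
        (fun _ _ => abs_nonneg _) (Finset.mem_univ i))
  rwa [cfc_const_mul _ _ _ (continuousOn_spectrum _), cfc_one_matrix hH, cfc_id_matrix hH] at h

lemma trace_exp_smul_one_add {S : Matrix n n ℝ} (hS : S.IsHermitian) (h : ℝ) :
    (cfc Real.exp (h • (1 : Matrix n n ℝ) + S)).trace =
      Real.exp h * (cfc Real.exp S).trace := by
  have e : h • (1 : Matrix n n ℝ) + S = cfc (fun x : ℝ => h * 1 + x) S := by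
    rw [cfc_add _ _ _ (continuousOn_spectrum _) (continuousOn_spectrum _),
      cfc_const_mul _ _ _ (continuousOn_spectrum _), cfc_one_matrix hS, cfc_id_matrix hS]
  rw [e, ← cfc_comp_matrix hS]
  simp only [Real.exp_add, mul_one]
  rw [cfc_const_mul _ _ _ (continuousOn_spectrum _), Matrix.trace_smul, smul_eq_mul]

lemma isHermitian_smul_one (h : ℝ) : (h • (1 : Matrix n n ℝ)).IsHermitian := by
  simp [Matrix.IsHermitian]

lemma isHermitian_real_smul {A : Matrix n n ℝ} (hA : A.IsHermitian) (c : ℝ) :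
    (c • A).IsHermitian := by
  rw [Matrix.IsHermitian, conjTranspose_smul, star_trivial, hA.eq]

lemma trace_exp_add_le {H S : Matrix n n ℝ} (hH : H.IsHermitian) (hS : S.IsHermitian) {h : ℝ}
    (hh : (h • (1 : Matrix n n ℝ) - H).PosSemidef) :
    (cfc Real.exp (H + S)).trace ≤ Real.exp h * (cfc Real.exp S).trace := by
  rw [← trace_exp_smul_one_add hS]
  refine trace_exp_mono (hH.add hS) ((isHermitian_smul_one h).add hS) ?_
  convert hh using 1
  abel

lemma posSemidef_quadratic_sub_exp_influence {A : Matrix n n ℝ} (hA : A.IsHermitian) :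
    (1 + A + (2⁻¹ : ℝ) • (A * A) - cfc Real.exp (cfc influence A)).PosSemidef := by
  have h := posSemidef_cfc_sub (f := fun x => Real.exp (influence x))
    (g := fun x => 1 + x + 2⁻¹ * (x * x)) hA
    fun i => (exp_influence_le _).trans (le_of_eq (by ring))
  rwa [cfc_add A (fun x : ℝ => 1 + x) (fun x => 2⁻¹ * (x * x)) (continuousOn_spectrum _)
      (continuousOn_spectrum _),
    cfc_add A (fun _ : ℝ => (1 : ℝ)) (fun x => x) (continuousOn_spectrum _)
      (continuousOn_spectrum _),
    cfc_const_mul _ _ _ (continuousOn_spectrum _), cfc_mul _ _ _ (continuousOn_spectrum _)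
    (continuousOn_spectrum _), cfc_one_matrix hA, cfc_id_matrix hA, cfc_comp_matrix hA] at h

/-- One step of the matrix version of Catoni's argument. -/
theorem integral_trace_exp_add_influence_le {Ω : Type*} [MeasurableSpace Ω] {ν : Measure Ω}
    [IsProbabilityMeasure ν] {H : Matrix n n ℝ} (hH : H.IsHermitian) {Z : Ω → Matrix n n ℝ}
    (hZ : ∀ ω, (Z ω).IsHermitian) (hZm : ∀ i j, Measurable fun ω => Z ω i j)
    (hZi : ∀ i j, Integrable (fun ω => Z ω i j) ν)
    (hZ2 : ∀ i j, Integrable (fun ω => (Z ω * Z ω) i j) ν) {v : ℝ}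
    (hv : ∀ w : n → ℝ, w ⬝ᵥ expMat ν (fun ω => Z ω * Z ω) *ᵥ w ≤ v * (w ⬝ᵥ w)) (c : ℝ) :
    Integrable (fun ω => (cfc Real.exp (H + cfc influence (c • Z ω))).trace) ν ∧
    ∫ ω, (cfc Real.exp (H + cfc influence (c • Z ω))).trace ∂ν ≤
      Real.exp (c ^ 2 * v / 2) * (cfc Real.exp (H + c • expMat ν Z)).trace := by
  have hcZ : ∀ ω, (c • Z ω).IsHermitian := fun ω => isHermitian_real_smul (hZ ω) c
  have hcZm : ∀ i j, Measurable fun ω => (c • Z ω) i j := fun i j => (hZm i j).const_mul c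
  set S : Ω → Matrix n n ℝ := fun ω => cfc influence (c • Z ω) with hSdef
  have hS : ∀ ω, (S ω).IsHermitian := fun ω => isHermitian_cfc _ _
  have hSm : ∀ i j, Measurable fun ω => S ω i j :=
    (spectrallyMeasurable_of_continuous continuous_influence).measurable hcZ hcZm
  have hexp := spectrallyMeasurable_of_continuous (n := n) Real.continuous_exp
  set P : Ω → Matrix n n ℝ := fun ω => 1 + c • Z ω + (2⁻¹ : ℝ) • ((c • Z ω) * (c • Z ω)) with hP
  have hPe : ∀ ω i j, P ω i j =
      (1 : Matrix n n ℝ) i j + c * Z ω i j + 2⁻¹ * (c * (c * (Z ω * Z ω) i j)) := by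
    intro ω i j
    simp [hP, Matrix.add_apply]
  have hPi : ∀ i j, Integrable (fun ω => P ω i j) ν := fun i j => by
    simp only [hPe]
    exact ((integrable_const _).add ((hZi i j).const_mul c)).add
      ((((hZ2 i j).const_mul c).const_mul c).const_mul _)
  have hle : ∀ ω, (P ω - cfc Real.exp (S ω)).PosSemidef := fun ω =>
    posSemidef_quadratic_sub_exp_influence (hcZ ω)
  have htr : ∀ ω, (cfc Real.exp (S ω)).trace ≤ (P ω).trace := fun ω => by
    have := (hle ω).trace_nonneg
    rw [Matrix.trace_sub] at this
    linarith
  have hPt : Integrable (fun ω => (P ω).trace) ν := by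
    simpa using (trace_mul_expMat hPi 1).1
  -- Integrability comes from the quadratic bound `P` and second moments; no exponential moment of Z
  -- is needed.
  have hB : ∀ i j, Integrable (fun ω => cfc Real.exp (S ω) i j) ν :=
    integrable_entry_of_trace_le (fun ω => (posDef_cfc_exp (hS ω)).posSemidef)
      (hexp.measurable hS hSm) hPt htr
  obtain ⟨h, hh⟩ := exists_posSemidef_smul_one_sub hH
  have hX : ∀ i j, Integrable (fun ω => cfc Real.exp (H + S ω) i j) ν :=
    integrable_entry_of_trace_le (fun ω => (posDef_cfc_exp (hH.add (hS ω))).posSemidef)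
      (hexp.measurable (fun ω => hH.add (hS ω)) fun i j => (hSm i j).const_add _)
      (hPt.const_mul (Real.exp h)) fun ω => (trace_exp_add_le hH (hS ω) hh).trans
        (mul_le_mul_of_nonneg_left (htr ω) (Real.exp_pos h).le)
  refine ⟨by simpa using (trace_mul_expMat hX 1).1,
    (integral_trace_exp_add_le hH hS hX hB).trans ?_⟩
  have hM : (expMat ν Z).IsHermitian := isHermitian_expMat hZ
  have hEB : (expMat ν fun ω => cfc Real.exp (S ω)).IsHermitian :=
    isHermitian_expMat fun ω => isHermitian_cfc _ _
  have hK : (H + c • expMat ν Z).IsHermitian := hH.add (isHermitian_real_smul hM c)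
  -- Moving the scalar factor into the exponent as a multiple of the identity reduces the claim, by
  -- monotonicity of tr exp, to the Loewner inequality E e^S − 1 ≤ c E Z + (c² v / 2) · 1.
  rw [← trace_exp_smul_one_add hK]
  refine trace_exp_mono ((hH.add hEB).sub isHermitian_one) ((isHermitian_smul_one _).add hK) ?_
  refine PosSemidef.of_dotProduct_mulVec_nonneg
    (((isHermitian_smul_one _).add hK).sub ((hH.add hEB).sub isHermitian_one)) fun w => ?_
  have hq : w ⬝ᵥ expMat ν (fun ω => cfc Real.exp (S ω)) *ᵥ w ≤ w ⬝ᵥ expMat ν P *ᵥ w := by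
    rw [(dotProduct_expMat hB w w).2, (dotProduct_expMat hPi w w).2]
    refine integral_mono (dotProduct_expMat hB w w).1 (dotProduct_expMat hPi w w).1 fun ω => ?_
    have := (hle ω).dotProduct_mulVec_nonneg w
    rw [star_trivial, sub_mulVec, dotProduct_sub] at this
    simp only
    linarith
  have hEP : expMat ν P = 1 + c • expMat ν Z +
      (c ^ 2 / 2) • expMat ν (fun ω => Z ω * Z ω) := by
    ext i j
    simp only [expMat, of_apply, hPe, Matrix.add_apply, Matrix.smul_apply, smul_eq_mul]
    have i1 : Integrable (fun ω => (1 : Matrix n n ℝ) i j + c * Z ω i j) ν :=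
      (integrable_const _).add ((hZi i j).const_mul c)
    have i2 : Integrable (fun ω => 2⁻¹ * (c * (c * (Z ω * Z ω) i j))) ν :=
      (((hZ2 i j).const_mul c).const_mul c).const_mul _
    rw [integral_add i1 i2, integral_add (integrable_const _) ((hZi i j).const_mul c),
      integral_const_mul,
      integral_const_mul, integral_const_mul, integral_const_mul]
    simp only [integral_const, probReal_univ, one_smul]
    ring
  rw [hEP] at hq
  have hv' := mul_le_mul_of_nonneg_left (hv w) (by positivity : 0 ≤ c ^ 2 / 2)
  simp only [star_trivial, sub_mulVec, add_mulVec, smul_mulVec, one_mulVec, dotProduct_add,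
    dotProduct_sub, dotProduct_smul, smul_eq_mul] at hq ⊢
  linarith

end CatoniStep

/-! ### Moments of the noise under a joint law of arm and noise. -/

section NoiseKernel

open ProbabilityTheory

variable {α : Type*} [MeasurableSpace α]

/-- A measurable function that is almost everywhere bounded. -/
def BddAE (π : Measure α) (f : α → ℝ) : Prop := Measurable f ∧ ∃ K, ∀ᵐ x ∂π, |f x| ≤ K

namespace BddAE

variable {π : Measure α} {f g : α → ℝ}

lemma const (c : ℝ) : BddAE π fun _ => c := ⟨measurable_const, |c|, ae_of_all _ fun _ => le_rfl⟩

lemma add (hf : BddAE π f) (hg : BddAE π g) : BddAE π fun x => f x + g x := by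
  obtain ⟨mf, K, hK⟩ := hf
  obtain ⟨mg, L, hL⟩ := hg
  refine ⟨mf.add mg, K + L, ?_⟩
  filter_upwards [hK, hL] with x h1 h2 using (abs_add_le _ _).trans (add_le_add h1 h2)

lemma mul (hf : BddAE π f) (hg : BddAE π g) : BddAE π fun x => f x * g x := by
  obtain ⟨mf, K, hK⟩ := hf
  obtain ⟨mg, L, hL⟩ := hg
  refine ⟨mf.mul mg, K * L, ?_⟩
  filter_upwards [hK, hL] with x h1 h2
  rw [abs_mul]
  exact mul_le_mul h1 h2 (abs_nonneg _) ((abs_nonneg _).trans h1)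

lemma sum {ι : Type*} {s : Finset ι} {f : ι → α → ℝ} (hf : ∀ i ∈ s, BddAE π (f i)) :
    BddAE π fun x => ∑ i ∈ s, f i x := by
  classical
  induction s using Finset.induction_on with
  | empty => simpa using const 0
  | insert a s ha ih =>
    simp only [Finset.sum_insert ha]
    exact (hf _ (Finset.mem_insert_self _ _)).add
      (ih fun i hi => hf i (Finset.mem_insert_of_mem hi))

lemma integrable [IsFiniteMeasure π] (hf : BddAE π f) : Integrable f π := by
  obtain ⟨mf, K, hK⟩ := hf
  exact Integrable.of_bound mf.aestronglyMeasurable K hK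

lemma integrable_mul (hf : BddAE π f) (hg : Integrable g π) :
    Integrable (fun x => g x * f x) π := by
  obtain ⟨mf, K, hK⟩ := hf
  exact hg.mul_bdd mf.aestronglyMeasurable hK

end BddAE

/-- Under `κ x` the identity is, for almost every `x`, a centred variable with variance at most
`σ²`. -/
structure IsNoiseKernel (π : Measure α) (κ : Kernel α ℝ) (σ : ℝ) : Prop where
  mean : ∀ᵐ x ∂π, ∫ y, y ∂κ x = 0
  integrable_sq : ∀ᵐ x ∂π, Integrable (fun y => y ^ 2) (κ x)
  sq_le : ∀ᵐ x ∂π, ∫ y, y ^ 2 ∂κ x ≤ σ ^ 2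

variable {π : Measure α} [IsProbabilityMeasure π] {κ : Kernel α ℝ} [IsMarkovKernel κ] {σ : ℝ}

lemma map_fst_compProd : (π ⊗ₘ κ).map Prod.fst = π := by
  rw [← Measure.fst, Measure.fst_compProd]

lemma ae_fst_compProd {p : α → Prop} (h : ∀ᵐ x ∂π, p x) : ∀ᵐ z ∂(π ⊗ₘ κ), p z.1 := by
  have h' : ∀ᵐ x ∂((π ⊗ₘ κ).map Prod.fst), p x := by rwa [map_fst_compProd]
  exact ae_of_ae_map measurable_fst.aemeasurable h'

lemma BddAE.comp_fst {f : α → ℝ} (hf : BddAE π f) : BddAE (π ⊗ₘ κ) fun z => f z.1 := by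
  obtain ⟨mf, K, hK⟩ := hf
  exact ⟨mf.comp measurable_fst, K, ae_fst_compProd hK⟩

lemma BddAE.integral_comp_fst {f : α → ℝ} (hf : BddAE π f) :
    ∫ z, f z.1 ∂(π ⊗ₘ κ) = ∫ x, f x ∂π := by
  conv_rhs => rw [← map_fst_compProd (π := π) (κ := κ)]
  rw [integral_map measurable_fst.aemeasurable hf.1.aestronglyMeasurable]

namespace IsNoiseKernel

lemma integrable_snd_sq (h : IsNoiseKernel π κ σ) :
    Integrable (fun z : α × ℝ => z.2 ^ 2) (π ⊗ₘ κ) := by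
  have hm : Measurable fun z : α × ℝ => z.2 ^ 2 := by fun_prop
  rw [Measure.integrable_compProd_iff hm.aestronglyMeasurable]
  refine ⟨h.integrable_sq, ?_⟩
  refine Integrable.of_bound (C := σ ^ 2) ?_ ?_
  · exact (StronglyMeasurable.integral_kernel_prod_right'
      (f := fun z : α × ℝ => ‖z.2 ^ 2‖) hm.norm.stronglyMeasurable).aestronglyMeasurable
  · filter_upwards [h.sq_le] with x hx
    have : ∀ y : ℝ, ‖y ^ 2‖ = y ^ 2 := fun y => Real.norm_of_nonneg (sq_nonneg y)
    simp only [this]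
    rwa [Real.norm_of_nonneg (integral_nonneg fun y => sq_nonneg y)]

lemma integrable_snd (h : IsNoiseKernel π κ σ) :
    Integrable (fun z : α × ℝ => z.2) (π ⊗ₘ κ) := by
  refine ((integrable_const (1 : ℝ)).add h.integrable_snd_sq).mono'
    measurable_snd.aestronglyMeasurable (ae_of_all _ fun z => ?_)
  simp only [Real.norm_eq_abs, Pi.add_apply]
  rcases abs_cases z.2 with ⟨e, _⟩ | ⟨e, _⟩ <;> rw [e] <;>
    nlinarith [sq_nonneg (z.2 - 1), sq_nonneg (z.2 + 1)]

/-- The noise is centred on each fibre, so every term linear in it vanishes against a bounded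
function of the arm. -/
lemma integral_snd_mul (h : IsNoiseKernel π κ σ) {g : α → ℝ} (hg : BddAE π g) :
    ∫ z, z.2 * g z.1 ∂(π ⊗ₘ κ) = 0 := by
  rw [Measure.integral_compProd (hg.comp_fst.integrable_mul h.integrable_snd)]
  simp only [integral_mul_const]
  rw [integral_eq_zero_of_ae]
  filter_upwards [h.mean] with x hx
  simp [hx]

lemma integral_snd_sq_mul_le (h : IsNoiseKernel π κ σ) {g : α → ℝ} (hg : BddAE π g)
    (h0 : ∀ x, 0 ≤ g x) :
    ∫ z, z.2 ^ 2 * g z.1 ∂(π ⊗ₘ κ) ≤ σ ^ 2 * ∫ x, g x ∂π := by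
  have hi := hg.comp_fst.integrable_mul h.integrable_snd_sq
  rw [Measure.integral_compProd hi, ← integral_const_mul]
  refine integral_mono_ae hi.integral_compProd (hg.integrable.const_mul _) ?_
  filter_upwards [h.sq_le] with x hx
  simp only [integral_mul_const]
  exact mul_le_mul_of_nonneg_right hx (h0 x)

end IsNoiseKernel

end NoiseKernel

/-! ### Mean and second moment of the one-sample estimator. -/

section Moments

open Matrix ProbabilityTheory

variable {d₁ d₂ : ℕ} {𝒜 : Set (Matrix (Fin d₁) (Fin d₂) ℝ)}
  {π : Measure (Matrix (Fin d₁) (Fin d₂) ℝ)}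

lemma frobInner_eq_dotProduct (Θ A : Matrix (Fin d₁) (Fin d₂) ℝ) :
    frobInner Θ A = Θ.vec ⬝ᵥ A.vec := by
  rw [frobInner, vec_dotProduct_vec]

lemma measurable_matrix_iff {Ω : Type*} [MeasurableSpace Ω]
    {W : Ω → Matrix (Fin d₁) (Fin d₂) ℝ} :
    Measurable W ↔ ∀ i j, Measurable fun ω => W ω i j := by
  constructor
  · intro h i j
    exact (measurable_pi_apply j).comp ((measurable_pi_apply i).comp h)
  · intro h
    exact measurable_pi_lambda _ fun i => measurable_pi_lambda _ fun j => h i j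

/-- The reshaped whitened arm `Q⁻¹ vec(X)`. -/
noncomputable def whiten (Q : Matrix (Fin d₂ × Fin d₁) (Fin d₂ × Fin d₁) ℝ)
    (X : Matrix (Fin d₁) (Fin d₂) ℝ) :
    Matrix (Fin d₁) (Fin d₂) ℝ :=
  Matrix.of fun i j => (Q⁻¹ (j, i)) ⬝ᵥ X.vec

lemma oneSample_eq (Q : Matrix (Fin d₂ × Fin d₁) (Fin d₂ × Fin d₁) ℝ)
    (Θ₀ X : Matrix (Fin d₁) (Fin d₂) ℝ) (y : ℝ) :
    oneSample Q Θ₀ X y = (y - frobInner Θ₀ X) • whiten Q X := by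
  ext i j
  simp only [oneSample, whiten, of_apply, mulVec_smul, Pi.smul_apply, Matrix.smul_apply]
  rfl

lemma isHermitian_dilation (M : Matrix (Fin d₁) (Fin d₂) ℝ) : (dilation M).IsHermitian := by
  rw [dilation, Matrix.isHermitian_fromBlocks_iff]
  simp [conjTranspose_eq_transpose_of_trivial]

lemma dilation_smul (c : ℝ) (M : Matrix (Fin d₁) (Fin d₂) ℝ) :
    dilation (c • M) = c • dilation M := by
  simp [dilation, fromBlocks_smul]

lemma dilation_mul_self (M : Matrix (Fin d₁) (Fin d₂) ℝ) :
    dilation M * dilation M = fromBlocks (M * Mᵀ) 0 0 (Mᵀ * M) := by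
  simp [dilation, fromBlocks_multiply]

lemma abs_entry_le_opNorm (A : Matrix (Fin d₁) (Fin d₂) ℝ) (i : Fin d₁) (j : Fin d₂) :
    |A i j| ≤ opNorm A := by
  have h := Matrix.l2_opNorm_mulVec A (EuclideanSpace.single j (1 : ℝ))
  have h2 := PiLp.norm_apply_le ((EuclideanSpace.equiv (Fin d₁) ℝ).symm
    (A *ᵥ (EuclideanSpace.single j (1 : ℝ)).ofLp)) i
  have h3 := h2.trans h
  simpa [opNorm, mulVec_single] using h3

lemma IsDesign.bddAE_entry (hπ : IsDesign 𝒜 π) (h𝒜 : ∀ a ∈ 𝒜, opNorm a ≤ 1) (i : Fin d₁)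
    (j : Fin d₂) : BddAE π fun A => A i j := by
  refine ⟨measurable_matrix_iff.1 measurable_id i j, 1, ?_⟩
  filter_upwards [hπ.ae_mem] with A hA using (abs_entry_le_opNorm A i j).trans (h𝒜 A hA)

lemma IsDesign.bddAE_dotProduct_vec (hπ : IsDesign 𝒜 π) (h𝒜 : ∀ a ∈ 𝒜, opNorm a ≤ 1)
    (a : Fin d₂ × Fin d₁ → ℝ) : BddAE π fun A => a ⬝ᵥ A.vec :=
  BddAE.sum fun p _ => (BddAE.const (a p)).mul (hπ.bddAE_entry h𝒜 p.2 p.1)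

lemma IsDesign.integral_dotProduct_mul (hπ : IsDesign 𝒜 π) (h𝒜 : ∀ a ∈ 𝒜, opNorm a ≤ 1)
    (a b : Fin d₂ × Fin d₁ → ℝ) :
    ∫ A, (a ⬝ᵥ A.vec) * (b ⬝ᵥ A.vec) ∂π = a ⬝ᵥ covMatrix π *ᵥ b := by
  have := hπ.isProbabilityMeasure
  have h := (dotProduct_expMat (ν := π) (W := fun A => vecMulVec A.vec A.vec) (fun p q =>
    ((hπ.bddAE_entry h𝒜 p.2 p.1).mul (hπ.bddAE_entry h𝒜 q.2 q.1)).integrable) a b).2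
  have e : covMatrix π = expMat π fun A => vecMulVec A.vec A.vec := rfl
  rw [e, h]
  refine integral_congr_ae (ae_of_all _ fun A => ?_)
  simp only [vecMulVec_mulVec, dotProduct_comm b]
  simp [dotProduct_smul, mul_comm]

/-- Q⁻¹ Q a = a. This is the unbiasedness of the one-sample estimator; with a row of Q⁻¹ as `a` it
gives the second moments of the whitened arm. -/
lemma IsDesign.integral_dotProduct_mul_whiten (hπ : IsDesign 𝒜 π)
    (h𝒜 : ∀ a ∈ 𝒜, opNorm a ≤ 1) (a : Fin d₂ × Fin d₁ → ℝ) (i : Fin d₁) (j : Fin d₂) :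
    ∫ A, (a ⬝ᵥ A.vec) * whiten (covMatrix π) A i j ∂π = a (j, i) := by
  simp only [whiten, of_apply]
  rw [hπ.integral_dotProduct_mul h𝒜, dotProduct_mulVec, dotProduct_comm, ← mulVec_transpose]
  have hs : (covMatrix π)ᵀ = covMatrix π := by
    rw [← conjTranspose_eq_transpose_of_trivial]; exact hπ.posDef.1
  have hu : IsUnit (covMatrix π).det := hπ.posDef.det_pos.ne'.isUnit
  rw [hs]
  change ((covMatrix π)⁻¹ *ᵥ covMatrix π *ᵥ a) (j, i) = a (j, i)
  rw [mulVec_mulVec, nonsing_inv_mul _ hu, one_mulVec]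

lemma IsDesign.integral_whiten_mul_whiten (hπ : IsDesign 𝒜 π)
    (h𝒜 : ∀ a ∈ 𝒜, opNorm a ≤ 1) (i i' : Fin d₁) (j j' : Fin d₂) :
    ∫ A, whiten (covMatrix π) A i j * whiten (covMatrix π) A i' j' ∂π =
      (covMatrix π)⁻¹ (j, i) (j', i') :=
  hπ.integral_dotProduct_mul_whiten h𝒜 _ i' j'

lemma IsDesign.bddAE_whiten (hπ : IsDesign 𝒜 π) (h𝒜 : ∀ a ∈ 𝒜, opNorm a ≤ 1)
    (Q : Matrix (Fin d₂ × Fin d₁) (Fin d₂ × Fin d₁) ℝ) (i : Fin d₁) (j : Fin d₂) :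
    BddAE π fun A => whiten Q A i j :=
  hπ.bddAE_dotProduct_vec h𝒜 _

lemma IsDesign.bddAE_dilation_whiten (hπ : IsDesign 𝒜 π) (h𝒜 : ∀ a ∈ 𝒜, opNorm a ≤ 1)
    (Q : Matrix (Fin d₂ × Fin d₁) (Fin d₂ × Fin d₁) ℝ) (p q : Fin d₁ ⊕ Fin d₂) :
    BddAE π fun A => dilation (whiten Q A) p q := by
  rcases p with i | j <;> rcases q with i' | j' <;> simp only [dilation, fromBlocks_apply₁₁,
    fromBlocks_apply₁₂, fromBlocks_apply₂₁, fromBlocks_apply₂₂, transpose_apply, Matrix.zero_apply]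
  · exact BddAE.const 0
  · exact hπ.bddAE_whiten h𝒜 Q i j'
  · exact hπ.bddAE_whiten h𝒜 Q i' j
  · exact BddAE.const 0

lemma IsDesign.bddAE_dilation_whiten_sq (hπ : IsDesign 𝒜 π) (h𝒜 : ∀ a ∈ 𝒜, opNorm a ≤ 1)
    (Q : Matrix (Fin d₂ × Fin d₁) (Fin d₂ × Fin d₁) ℝ) (p q : Fin d₁ ⊕ Fin d₂) :
    BddAE π fun A => (dilation (whiten Q A) * dilation (whiten Q A)) p q := by
  simp only [Matrix.mul_apply]
  exact BddAE.sum fun k _ =>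
    (hπ.bddAE_dilation_whiten h𝒜 Q p k).mul (hπ.bddAE_dilation_whiten h𝒜 Q k q)

lemma dotProduct_mulVec_le_lambdaMax {k : ℕ} {M : Matrix (Fin k) (Fin k) ℝ} (hM : M.IsHermitian)
    (w : Fin k → ℝ) : w ⬝ᵥ M *ᵥ w ≤ lambdaMax M * (w ⬝ᵥ w) := by
  have h := posSemidef_cfc_sub (f := fun x => x) (g := fun _ => lambdaMax M * 1) hM fun i => by
    rw [mul_one]
    exact le_csSup (Matrix.finite_real_spectrum).bddAbove (hM.eigenvalues_mem_spectrum_real i)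
  rw [cfc_const_mul _ _ _ (continuousOn_spectrum _), cfc_one_matrix hM, cfc_id_matrix hM] at h
  have := h.dotProduct_mulVec_nonneg w
  simp only [star_trivial, sub_mulVec, smul_mulVec, one_mulVec, dotProduct_sub, dotProduct_smul,
    smul_eq_mul] at this
  linarith

/-- The square of a dilation has diagonal blocks W Wᵀ and Wᵀ W, and the whitened arm has covariance
Q⁻¹. This is the origin of the two block sums in `designB`. -/
lemma IsDesign.expMat_dilation_whiten_sq (hπ : IsDesign 𝒜 π) (h𝒜 : ∀ a ∈ 𝒜, opNorm a ≤ 1) :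
    expMat π (fun A => dilation (whiten (covMatrix π) A) * dilation (whiten (covMatrix π) A)) =
      fromBlocks (∑ i, colBlock (covMatrix π) i) 0 0 (∑ j, rowBlock (covMatrix π) j) := by
  have := hπ.isProbabilityMeasure
  have hb := hπ.bddAE_whiten h𝒜 (covMatrix π)
  ext p q
  simp only [expMat, of_apply, dilation_mul_self]
  rcases p with i | j <;> rcases q with i' | j' <;> simp only [fromBlocks_apply₁₁,
    fromBlocks_apply₁₂, fromBlocks_apply₂₁, fromBlocks_apply₂₂, transpose_apply, Matrix.zero_apply,
    Matrix.mul_apply, integral_zero, Matrix.sum_apply, colBlock, rowBlock, submatrix_apply]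
  · rw [integral_finsetSum _ fun k _ => ((hb i k).mul (hb i' k)).integrable]
    exact Finset.sum_congr rfl fun k _ => hπ.integral_whiten_mul_whiten h𝒜 _ _ _ _
  · rw [integral_finsetSum _ fun k _ => ((hb k j).mul (hb k j')).integrable]
    exact Finset.sum_congr rfl fun k _ => hπ.integral_whiten_mul_whiten h𝒜 _ _ _ _

lemma isHermitian_inv_covMatrix (hπ : IsDesign 𝒜 π) : ((covMatrix π)⁻¹).IsHermitian :=
  hπ.posDef.1.inv

lemma isHermitian_sum_colBlock (hπ : IsDesign 𝒜 π) :
    (∑ i, colBlock (covMatrix π) i).IsHermitian := by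
  ext k l
  simp only [conjTranspose_apply, Matrix.sum_apply, star_trivial, colBlock, submatrix_apply]
  exact Finset.sum_congr rfl fun i _ => by
    simpa using (isHermitian_inv_covMatrix hπ).apply (i, k) (i, l)

lemma isHermitian_sum_rowBlock (hπ : IsDesign 𝒜 π) :
    (∑ j, rowBlock (covMatrix π) j).IsHermitian := by
  ext k l
  simp only [conjTranspose_apply, Matrix.sum_apply, star_trivial, rowBlock, submatrix_apply]
  exact Finset.sum_congr rfl fun i _ => by
    simpa using (isHermitian_inv_covMatrix hπ).apply (k, i) (l, i)

lemma IsDesign.dotProduct_expMat_dilation_whiten_le (hπ : IsDesign 𝒜 π)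
    (h𝒜 : ∀ a ∈ 𝒜, opNorm a ≤ 1) (w : Fin d₁ ⊕ Fin d₂ → ℝ) :
    w ⬝ᵥ expMat π (fun A => dilation (whiten (covMatrix π) A) *
      dilation (whiten (covMatrix π) A)) *ᵥ w ≤ designB (covMatrix π) * (w ⬝ᵥ w) := by
  rw [hπ.expMat_dilation_whiten_sq h𝒜, fromBlocks_mulVec]
  obtain ⟨u, v, rfl⟩ : ∃ u v, w = Sum.elim u v :=
    ⟨w ∘ Sum.inl, w ∘ Sum.inr, (Sum.elim_comp_inl_inr w).symm⟩
  simp only [Sum.elim_comp_inl, Sum.elim_comp_inr, zero_mulVec, add_zero, zero_add,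
    sumElim_dotProduct_sumElim]
  have h1 := dotProduct_mulVec_le_lambdaMax (isHermitian_sum_colBlock hπ) u
  have h2 := dotProduct_mulVec_le_lambdaMax (isHermitian_sum_rowBlock hπ) v
  have h3 := mul_le_mul_of_nonneg_right (le_max_left (lambdaMax (∑ i, colBlock (covMatrix π) i))
    (lambdaMax (∑ j, rowBlock (covMatrix π) j))) (dotProduct_self_star_nonneg u)
  have h4 := mul_le_mul_of_nonneg_right (le_max_right (lambdaMax (∑ i, colBlock (covMatrix π) i))
    (lambdaMax (∑ j, rowBlock (covMatrix π) j))) (dotProduct_self_star_nonneg v)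
  simp only [star_trivial] at h3 h4
  rw [designB]
  linarith

variable {κ : Kernel (Matrix (Fin d₁) (Fin d₂) ℝ) ℝ} [IsMarkovKernel κ] {σ R₀ : ℝ}
  {Θ Θ₀ : Matrix (Fin d₁) (Fin d₂) ℝ}

/-- The dilated one-sample estimator as a function of the arm and of the noise. -/
noncomputable def sampleDilation (Q : Matrix (Fin d₂ × Fin d₁) (Fin d₂ × Fin d₁) ℝ)
    (Θ Θ₀ : Matrix (Fin d₁) (Fin d₂) ℝ) (z : Matrix (Fin d₁) (Fin d₂) ℝ × ℝ) :
    Matrix (Fin d₁ ⊕ Fin d₂) (Fin d₁ ⊕ Fin d₂) ℝ :=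
  dilation (oneSample Q Θ₀ z.1 (frobInner Θ z.1 + z.2))

lemma sampleDilation_eq (Q : Matrix (Fin d₂ × Fin d₁) (Fin d₂ × Fin d₁) ℝ)
    (Θ Θ₀ : Matrix (Fin d₁) (Fin d₂) ℝ) (z : Matrix (Fin d₁) (Fin d₂) ℝ × ℝ) :
    sampleDilation Q Θ Θ₀ z = ((Θ - Θ₀).vec ⬝ᵥ z.1.vec + z.2) • dilation (whiten Q z.1) := by
  rw [sampleDilation, oneSample_eq, dilation_smul, frobInner_eq_dotProduct,
    frobInner_eq_dotProduct, vec_sub, sub_dotProduct]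
  congr 1
  ring

/-- The signal part is exact by whitening and the noise part averages to zero. -/
lemma IsDesign.expMat_sampleDilation (hπ : IsDesign 𝒜 π) (h𝒜 : ∀ a ∈ 𝒜, opNorm a ≤ 1)
    (hκ : IsNoiseKernel π κ σ) :
    (∀ i j, Integrable (fun z => sampleDilation (covMatrix π) Θ Θ₀ z i j) (π ⊗ₘ κ)) ∧
    expMat (π ⊗ₘ κ) (sampleDilation (covMatrix π) Θ Θ₀) = dilation (Θ - Θ₀) := by
  have := hπ.isProbabilityMeasure
  have hd := hπ.bddAE_dotProduct_vec h𝒜 (Θ - Θ₀).vec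
  have hw := hπ.bddAE_dilation_whiten h𝒜 (covMatrix π)
  have e : ∀ i j z, sampleDilation (covMatrix π) Θ Θ₀ z i j =
      ((Θ - Θ₀).vec ⬝ᵥ z.1.vec) * dilation (whiten (covMatrix π) z.1) i j +
        z.2 * dilation (whiten (covMatrix π) z.1) i j := by
    intro i j z
    rw [sampleDilation_eq, Matrix.smul_apply, smul_eq_mul, add_mul]
  have i1 := fun i j => ((hd.mul (hw i j)).comp_fst (κ := κ)).integrable
  have i2 := fun i j => (hw i j).comp_fst.integrable_mul hκ.integrable_snd
  refine ⟨fun i j => by simp only [e]; exact (i1 i j).add (i2 i j), ?_⟩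
  ext p q
  simp only [expMat, of_apply, e]
  rw [integral_add (i1 p q) (i2 p q), hκ.integral_snd_mul (hw p q), add_zero,
    (hd.mul (hw p q)).integral_comp_fst]
  rcases p with i | j <;> rcases q with i' | j' <;> simp only [dilation, fromBlocks_apply₁₁,
    fromBlocks_apply₁₂, fromBlocks_apply₂₁, fromBlocks_apply₂₂, transpose_apply, Matrix.zero_apply,
    mul_zero, integral_zero]
  · exact hπ.integral_dotProduct_mul_whiten h𝒜 _ _ _
  · exact hπ.integral_dotProduct_mul_whiten h𝒜 _ _ _

lemma dotProduct_mul_self_nonneg {n : Type*} [Fintype n] {D : Matrix n n ℝ} (hD : D.IsHermitian)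
    (w : n → ℝ) : 0 ≤ w ⬝ᵥ (D * D) *ᵥ w := by
  have h := (posSemidef_conjTranspose_mul_self D).dotProduct_mulVec_nonneg w
  rwa [hD.eq, star_trivial] at h

/-- The sample is (s + η) D, where s is the pilot's residual on the arm. In E (s + η)² D² the cross
term vanishes, s² ≤ R₀², and η² contributes at most σ². -/
lemma IsDesign.expMat_sampleDilation_sq (hπ : IsDesign 𝒜 π) (h𝒜 : ∀ a ∈ 𝒜, opNorm a ≤ 1)
    (hκ : IsNoiseKernel π κ σ) (hR : ∀ a ∈ 𝒜, |frobInner (Θ - Θ₀) a| ≤ R₀) :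
    (∀ i j, Integrable (fun z => (sampleDilation (covMatrix π) Θ Θ₀ z *
      sampleDilation (covMatrix π) Θ Θ₀ z) i j) (π ⊗ₘ κ)) ∧
    ∀ w, w ⬝ᵥ expMat (π ⊗ₘ κ) (fun z => sampleDilation (covMatrix π) Θ Θ₀ z *
      sampleDilation (covMatrix π) Θ Θ₀ z) *ᵥ w ≤
        (σ ^ 2 + R₀ ^ 2) * designB (covMatrix π) * (w ⬝ᵥ w) := by
  have := hπ.isProbabilityMeasure
  have hd := hπ.bddAE_dotProduct_vec h𝒜 (Θ - Θ₀).vec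
  have hw := hπ.bddAE_dilation_whiten_sq h𝒜 (covMatrix π)
  set D := fun A => dilation (whiten (covMatrix π) A) with hD
  have e : ∀ z, sampleDilation (covMatrix π) Θ Θ₀ z * sampleDilation (covMatrix π) Θ Θ₀ z =
      (((Θ - Θ₀).vec ⬝ᵥ z.1.vec) * ((Θ - Θ₀).vec ⬝ᵥ z.1.vec) +
        z.2 * (2 * ((Θ - Θ₀).vec ⬝ᵥ z.1.vec)) + z.2 ^ 2) • (D z.1 * D z.1) := by
    intro z
    rw [sampleDilation_eq, Matrix.smul_mul, Matrix.mul_smul, smul_smul]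
    congr 1
    ring
  -- Stated for a general weight because it has two uses: matrix entries, which have no sign, for
  -- integrability, and the quadratic form of D², which is nonnegative, for the bound.
  have key : ∀ f : Matrix (Fin d₁) (Fin d₂) ℝ → ℝ, BddAE π f →
      Integrable (fun z : Matrix (Fin d₁) (Fin d₂) ℝ × ℝ =>
        (((Θ - Θ₀).vec ⬝ᵥ z.1.vec) * ((Θ - Θ₀).vec ⬝ᵥ z.1.vec) +
        z.2 * (2 * ((Θ - Θ₀).vec ⬝ᵥ z.1.vec)) + z.2 ^ 2) * f z.1) (π ⊗ₘ κ) ∧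
      ((∀ x, 0 ≤ f x) → ∫ z, (((Θ - Θ₀).vec ⬝ᵥ z.1.vec) * ((Θ - Θ₀).vec ⬝ᵥ z.1.vec) +
        z.2 * (2 * ((Θ - Θ₀).vec ⬝ᵥ z.1.vec)) + z.2 ^ 2) * f z.1 ∂(π ⊗ₘ κ) ≤
        (σ ^ 2 + R₀ ^ 2) * ∫ x, f x ∂π) := by
    intro f hf
    have b1 := (hd.mul hd).mul hf
    have b2 := ((BddAE.const 2).mul hd).mul hf
    have i1 := (b1.comp_fst (κ := κ)).integrable
    have i2 := b2.comp_fst.integrable_mul hκ.integrable_snd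
    have i3 := hf.comp_fst.integrable_mul hκ.integrable_snd_sq
    have e' : ∀ z : Matrix (Fin d₁) (Fin d₂) ℝ × ℝ,
        (((Θ - Θ₀).vec ⬝ᵥ z.1.vec) * ((Θ - Θ₀).vec ⬝ᵥ z.1.vec) +
          z.2 * (2 * ((Θ - Θ₀).vec ⬝ᵥ z.1.vec)) + z.2 ^ 2) * f z.1 =
        ((Θ - Θ₀).vec ⬝ᵥ z.1.vec) * ((Θ - Θ₀).vec ⬝ᵥ z.1.vec) * f z.1 +
          z.2 * (2 * ((Θ - Θ₀).vec ⬝ᵥ z.1.vec) * f z.1) + z.2 ^ 2 * f z.1 := by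
      intro z
      ring
    simp only [e']
    refine ⟨(i1.add i2).add i3, fun h0 => ?_⟩
    refine (integral_add (i1.add i2) i3).le.trans ?_
    have s1 := integral_add i1 i2
    rw [hκ.integral_snd_mul b2, add_zero, b1.integral_comp_fst] at s1
    have s2 : ∫ x, ((Θ - Θ₀).vec ⬝ᵥ x.vec) * ((Θ - Θ₀).vec ⬝ᵥ x.vec) * f x ∂π ≤
        R₀ ^ 2 * ∫ x, f x ∂π := by
      rw [← integral_const_mul]
      refine integral_mono_ae b1.integrable (hf.integrable.const_mul _) ?_
      filter_upwards [hπ.ae_mem] with x hx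
      refine mul_le_mul_of_nonneg_right ?_ (h0 x)
      have hx' := hR x hx
      rw [frobInner_eq_dotProduct] at hx'
      rw [← sq]
      exact sq_le_sq' (abs_le.1 hx').1 (abs_le.1 hx').2
    have s3 := hκ.integral_snd_sq_mul_le hf h0
    exact (add_le_add (s1.le.trans s2) s3).trans (le_of_eq (by ring))
  have hint : ∀ i j, Integrable (fun z => (sampleDilation (covMatrix π) Θ Θ₀ z *
      sampleDilation (covMatrix π) Θ Θ₀ z) i j) (π ⊗ₘ κ) := fun i j => by
    simp only [e, Matrix.smul_apply, smul_eq_mul]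
    exact (key _ (hw i j)).1
  refine ⟨hint, fun w => ?_⟩
  rw [(dotProduct_expMat hint w w).2]
  simp only [e, smul_mulVec, dotProduct_smul, smul_eq_mul]
  have hq : BddAE π fun A => w ⬝ᵥ (D A * D A) *ᵥ w := by
    simp only [dotProduct, mulVec]
    exact BddAE.sum fun p _ => (BddAE.const (w p)).mul
      (BddAE.sum fun q _ => (hw p q).mul (BddAE.const (w q)))
  refine ((key _ hq).2 fun A => dotProduct_mul_self_nonneg (isHermitian_dilation _) w).trans ?_
  rw [mul_assoc]
  refine mul_le_mul_of_nonneg_left ?_ (by positivity)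
  rw [← (dotProduct_expMat (fun p q => (hw p q).integrable) w w).2]
  exact hπ.dotProduct_expMat_dilation_whiten_le h𝒜 w

end Moments

/-! ### Conditioning on the past, and variance from subgaussianity. -/

section Disintegration

open ProbabilityTheory
open scoped ENNReal

/-- If `X` is independent of `h` and, conditionally on `(h, X)`, the noise `η` is centred with
variance at most `σ²`, then given `h` the pair `(X, η)` is distributed according to a noise kernel
over the law of `X`. -/
theorem lintegral_le_of_noise {Ω 𝓗 α : Type*} {mΩ : MeasurableSpace Ω} {m𝓗 : MeasurableSpace 𝓗}
    {mα : MeasurableSpace α} {μ : Measure Ω} [IsProbabilityMeasure μ] {π : Measure α}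
    [IsProbabilityMeasure π] {h : Ω → 𝓗} {X : Ω → α} {η : Ω → ℝ} {σ : ℝ} (hh : Measurable h)
    (hX : Measurable X) (hη : Measurable η) (hind : IndepFun h X μ) (hlaw : μ.map X = π)
    (hηi : Integrable η μ) (hη2 : Integrable (fun ω => η ω ^ 2) μ)
    (hmean : μ[η | MeasurableSpace.comap (fun ω => (h ω, X ω)) inferInstance] =ᵐ[μ] 0)
    (hsq : ∀ᵐ ω ∂μ, (μ[fun ω => η ω ^ 2 |
      MeasurableSpace.comap (fun ω => (h ω, X ω)) inferInstance]) ω ≤ σ ^ 2)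
    {F : 𝓗 → α × ℝ → ℝ≥0∞} (hF : Measurable fun p : 𝓗 × (α × ℝ) => F p.1 p.2) {G : 𝓗 → ℝ≥0∞}
    (hFG : ∀ (a : 𝓗) (κ : Kernel α ℝ) [IsMarkovKernel κ], IsNoiseKernel π κ σ →
      ∫⁻ z, F a z ∂(π ⊗ₘ κ) ≤ G a) :
    ∫⁻ ω, F (h ω) (X ω, η ω) ∂μ ≤ ∫⁻ ω, G (h ω) ∂μ := by
  have hhX : Measurable fun ω => (h ω, X ω) := hh.prodMk hX
  -- Only the real-valued noise is disintegrated, so the space of the past may be an arbitrary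
  -- measurable space. Independence makes the law of (past, arm) a product with π.
  set κ : Kernel (𝓗 × α) ℝ := condDistrib η (fun ω => (h ω, X ω)) μ with hκ
  have hprod : μ.map (fun ω => (h ω, X ω)) = (μ.map h).prod π := by
    rw [← hlaw]
    exact (indepFun_iff_map_prod_eq_prod_map_map hh.aemeasurable hX.aemeasurable).1 hind
  have : IsProbabilityMeasure (μ.map h) := Measure.isProbabilityMeasure_map hh.aemeasurable
  have hjoint : μ.map (fun ω => ((h ω, X ω), η ω)) = ((μ.map h).prod π) ⊗ₘ κ := by
    rw [← hprod, hκ, compProd_map_condDistrib hη.aemeasurable]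
  have m1 : StronglyMeasurable fun p => ∫ y, y ∂κ p :=
    StronglyMeasurable.integral_kernel_prod_right' (f := fun z : (𝓗 × α) × ℝ => z.2)
      measurable_snd.stronglyMeasurable
  have m2 : StronglyMeasurable fun p => ∫ y, y ^ 2 ∂κ p :=
    StronglyMeasurable.integral_kernel_prod_right' (f := fun z : (𝓗 × α) × ℝ => z.2 ^ 2)
      (measurable_snd.pow_const 2).stronglyMeasurable
  have k1 : ∀ᵐ p ∂((μ.map h).prod π), ∫ y, y ∂κ p = 0 := by
    rw [← hprod]
    refine (ae_map_iff hhX.aemeasurable (m1.measurable (measurableSet_singleton 0))).2 ?_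
    filter_upwards [hmean, condExp_ae_eq_integral_condDistrib hhX hη.aemeasurable
      (f := fun y => y) measurable_id.stronglyMeasurable hηi] with ω e1 e2
    exact e2.symm.trans e1
  have k2 : ∀ᵐ p ∂((μ.map h).prod π), ∫ y, y ^ 2 ∂κ p ≤ σ ^ 2 := by
    rw [← hprod]
    refine (ae_map_iff hhX.aemeasurable (m2.measurable (measurableSet_Iic (a := σ ^ 2)))).2 ?_
    filter_upwards [hsq, condExp_ae_eq_integral_condDistrib hhX hη.aemeasurable
      (f := fun y => y ^ 2) (measurable_id.pow_const 2).stronglyMeasurable hη2] with ω e1 e2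
    exact e2.symm.le.trans e1
  have k3 : ∀ᵐ p ∂((μ.map h).prod π), Integrable (fun y => y ^ 2) (κ p) := by
    rw [← hprod]
    refine Integrable.condDistrib_ae_map (f := fun z : (𝓗 × α) × ℝ => z.2 ^ 2)
      hη.aemeasurable ?_
    rw [integrable_map_measure (measurable_snd.pow_const 2).aestronglyMeasurable
      (hhX.prodMk hη).aemeasurable]
    exact hη2
  have hF' : Measurable fun z : (𝓗 × α) × ℝ => F z.1.1 (z.1.2, z.2) :=
    hF.comp (measurable_fst.fst.prodMk (measurable_fst.snd.prodMk measurable_snd))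
  calc ∫⁻ ω, F (h ω) (X ω, η ω) ∂μ
      = ∫⁻ z, F z.1.1 (z.1.2, z.2) ∂(μ.map (fun ω => ((h ω, X ω), η ω))) :=
        (lintegral_map hF' (hhX.prodMk hη)).symm
    _ = ∫⁻ a, ∫⁻ x, ∫⁻ y, F a (x, y) ∂κ (a, x) ∂π ∂(μ.map h) := by
        rw [hjoint, Measure.lintegral_compProd hF', lintegral_prod]
        exact (Measurable.lintegral_kernel_prod_right' hF').aemeasurable
    _ ≤ ∫⁻ a, G a ∂(μ.map h) := by
        refine lintegral_mono_ae ?_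
        -- For almost every past a, the section κ(a, ·) is a noise kernel over π, so the hypothesis
        -- on F and G applies fibrewise.
        filter_upwards [Measure.ae_ae_of_ae_prod k1, Measure.ae_ae_of_ae_prod k2,
          Measure.ae_ae_of_ae_prod k3] with a a1 a2 a3
        have hm : Measurable fun x : α => (a, x) := measurable_prodMk_left
        refine le_of_eq_of_le ?_ (hFG a (κ.comap (fun x => (a, x)) hm) ⟨?_, ?_, ?_⟩)
        · exact (Measure.lintegral_compProd (f := F a) (μ := π)
            (κ := κ.comap (fun x => (a, x)) hm) (hF.comp measurable_prodMk_left)).symm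
        · simpa only [Kernel.comap_apply] using a1
        · simpa only [Kernel.comap_apply] using a3
        · simpa only [Kernel.comap_apply] using a2
    _ ≤ ∫⁻ ω, G (h ω) ∂μ := lintegral_map_le _ _

lemma exp_le_quadratic {x : ℝ} (hx : |x| ≤ 1) : Real.exp x ≤ 1 + x + x ^ 2 := by
  have h := Real.abs_exp_sub_one_sub_id_le hx
  have := (abs_le.1 h).2
  linarith

/-- 2 cosh u − 2 = 4 sinh²(u/2) ≥ u². It extracts the second moment from the exponential moments at
±s. -/
lemma sq_mul_sq_le_exp (s y : ℝ) :
    s ^ 2 * y ^ 2 ≤ Real.exp (s * y) + Real.exp (-s * y) - 2 := by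
  have h1 : |s * y / 2| ≤ |Real.sinh (s * y / 2)| := by
    rw [Real.abs_sinh]
    exact Real.self_le_sinh_iff.2 (abs_nonneg _)
  have h2 := sq_le_sq.2 h1
  have h3 : Real.exp (s * y) + Real.exp (-s * y) - 2 = 4 * Real.sinh (s * y / 2) ^ 2 := by
    have e1 : Real.exp (s * y) = Real.exp (s * y / 2) ^ 2 := by rw [← Real.exp_nat_mul]; ring_nf
    have e2 : Real.exp (-s * y) = Real.exp (-(s * y / 2)) ^ 2 := by
      rw [← Real.exp_nat_mul]; ring_nf
    have e3 : Real.exp (s * y / 2) * Real.exp (-(s * y / 2)) = 1 := by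
      rw [← Real.exp_add, add_neg_cancel, Real.exp_zero]
    rw [e1, e2, Real.sinh_eq]
    linear_combination 2 * e3
  rw [h3]
  linarith

/-- A conditionally subgaussian variable has conditional variance at most `σ²`. -/
lemma condExp_sq_le_of_subgaussian {Ω : Type*} {m mΩ : MeasurableSpace Ω} {μ : Measure Ω}
    [IsProbabilityMeasure μ] (hm : m ≤ mΩ) {η : Ω → ℝ} (hη : Measurable η) {σ : ℝ}
    (hi : ∀ s : ℝ, Integrable (fun ω => Real.exp (s * η ω)) μ)
    (hle : ∀ s : ℝ, ∀ᵐ ω ∂μ, (μ[fun ω => Real.exp (s * η ω) | m]) ω ≤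
      Real.exp (σ ^ 2 * s ^ 2 / 2)) :
    Integrable (fun ω => η ω ^ 2) μ ∧ ∀ᵐ ω ∂μ, (μ[fun ω => η ω ^ 2 | m]) ω ≤ σ ^ 2 := by
  have hint : ∀ s : ℝ, Integrable
      (fun ω => Real.exp (s * η ω) + Real.exp (-s * η ω) - 2) μ := fun s =>
    ((hi s).add (hi (-s))).sub (integrable_const _)
  have h2 : Integrable (fun ω => η ω ^ 2) μ := by
    refine (hint 1).mono' (hη.pow_const 2).aestronglyMeasurable (ae_of_all _ fun ω => ?_)
    rw [Real.norm_of_nonneg (sq_nonneg _)]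
    have := sq_mul_sq_le_exp 1 (η ω)
    linarith
  refine ⟨h2, ?_⟩
  have key : ∀ s : ℝ, ∀ᵐ ω ∂μ, s ^ 2 * (μ[fun ω => η ω ^ 2 | m]) ω ≤
      2 * Real.exp (σ ^ 2 * s ^ 2 / 2) - 2 := by
    intro s
    have e1 : μ[fun ω => s ^ 2 * η ω ^ 2 | m] =ᵐ[μ] fun ω => s ^ 2 * (μ[fun ω => η ω ^ 2 | m]) ω :=
      condExp_smul (s ^ 2) (fun ω => η ω ^ 2) m
    have e2 := condExp_mono (m := m) (h2.const_mul (s ^ 2)) (hint s)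
      (ae_of_all _ fun ω => sq_mul_sq_le_exp s (η ω))
    have e3 := condExp_sub ((hi s).add (hi (-s))) (integrable_const (μ := μ) (2 : ℝ)) m
    have e4 := condExp_add (hi s) (hi (-s)) m
    have e5 := condExp_const (μ := μ) hm (2 : ℝ)
    filter_upwards [e1, e2, e3, e4, hle s, hle (-s)] with ω h1 h2 h3 h4 h5 h6
    rw [h1] at h2
    refine h2.trans (h3.le.trans ?_)
    rw [Pi.sub_apply, h4, Pi.add_apply, e5]
    rw [neg_sq] at h6
    linarith
  -- Dividing by s² and letting s → 0 gives σ². The sequence s = 1/(k+1) keeps a common null set.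
  have hall : ∀ᵐ ω ∂μ, ∀ k : ℕ, (1 / ((k : ℝ) + 1)) ^ 2 * (μ[fun ω => η ω ^ 2 | m]) ω ≤
      2 * Real.exp (σ ^ 2 * (1 / ((k : ℝ) + 1)) ^ 2 / 2) - 2 := ae_all_iff.2 fun k => key _
  filter_upwards [hall] with ω hω
  have hlim : Filter.Tendsto (fun k : ℕ => σ ^ 2 + σ ^ 4 * (1 / ((k : ℝ) + 1)) / 2) Filter.atTop
      (nhds (σ ^ 2 + σ ^ 4 * 0 / 2)) :=
    ((tendsto_one_div_add_atTop_nhds_zero_nat.const_mul _).div_const _).const_add _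
  rw [mul_zero, zero_div, add_zero] at hlim
  refine ge_of_tendsto hlim ?_
  -- For k ≥ σ² the exponent σ²s²/2 is at most 1, so e^y ≤ 1 + y + y² applies and leaves an error of
  -- at most σ⁴s/2 after division.
  obtain ⟨K, hK⟩ := exists_nat_ge (σ ^ 2)
  filter_upwards [Filter.eventually_ge_atTop K] with k hk
  have hk' : σ ^ 2 ≤ (k : ℝ) := hK.trans (by exact_mod_cast hk)
  set u : ℝ := 1 / ((k : ℝ) + 1) with hu
  have hu0 : 0 < u := by positivity
  have hu1 : u ≤ 1 := by
    rw [hu, div_le_one (by positivity)]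
    linarith [Nat.cast_nonneg (α := ℝ) k]
  have hsu : σ ^ 2 * u ≤ 1 := by
    rw [hu, mul_one_div, div_le_one (by positivity)]
    linarith
  have hx : |σ ^ 2 * u ^ 2 / 2| ≤ 1 := by
    rw [abs_of_nonneg (by positivity)]
    nlinarith [sq_nonneg σ]
  have h1 := hω k
  have h2 := exp_le_quadratic hx
  have hu2 : 0 < u ^ 2 := by positivity
  have h3 : u ^ 2 * (μ[fun ω => η ω ^ 2 | m]) ω ≤ u ^ 2 * (σ ^ 2 + σ ^ 4 * u ^ 2 / 2) := by
    nlinarith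
  have h4 := le_of_mul_le_mul_left h3 hu2
  have h5 : u ^ 2 ≤ u := by nlinarith
  have h6 := mul_le_mul_of_nonneg_left h5 (by positivity : 0 ≤ σ ^ 4)
  linarith

end Disintegration

/-! ### One round of the trace exponential, given the past. -/

section ExponentialMoment

open Matrix ProbabilityTheory
open scoped ENNReal

variable {d₁ d₂ : ℕ} {𝒜 : Set (Matrix (Fin d₁) (Fin d₂) ℝ)}
  {π : Measure (Matrix (Fin d₁) (Fin d₂) ℝ)}

lemma measurable_frobInner {Ω : Type*} {mΩ : MeasurableSpace Ω}
    {Θ X : Ω → Matrix (Fin d₁) (Fin d₂) ℝ} (hΘ : Measurable Θ) (hX : Measurable X) :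
    Measurable fun ω => frobInner (Θ ω) (X ω) := by
  simp only [frobInner_eq_dotProduct, dotProduct]
  exact Finset.measurable_sum _ fun p _ =>
    (measurable_matrix_iff.1 hΘ p.2 p.1).mul (measurable_matrix_iff.1 hX p.2 p.1)

lemma measurable_dilation_entry {Ω : Type*} {mΩ : MeasurableSpace Ω}
    {W : Ω → Matrix (Fin d₁) (Fin d₂) ℝ} (hW : Measurable W) (p q : Fin d₁ ⊕ Fin d₂) :
    Measurable fun ω => dilation (W ω) p q := by
  rcases p with i | j <;> rcases q with i' | j' <;> simp only [dilation, fromBlocks_apply₁₁,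
    fromBlocks_apply₁₂, fromBlocks_apply₂₁, fromBlocks_apply₂₂, transpose_apply,
    Matrix.zero_apply]
  · exact measurable_const
  · exact measurable_matrix_iff.1 hW i j'
  · exact measurable_matrix_iff.1 hW i' j
  · exact measurable_const

lemma measurable_oneSample {Ω : Type*} {mΩ : MeasurableSpace Ω}
    (Q : Matrix (Fin d₂ × Fin d₁) (Fin d₂ × Fin d₁) ℝ)
    {Θ₀ X : Ω → Matrix (Fin d₁) (Fin d₂) ℝ} {y : Ω → ℝ} (hΘ : Measurable Θ₀) (hX : Measurable X)
    (hy : Measurable y) : Measurable fun ω => oneSample Q (Θ₀ ω) (X ω) (y ω) := by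
  refine measurable_matrix_iff.2 fun i j => ?_
  simp only [oneSample_eq, Matrix.smul_apply, smul_eq_mul, whiten, of_apply, dotProduct]
  exact (hy.sub (measurable_frobInner hΘ hX)).mul (Finset.measurable_sum _ fun p _ =>
    measurable_const.mul (measurable_matrix_iff.1 hX p.2 p.1))

/-- The robustified one-sample estimator. -/
noncomputable def robustSample (Q : Matrix (Fin d₂ × Fin d₁) (Fin d₂ × Fin d₁) ℝ) (c : ℝ)
    (Θ₀ X : Matrix (Fin d₁) (Fin d₂) ℝ) (y : ℝ) :
    Matrix (Fin d₁ ⊕ Fin d₂) (Fin d₁ ⊕ Fin d₂) ℝ :=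
  cfc influence (c • dilation (oneSample Q Θ₀ X y))

lemma isHermitian_robustSample (Q : Matrix (Fin d₂ × Fin d₁) (Fin d₂ × Fin d₁) ℝ) (c : ℝ)
    (Θ₀ X : Matrix (Fin d₁) (Fin d₂) ℝ) (y : ℝ) : (robustSample Q c Θ₀ X y).IsHermitian :=
  isHermitian_cfc _ _

lemma measurable_robustSample {Ω : Type*} {mΩ : MeasurableSpace Ω}
    (Q : Matrix (Fin d₂ × Fin d₁) (Fin d₂ × Fin d₁) ℝ) (c : ℝ)
    {Θ₀ X : Ω → Matrix (Fin d₁) (Fin d₂) ℝ} {y : Ω → ℝ} (hΘ : Measurable Θ₀) (hX : Measurable X)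
    (hy : Measurable y) (p q : Fin d₁ ⊕ Fin d₂) :
    Measurable fun ω => robustSample Q c (Θ₀ ω) (X ω) (y ω) p q :=
  (spectrallyMeasurable_of_continuous continuous_influence).measurable
    (W := fun ω => c • dilation (oneSample Q (Θ₀ ω) (X ω) (y ω)))
    (fun _ => isHermitian_real_smul (isHermitian_dilation _) _)
    (fun p q => (measurable_dilation_entry (measurable_oneSample Q hΘ hX hy) p q).const_mul c) p q

lemma measurable_trace_exp {n Ω : Type*} [Fintype n] [DecidableEq n] {mΩ : MeasurableSpace Ω}
    {W : Ω → Matrix n n ℝ} (hW : ∀ ω, (W ω).IsHermitian)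
    (hm : ∀ i j, Measurable fun ω => W ω i j) :
    Measurable fun ω => (cfc Real.exp (W ω)).trace := by
  simp only [Matrix.trace, Matrix.diag]
  exact Finset.measurable_sum _ fun i _ =>
    (spectrallyMeasurable_of_continuous Real.continuous_exp).measurable hW hm i i

lemma trace_exp_nonneg {n : Type*} [Fintype n] [DecidableEq n] {K : Matrix n n ℝ}
    (hK : K.IsHermitian) : 0 ≤ (cfc Real.exp K).trace :=
  (posDef_cfc_exp hK).posSemidef.trace_nonneg

/-- One step of the exponential moment bound: the noise of a round is averaged out, given the
past `h`. -/
theorem lintegral_trace_exp_step {Ω 𝓗 : Type*} {mΩ : MeasurableSpace Ω}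
    {m𝓗 : MeasurableSpace 𝓗} {μ : Measure Ω} [IsProbabilityMeasure μ] {h : Ω → 𝓗}
    {X : Ω → Matrix (Fin d₁) (Fin d₂) ℝ} {η : Ω → ℝ} {σ R₀ : ℝ} (hπ : IsDesign 𝒜 π)
    (h𝒜 : ∀ a ∈ 𝒜, opNorm a ≤ 1) (hh : Measurable h)
    (hX : Measurable X) (hη : Measurable η) (hind : IndepFun h X μ) (hlaw : μ.map X = π)
    (hηi : Integrable η μ) (hη2 : Integrable (fun ω => η ω ^ 2) μ)
    (hmean : μ[η | MeasurableSpace.comap (fun ω => (h ω, X ω)) inferInstance] =ᵐ[μ] 0)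
    (hsq : ∀ᵐ ω ∂μ, (μ[fun ω => η ω ^ 2 |
      MeasurableSpace.comap (fun ω => (h ω, X ω)) inferInstance]) ω ≤ σ ^ 2)
    {Θ : Matrix (Fin d₁) (Fin d₂) ℝ} {Θ₀ : 𝓗 → Matrix (Fin d₁) (Fin d₂) ℝ} (hΘ₀ : Measurable Θ₀)
    {K : 𝓗 → Matrix (Fin d₁ ⊕ Fin d₂) (Fin d₁ ⊕ Fin d₂) ℝ} (hK : ∀ a, (K a).IsHermitian)
    (hKm : ∀ p q, Measurable fun a => K a p q) {E : Set 𝓗} (hE : MeasurableSet E)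
    (hR : ∀ a ∈ E, ∀ x ∈ 𝒜, |frobInner (Θ - Θ₀ a) x| ≤ R₀) (c : ℝ) :
    ∫⁻ ω, E.indicator (fun a => ENNReal.ofReal (cfc Real.exp (K a +
        (robustSample (covMatrix π) c (Θ₀ a) (X ω) (frobInner Θ (X ω) + η ω) -
          c • dilation (Θ - Θ₀ a)))).trace) (h ω) ∂μ ≤
      ENNReal.ofReal (Real.exp (c ^ 2 * ((σ ^ 2 + R₀ ^ 2) * designB (covMatrix π)) / 2)) *
        ∫⁻ ω, E.indicator (fun a => ENNReal.ofReal (cfc Real.exp (K a)).trace) (h ω) ∂μ := by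
  have := hπ.isProbabilityMeasure
  set ρ := ENNReal.ofReal (Real.exp (c ^ 2 * ((σ ^ 2 + R₀ ^ 2) * designB (covMatrix π)) / 2))
  have hTr : Measurable fun a => E.indicator (fun a => ENNReal.ofReal (cfc Real.exp (K a)).trace) a :=
    (measurable_trace_exp hK hKm).ennreal_ofReal.indicator hE
  have hTrh : Measurable fun ω =>
      E.indicator (fun a => ENNReal.ofReal (cfc Real.exp (K a)).trace) (h ω) := hTr.comp hh
  rw [← lintegral_const_mul _ hTrh]
  have hdil : ∀ a, (c • dilation (Θ - Θ₀ a)).IsHermitian := fun a =>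
    isHermitian_real_smul (isHermitian_dilation _) _
  refine lintegral_le_of_noise (π := π) (σ := σ)
    (F := fun a z => E.indicator (fun a => ENNReal.ofReal (cfc Real.exp (K a +
        (robustSample (covMatrix π) c (Θ₀ a) z.1 (frobInner Θ z.1 + z.2) -
          c • dilation (Θ - Θ₀ a)))).trace) a)
    (G := fun a => ρ * E.indicator (fun a => ENNReal.ofReal (cfc Real.exp (K a)).trace) a)
    hh hX hη hind hlaw hηi hη2 hmean hsq ?_ ?_
  · have hΘ₀' : Measurable fun p : 𝓗 × (Matrix (Fin d₁) (Fin d₂) ℝ × ℝ) => Θ₀ p.1 :=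
      hΘ₀.comp measurable_fst
    have hx' : Measurable fun p : 𝓗 × (Matrix (Fin d₁) (Fin d₂) ℝ × ℝ) => p.2.1 :=
      measurable_snd.fst
    have hy' : Measurable fun p : 𝓗 × (Matrix (Fin d₁) (Fin d₂) ℝ × ℝ) =>
        frobInner Θ p.2.1 + p.2.2 :=
      (measurable_frobInner measurable_const hx').add measurable_snd.snd
    have hd' : Measurable fun p : 𝓗 × (Matrix (Fin d₁) (Fin d₂) ℝ × ℝ) => Θ - Θ₀ p.1 :=
      measurable_matrix_iff.2 fun i j =>
        measurable_const.sub (measurable_matrix_iff.1 hΘ₀' i j)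
    have hm := (measurable_trace_exp
      (W := fun p : 𝓗 × (Matrix (Fin d₁) (Fin d₂) ℝ × ℝ) => K p.1 +
        (robustSample (covMatrix π) c (Θ₀ p.1) p.2.1 (frobInner Θ p.2.1 + p.2.2) -
          c • dilation (Θ - Θ₀ p.1)))
      (fun p => (hK _).add ((isHermitian_robustSample _ _ _ _ _).sub (hdil _)))
      (fun i j => ((hKm i j).comp measurable_fst).add
        ((measurable_robustSample (covMatrix π) c hΘ₀' hx' hy' i j).sub
          ((measurable_dilation_entry hd' i j).const_mul c)))).ennreal_ofReal
    exact hm.indicator (measurable_fst hE)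
  · intro a κ _ hκ
    by_cases ha : a ∈ E
    · simp only [Set.indicator_of_mem ha]
      obtain ⟨i1, e1⟩ := hπ.expMat_sampleDilation (Θ := Θ) (Θ₀ := Θ₀ a) h𝒜 hκ
      obtain ⟨i2, e2⟩ := hπ.expMat_sampleDilation_sq h𝒜 hκ (hR a ha)
      have hmz : Measurable fun z : Matrix (Fin d₁) (Fin d₂) ℝ × ℝ =>
          oneSample (covMatrix π) (Θ₀ a) z.1 (frobInner Θ z.1 + z.2) :=
        measurable_oneSample _ measurable_const measurable_fst
          ((measurable_frobInner measurable_const measurable_fst).add measurable_snd)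
      have hKd : (K a - c • dilation (Θ - Θ₀ a)).IsHermitian := (hK a).sub (hdil a)
      -- The centring is put into the deterministic exponent. The mean of the sample cancels it, so
      -- the right side is tr exp of K(a) again and the step can be iterated.
      obtain ⟨hi, hle⟩ := integral_trace_exp_add_influence_le hKd
        (Z := sampleDilation (covMatrix π) Θ (Θ₀ a)) (fun z => isHermitian_dilation _)
        (measurable_dilation_entry hmz) i1 i2 e2 c
      rw [e1, sub_add_cancel] at hle
      have hre : ∀ z : Matrix (Fin d₁) (Fin d₂) ℝ × ℝ, K a +
          (robustSample (covMatrix π) c (Θ₀ a) z.1 (frobInner Θ z.1 + z.2) -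
            c • dilation (Θ - Θ₀ a)) = K a - c • dilation (Θ - Θ₀ a) +
          cfc influence (c • sampleDilation (covMatrix π) Θ (Θ₀ a) z) := by
        intro z
        rw [robustSample, sampleDilation]
        abel
      simp only [hre]
      rw [← ofReal_integral_eq_lintegral_ofReal hi (ae_of_all _ fun z =>
        trace_exp_nonneg (hKd.add (isHermitian_cfc _ _))), ← ENNReal.ofReal_mul (Real.exp_pos _).le]
      exact ENNReal.ofReal_le_ofReal hle
    · simp [Set.indicator_of_notMem ha]

end ExponentialMoment

/-! ### From trace exponentials of dilations to operator norms. -/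

section OffDiagonal

open Matrix

variable {d₁ d₂ : ℕ}

lemma trace_cfc {n : Type*} [Fintype n] [DecidableEq n] {A : Matrix n n ℝ} (hA : A.IsHermitian)
    (f : ℝ → ℝ) : (cfc f A).trace = ∑ i, f (hA.eigenvalues i) := by
  rw [cfc_eq_eigU hA, Matrix.trace_mul_cycle, eigU_transpose_mul, Matrix.one_mul, trace_diagonal]

/-- Each e^{λᵢ} is at most the sum of them all, so every eigenvalue is at most s. -/
lemma dotProduct_mulVec_le_of_trace_exp_le {n : Type*} [Fintype n] [DecidableEq n]
    {A : Matrix n n ℝ} (hA : A.IsHermitian) {s : ℝ} (h : (cfc Real.exp A).trace ≤ Real.exp s)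
    (w : n → ℝ) : w ⬝ᵥ A *ᵥ w ≤ s * (w ⬝ᵥ w) := by
  rw [trace_cfc hA] at h
  have hs := posSemidef_cfc_sub (f := fun x => x) (g := fun _ => s * 1) hA fun i => by
    rw [mul_one, ← Real.exp_le_exp]
    exact (Finset.single_le_sum (f := fun i => Real.exp (hA.eigenvalues i))
      (fun _ _ => (Real.exp_pos _).le) (Finset.mem_univ i)).trans h
  rw [cfc_const_mul _ _ _ (continuousOn_spectrum _), cfc_one_matrix hA, cfc_id_matrix hA] at hs
  have := hs.dotProduct_mulVec_nonneg w
  simp only [star_trivial, sub_mulVec, smul_mulVec, one_mulVec, dotProduct_sub, dotProduct_smul,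
    smul_eq_mul] at this
  linarith

lemma dotProduct_self_eq_norm_sq {k : ℕ} (x : EuclideanSpace ℝ (Fin k)) :
    x.ofLp ⬝ᵥ x.ofLp = ‖x‖ ^ 2 := by
  rw [EuclideanSpace.real_norm_sq_eq]
  simp [dotProduct, sq]

lemma norm_mulVec_le_opNorm (A : Matrix (Fin d₁) (Fin d₂) ℝ) (x : EuclideanSpace ℝ (Fin d₂)) :
    ‖WithLp.toLp 2 (A *ᵥ x.ofLp)‖ ≤ opNorm A * ‖x‖ :=
  Matrix.l2_opNorm_mulVec A x

lemma opNorm_le_of_forall {A : Matrix (Fin d₁) (Fin d₂) ℝ} {s : ℝ} (hs : 0 ≤ s)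
    (h : ∀ x : EuclideanSpace ℝ (Fin d₂), ‖WithLp.toLp 2 (A *ᵥ x.ofLp)‖ ≤ s * ‖x‖) :
    opNorm A ≤ s := by
  rw [opNorm, Matrix.l2_opNorm_def]
  exact ContinuousLinearMap.opNorm_le_bound _ hs h

open scoped Matrix.Norms.L2Operator in
lemma opNorm_nonneg (A : Matrix (Fin d₁) (Fin d₂) ℝ) : 0 ≤ opNorm A := norm_nonneg A

open scoped Matrix.Norms.L2Operator in
lemma opNorm_smul (c : ℝ) (A : Matrix (Fin d₁) (Fin d₂) ℝ) : opNorm (c • A) = |c| * opNorm A :=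
  norm_smul c A

lemma opNorm_le_of_bilinear {B : Matrix (Fin d₁) (Fin d₂) ℝ} {s : ℝ} (hs : 0 ≤ s)
    (h : ∀ u w, 2 * (u ⬝ᵥ B *ᵥ w) ≤ s * (u ⬝ᵥ u + w ⬝ᵥ w)) : opNorm B ≤ s := by
  refine opNorm_le_of_forall hs fun x => ?_
  set y : EuclideanSpace ℝ (Fin d₁) := WithLp.toLp 2 (B *ᵥ x.ofLp) with hy
  rcases (norm_nonneg y).eq_or_lt with h0 | hy0
  · rw [← h0]
    positivity
  have hx0 : 0 < ‖x‖ := by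
    rw [norm_pos_iff]
    rintro rfl
    simp [hy] at hy0
  -- The first vector is Bx rescaled to the norm of x, which makes the arithmetic mean on the right
  -- sharp.
  have key := h ((‖x‖ / ‖y‖) • y.ofLp) x.ofLp
  have e1 : (y.ofLp ⬝ᵥ B *ᵥ x.ofLp) = ‖y‖ ^ 2 := by
    rw [← dotProduct_self_eq_norm_sq]
  simp only [smul_dotProduct, dotProduct_smul, smul_eq_mul, e1, dotProduct_self_eq_norm_sq] at key
  have e2 : ‖x‖ / ‖y‖ * ‖y‖ ^ 2 = ‖x‖ * ‖y‖ := by field_simp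
  have e3 : ‖x‖ / ‖y‖ * (‖x‖ * ‖y‖) = ‖x‖ ^ 2 := by field_simp
  rw [e2, e3] at key
  nlinarith

lemma dilation_sub (M N : Matrix (Fin d₁) (Fin d₂) ℝ) :
    dilation (M - N) = dilation M - dilation N := by
  ext p q
  rcases p with i | j <;> rcases q with i' | j' <;> simp [dilation]

lemma dilation_sum {ι : Type*} (s : Finset ι) (M : ι → Matrix (Fin d₁) (Fin d₂) ℝ) :
    dilation (∑ i ∈ s, M i) = ∑ i ∈ s, dilation (M i) := by
  ext p q
  rcases p with i | j <;> rcases q with i' | j' <;> simp [dilation, Matrix.sum_apply]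

lemma toBlocks₁₂_dilation (M : Matrix (Fin d₁) (Fin d₂) ℝ) : (dilation M).toBlocks₁₂ = M := by
  rw [dilation, toBlocks_fromBlocks₁₂]

/-- The quadratic form of a dilation at (u, w) is 2 u·Bw. A one-sided eigenvalue bound controls the
norm because the sign of u is free. -/
lemma opNorm_le_of_trace_exp_dilation_le {B : Matrix (Fin d₁) (Fin d₂) ℝ} {s : ℝ} (hs : 0 ≤ s)
    (h : (cfc Real.exp (dilation B)).trace ≤ Real.exp s) : opNorm B ≤ s := by
  refine opNorm_le_of_bilinear hs fun u w => ?_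
  have hq := dotProduct_mulVec_le_of_trace_exp_le (isHermitian_dilation B) h (Sum.elim u w)
  rw [dilation, fromBlocks_mulVec] at hq
  simp only [Sum.elim_comp_inl, Sum.elim_comp_inr, zero_mulVec, add_zero, zero_add,
    sumElim_dotProduct_sumElim] at hq
  have : w ⬝ᵥ Bᵀ *ᵥ u = u ⬝ᵥ B *ᵥ w := by
    rw [mulVec_transpose, dotProduct_comm, ← dotProduct_mulVec]
  linarith

/-- The signature matrix `diag (1, -1)`. -/
def signature (d₁ d₂ : ℕ) : Matrix (Fin d₁ ⊕ Fin d₂) (Fin d₁ ⊕ Fin d₂) ℝ :=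
  fromBlocks 1 0 0 (-1)

lemma signature_mem_unitary (d₁ d₂ : ℕ) :
    signature d₁ d₂ ∈ unitary (Matrix (Fin d₁ ⊕ Fin d₂) (Fin d₁ ⊕ Fin d₂) ℝ) := by
  have h : star (signature d₁ d₂) = signature d₁ d₂ := by
    rw [star_eq_conjTranspose, signature, fromBlocks_conjTranspose]
    simp
  rw [Unitary.mem_iff, h, signature, fromBlocks_multiply]
  simp [fromBlocks_one]

lemma eq_zero_of_eq_neg_self {m n : Type*} {W : Matrix m n ℝ} (h : W = -W) : W = 0 := by
  ext i j
  have h' : W i j = -W i j := congrFun₂ h i j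
  rw [Matrix.zero_apply]
  linarith

/-- An odd function of a dilation is a dilation. -/
lemma cfc_dilation_eq {f : ℝ → ℝ} (hf : ∀ x, f (-x) = -f x) (M : Matrix (Fin d₁) (Fin d₂) ℝ) :
    cfc f (dilation M) = dilation (cfc f (dilation M)).toBlocks₁₂ := by
  set R := cfc f (dilation M) with hR
  set J : unitary (Matrix (Fin d₁ ⊕ Fin d₂) (Fin d₁ ⊕ Fin d₂) ℝ) :=
    ⟨signature d₁ d₂, signature_mem_unitary d₁ d₂⟩
  have hJ : ∀ W, Unitary.conjStarAlgAut ℝ _ J W = signature d₁ d₂ * W * signature d₁ d₂ := by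
    intro W
    rw [Unitary.conjStarAlgAut_apply]
    congr 1
    rw [star_eq_conjTranspose]
    simp only [J, signature, fromBlocks_conjTranspose]
    simp
  have hc : Continuous (Unitary.conjStarAlgAut ℝ _ J) := by
    simp only [funext hJ]
    exact (continuous_const.matrix_mul continuous_id).matrix_mul continuous_const
  -- Conjugation by diag(1, −1) negates a dilation. It therefore negates an odd function of it,
  -- while it fixes the diagonal blocks, which must vanish.
  have hneg : Unitary.conjStarAlgAut ℝ _ J (dilation M) = -dilation M := by
    rw [hJ, dilation, signature, fromBlocks_multiply, fromBlocks_multiply]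
    simp [fromBlocks_neg]
  have h1 : Unitary.conjStarAlgAut ℝ _ J R = -R := by
    have h := StarAlgHomClass.map_cfc (Unitary.conjStarAlgAut ℝ _ J) f (dilation M)
      (continuousOn_spectrum _) hc (isHermitian_dilation M)
      (by rw [hneg]; exact (isHermitian_dilation M).neg)
    rw [hR, h, hneg, ← cfc_neg _ _]
    have h2 := cfc_comp_matrix (isHermitian_dilation M) f (fun x => -x)
    rw [cfc_neg (fun x : ℝ => x), cfc_id_matrix (isHermitian_dilation M)] at h2
    rw [← h2]
    simp only [hf]
  have hRh : R.IsHermitian := isHermitian_cfc _ _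
  rw [hJ] at h1
  obtain ⟨a, b, c, d, habcd⟩ : ∃ a b c d, R = fromBlocks a b c d :=
    ⟨_, _, _, _, (fromBlocks_toBlocks R).symm⟩
  rw [habcd, signature, fromBlocks_multiply, fromBlocks_multiply, fromBlocks_neg,
    fromBlocks_inj] at h1
  simp only [Matrix.one_mul, Matrix.mul_one, Matrix.zero_mul, Matrix.mul_zero, add_zero, zero_add,
    Matrix.neg_mul, Matrix.mul_neg, neg_neg] at h1
  rw [habcd, isHermitian_fromBlocks_iff] at hRh
  rw [habcd, dilation, toBlocks_fromBlocks₁₂, fromBlocks_inj]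
  refine ⟨eq_zero_of_eq_neg_self h1.1, rfl, ?_, eq_zero_of_eq_neg_self h1.2.2.2⟩
  rw [← conjTranspose_eq_transpose_of_trivial]
  exact hRh.2.1.symm

end OffDiagonal

/-! ### The filtration of arms and rewards. -/

section Histories

open Matrix ProbabilityTheory

variable {d₁ d₂ : ℕ} {Ω : Type*} {mΩ : MeasurableSpace Ω}
  {A : ℕ → Ω → Matrix (Fin d₁) (Fin d₂) ℝ} {Y : ℕ → Ω → ℝ}

lemma history_mono {s t : ℕ} (hst : s ≤ t) : history A Y s ≤ history A Y t :=
  iSup₂_le fun i hi => le_iSup₂_of_le i (hi.trans_le hst) le_rfl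

lemma history_le {t : ℕ} (hA : ∀ s < t, Measurable (A s)) (hY : ∀ s < t, Measurable (Y s)) :
    history A Y t ≤ mΩ :=
  iSup₂_le fun i hi => sup_le (hA i hi).comap_le (hY i hi).comap_le

lemma measurable_history_arm {s t : ℕ} (hst : s < t) : Measurable[history A Y t] (A s) :=
  (comap_measurable (A s)).mono (le_iSup₂_of_le s hst le_sup_left) le_rfl

lemma measurable_history_reward {s t : ℕ} (hst : s < t) : Measurable[history A Y t] (Y s) :=
  (comap_measurable (Y s)).mono (le_iSup₂_of_le s hst le_sup_right) le_rfl

end Histories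

/-! ### High-probability error of the robust mean. -/

section Tail

open Matrix ProbabilityTheory
open scoped ENNReal

variable {d₁ d₂ : ℕ} {𝒜 : Set (Matrix (Fin d₁) (Fin d₂) ℝ)}
  {π : Measure (Matrix (Fin d₁) (Fin d₂) ℝ)} {Ω : Type*} [mΩ : MeasurableSpace Ω]
  {μ : Measure Ω} [IsProbabilityMeasure μ] {A : ℕ → Ω → Matrix (Fin d₁) (Fin d₂) ℝ}
  {η : ℕ → Ω → ℝ} {Θ : Matrix (Fin d₁) (Fin d₂) ℝ} {T n₀ : ℕ} {σ Rmax δ R₀ : ℝ}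

lemma measurable_reward (hη : IsSubgaussianNoise μ T σ Θ A η)
    (hL : IsLPAETC μ 𝒜 π T n₀ σ Rmax δ A (reward Θ A η)) {t : ℕ} (ht : t < T) :
    Measurable (reward Θ A η t) :=
  (measurable_frobInner measurable_const (hL.measurable t ht)).add (hη.measurable t ht)

lemma history_reward_le (hη : IsSubgaussianNoise μ T σ Θ A η)
    (hL : IsLPAETC μ 𝒜 π T n₀ σ Rmax δ A (reward Θ A η)) {t : ℕ} (ht : t ≤ T) :
    history A (reward Θ A η) t ≤ mΩ :=
  history_le (fun s hs => hL.measurable s (hs.trans_le ht))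
    fun _ hs => measurable_reward hη hL (hs.trans_le ht)

/-- The past is represented by the identity map from Ω to Ω with the history σ-algebra on the
target, so that conditioning on it is conditioning on the history. -/
lemma lintegral_trace_exp_round (hπ : IsDesign 𝒜 π) (h𝒜 : ∀ a ∈ 𝒜, opNorm a ≤ 1)
    (hη : IsSubgaussianNoise μ T σ Θ A η)
    (hL : IsLPAETC μ 𝒜 π T n₀ σ Rmax δ A (reward Θ A η)) (hn₀ : n₀ ≤ T) {t : ℕ} (ht : t < n₀)
    {Θ₀ : Ω → Matrix (Fin d₁) (Fin d₂) ℝ} (hΘ₀ : Measurable[history A (reward Θ A η) t] Θ₀)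
    {K : Ω → Matrix (Fin d₁ ⊕ Fin d₂) (Fin d₁ ⊕ Fin d₂) ℝ} (hK : ∀ ω, (K ω).IsHermitian)
    (hKm : ∀ p q, Measurable[history A (reward Θ A η) t] fun ω => K ω p q) {E : Set Ω}
    (hE : MeasurableSet[history A (reward Θ A η) t] E)
    (hR : ∀ ω ∈ E, ∀ x ∈ 𝒜, |frobInner (Θ - Θ₀ ω) x| ≤ R₀) (c : ℝ) :
    ∫⁻ ω, E.indicator (fun ω => ENNReal.ofReal (cfc Real.exp (K ω +
        (robustSample (covMatrix π) c (Θ₀ ω) (A t ω) (reward Θ A η t ω) -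
          c • dilation (Θ - Θ₀ ω)))).trace) ω ∂μ ≤
      ENNReal.ofReal (Real.exp (c ^ 2 * ((σ ^ 2 + R₀ ^ 2) * designB (covMatrix π)) / 2)) *
        ∫⁻ ω, E.indicator (fun ω => ENNReal.ofReal (cfc Real.exp (K ω)).trace) ω ∂μ := by
  have htT : t < T := ht.trans_le hn₀
  have hm := history_reward_le hη hL htT.le
  have hcomap : MeasurableSpace.comap (fun ω => (id ω, A t ω))
      (@Prod.instMeasurableSpace _ _ (history A (reward Θ A η) t) instMeasurableSpaceMatrix) =
      history A (reward Θ A η) t ⊔ MeasurableSpace.comap (A t) inferInstance := by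
    refine (@MeasurableSpace.comap_prodMk _ _ _ (history A (reward Θ A η) t)
      instMeasurableSpaceMatrix id (A t)).trans ?_
    rw [MeasurableSpace.comap_id]
  have hm' : history A (reward Θ A η) t ⊔ MeasurableSpace.comap (A t) inferInstance ≤ mΩ :=
    sup_le hm (hL.measurable t htT).comap_le
  obtain ⟨h2, hv⟩ := condExp_sq_le_of_subgaussian hm' (hη.measurable t htT)
    (hη.integrable_exp t htT) (hη.condExp_exp_le t htT)
  have hind : @IndepFun _ _ _ mΩ (history A (reward Θ A η) t) instMeasurableSpaceMatrix
      (id : Ω → Ω) (A t) μ := by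
    refine (@IndepFun_iff_Indep _ _ _ mΩ (history A (reward Θ A η) t) instMeasurableSpaceMatrix
      id (A t) μ).2 ?_
    rw [MeasurableSpace.comap_id]
    exact (hL.explore_indep t ht).symm
  have key := @lintegral_trace_exp_step d₁ d₂ 𝒜 π Ω Ω mΩ (history A (reward Θ A η) t) μ _ id (A t)
    (η t) σ R₀ hπ h𝒜 (measurable_id'' hm) (hL.measurable t htT) (hη.measurable t htT) hind
    (hL.explore_law t ht) (hη.integrable t htT) h2 (by rw [hcomap]; exact hη.condExp_eq_zero t htT)
    (by rw [hcomap]; exact hv) Θ Θ₀ hΘ₀ K hK hKm E hE hR c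
  refine le_of_eq_of_le (lintegral_congr fun ω => ?_) key
  by_cases hω : ω ∈ E
  · simp only [id, Set.indicator_of_mem hω, reward]
  · simp only [id, Set.indicator_of_notMem hω]

/-- The centred sum of the robustified one-sample estimators. -/
noncomputable def robustSum (Q : Matrix (Fin d₂ × Fin d₁) (Fin d₂ × Fin d₁) ℝ) (c : ℝ)
    (Θ Θ₀ : Matrix (Fin d₁) (Fin d₂) ℝ) (X : ℕ → Matrix (Fin d₁) (Fin d₂) ℝ) (y : ℕ → ℝ)
    (s : Finset ℕ) : Matrix (Fin d₁ ⊕ Fin d₂) (Fin d₁ ⊕ Fin d₂) ℝ :=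
  ∑ i ∈ s, (robustSample Q c Θ₀ (X i) (y i) - c • dilation (Θ - Θ₀))

lemma isHermitian_sum {ι n : Type*} (s : Finset ι) {W : ι → Matrix n n ℝ}
    (hW : ∀ i ∈ s, (W i).IsHermitian) : (∑ i ∈ s, W i).IsHermitian := by
  rw [Matrix.IsHermitian, conjTranspose_sum]
  exact Finset.sum_congr rfl fun i hi => (hW i hi).eq

lemma isHermitian_robustSum (Q : Matrix (Fin d₂ × Fin d₁) (Fin d₂ × Fin d₁) ℝ) (c : ℝ)
    (Θ Θ₀ : Matrix (Fin d₁) (Fin d₂) ℝ) (X : ℕ → Matrix (Fin d₁) (Fin d₂) ℝ) (y : ℕ → ℝ)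
    (s : Finset ℕ) : (robustSum Q c Θ Θ₀ X y s).IsHermitian :=
  isHermitian_sum s fun _ _ => (isHermitian_robustSample _ _ _ _ _).sub
    (isHermitian_real_smul (isHermitian_dilation _) _)

lemma measurable_robustSum {Ω' : Type*} {m : MeasurableSpace Ω'}
    (Q : Matrix (Fin d₂ × Fin d₁) (Fin d₂ × Fin d₁) ℝ) (c : ℝ) {s : Finset ℕ}
    {Θ₀ : Ω' → Matrix (Fin d₁) (Fin d₂) ℝ} {X : ℕ → Ω' → Matrix (Fin d₁) (Fin d₂) ℝ}
    {y : ℕ → Ω' → ℝ} (hΘ₀ : Measurable Θ₀) (hX : ∀ i ∈ s, Measurable (X i))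
    (hy : ∀ i ∈ s, Measurable (y i)) (p q : Fin d₁ ⊕ Fin d₂) :
    Measurable fun ω => robustSum Q c Θ (Θ₀ ω) (fun i => X i ω) (fun i => y i ω) s p q := by
  have hd : Measurable fun ω => Θ - Θ₀ ω := measurable_matrix_iff.2 fun i j =>
    measurable_const.sub (measurable_matrix_iff.1 hΘ₀ i j)
  simp only [robustSum, Matrix.sum_apply, Matrix.sub_apply, Matrix.smul_apply, smul_eq_mul]
  exact Finset.measurable_sum _ fun i hi =>
    (measurable_robustSample Q c hΘ₀ (hX i hi) (hy i hi) p q).sub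
      ((measurable_dilation_entry hd p q).const_mul c)

lemma trace_exp_zero :
    (cfc Real.exp (0 : Matrix (Fin d₁ ⊕ Fin d₂) (Fin d₁ ⊕ Fin d₂) ℝ)).trace = d₁ + d₂ := by
  rw [trace_cfc isHermitian_zero]
  have h : ∀ i, (isHermitian_zero (n := Fin d₁ ⊕ Fin d₂) (α := ℝ)).eigenvalues i = 0 := fun i => by
    rw [(isHermitian_zero (n := Fin d₁ ⊕ Fin d₂) (α := ℝ)).eigenvalues_eq_zero_iff.2 rfl]
    rfl
  simp [h]

/-- Rounds are peeled off from the last one. The empty sum has trace exponential d₁ + d₂. The event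
`E` and the pilot depend only on rounds before `a`, so they stay fixed throughout. -/
lemma lintegral_trace_exp_robustSum_le (hπ : IsDesign 𝒜 π) (h𝒜 : ∀ a ∈ 𝒜, opNorm a ≤ 1)
    (hη : IsSubgaussianNoise μ T σ Θ A η)
    (hL : IsLPAETC μ 𝒜 π T n₀ σ Rmax δ A (reward Θ A η)) (hn₀ : n₀ ≤ T) {a : ℕ}
    {Θ₀ : Ω → Matrix (Fin d₁) (Fin d₂) ℝ} (hΘ₀ : Measurable[history A (reward Θ A η) a] Θ₀)
    {E : Set Ω} (hE : MeasurableSet[history A (reward Θ A η) a] E)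
    (hR : ∀ ω ∈ E, ∀ x ∈ 𝒜, |frobInner (Θ - Θ₀ ω) x| ≤ R₀) (c : ℝ) {b : ℕ} (hab : a ≤ b)
    (hb : b ≤ n₀) :
    ∫⁻ ω, E.indicator (fun ω => ENNReal.ofReal (cfc Real.exp (robustSum (covMatrix π) c Θ (Θ₀ ω)
        (fun i => A i ω) (fun i => reward Θ A η i ω) (Finset.Ico a b))).trace) ω ∂μ ≤
      ENNReal.ofReal ((d₁ + d₂) *
        Real.exp ((b - a : ℕ) * (c ^ 2 * ((σ ^ 2 + R₀ ^ 2) * designB (covMatrix π)) / 2))) := by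
  induction b, hab using Nat.le_induction with
  | base =>
    simp only [Finset.Ico_self, robustSum, Finset.sum_empty, trace_exp_zero]
    refine (lintegral_mono (Set.indicator_le_self _ _)).trans ?_
    simp
  | succ t hat ih =>
    have hK := lintegral_trace_exp_round hπ h𝒜 hη hL hn₀ (Nat.lt_of_succ_le hb)
      (hΘ₀.mono (history_mono hat) le_rfl)
      (K := fun ω => robustSum (covMatrix π) c Θ (Θ₀ ω) (fun i => A i ω)
        (fun i => reward Θ A η i ω) (Finset.Ico a t))
      (fun ω => isHermitian_robustSum _ _ _ _ _ _ _)
      (measurable_robustSum _ _ (hΘ₀.mono (history_mono hat) le_rfl)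
        (fun i hi => measurable_history_arm (Finset.mem_Ico.1 hi).2)
        fun i hi => measurable_history_reward (Finset.mem_Ico.1 hi).2)
      (history_mono hat _ hE) hR c
    simp only [robustSum, Finset.sum_Ico_succ_top hat] at hK ⊢
    refine hK.trans ((mul_le_mul_right (ih (Nat.le_of_succ_le hb)) _).trans (le_of_eq ?_))
    rw [← ENNReal.ofReal_mul (Real.exp_pos _).le, Nat.sub_add_comm hat, Nat.cast_add, Nat.cast_one]
    generalize c ^ 2 * ((σ ^ 2 + R₀ ^ 2) * designB (covMatrix π)) / 2 = q
    rw [add_mul ((t - a : ℕ) : ℝ) 1 q, Real.exp_add, one_mul]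
    congr 1
    ring

lemma measure_trace_exp_robustSum_ge_le (hπ : IsDesign 𝒜 π) (h𝒜 : ∀ a ∈ 𝒜, opNorm a ≤ 1)
    (hη : IsSubgaussianNoise μ T σ Θ A η)
    (hL : IsLPAETC μ 𝒜 π T n₀ σ Rmax δ A (reward Θ A η)) (hn₀ : n₀ ≤ T) {a : ℕ}
    {Θ₀ : Ω → Matrix (Fin d₁) (Fin d₂) ℝ} (hΘ₀ : Measurable[history A (reward Θ A η) a] Θ₀)
    {E : Set Ω} (hE : MeasurableSet[history A (reward Θ A η) a] E)
    (hR : ∀ ω ∈ E, ∀ x ∈ 𝒜, |frobInner (Θ - Θ₀ ω) x| ≤ R₀) (c s : ℝ) {b : ℕ} (hab : a ≤ b)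
    (hb : b ≤ n₀) :
    μ {ω | ω ∈ E ∧ Real.exp s ≤ (cfc Real.exp (robustSum (covMatrix π) c Θ (Θ₀ ω)
        (fun i => A i ω) (fun i => reward Θ A η i ω) (Finset.Ico a b))).trace} ≤
      ENNReal.ofReal ((d₁ + d₂) * Real.exp
        ((b - a : ℕ) * (c ^ 2 * ((σ ^ 2 + R₀ ^ 2) * designB (covMatrix π)) / 2) - s)) := by
  have hle := lintegral_trace_exp_robustSum_le hπ h𝒜 hη hL hn₀ hΘ₀ hE hR c hab hb
  set F : Ω → ℝ≥0∞ := fun ω => E.indicator (fun ω => ENNReal.ofReal (cfc Real.exp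
    (robustSum (covMatrix π) c Θ (Θ₀ ω) (fun i => A i ω) (fun i => reward Θ A η i ω)
      (Finset.Ico a b))).trace) ω with hF
  have hbT := hb.trans hn₀
  have hm := history_reward_le hη hL (hab.trans hbT)
  have hFm : Measurable F := by
    refine Measurable.indicator (Measurable.ennreal_ofReal (measurable_trace_exp
      (fun ω => isHermitian_robustSum _ _ _ _ _ _ _)
      (measurable_robustSum _ _ (hΘ₀.mono hm le_rfl)
        (fun i hi => hL.measurable i ((Finset.mem_Ico.1 hi).2.trans_le hbT))
        fun i hi => measurable_reward hη hL ((Finset.mem_Ico.1 hi).2.trans_le hbT)))) (hm _ hE)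
  have h1 := mul_meas_ge_le_lintegral₀ (μ := μ) hFm.aemeasurable (ENNReal.ofReal (Real.exp s))
  have hsub : {ω | ω ∈ E ∧ Real.exp s ≤ (cfc Real.exp (robustSum (covMatrix π) c Θ (Θ₀ ω)
      (fun i => A i ω) (fun i => reward Θ A η i ω) (Finset.Ico a b))).trace} ⊆
      {ω | ENNReal.ofReal (Real.exp s) ≤ F ω} := by
    rintro ω ⟨h1, h2⟩
    simp only [hF, Set.mem_ofPred_eq, Set.indicator_of_mem h1]
    exact ENNReal.ofReal_le_ofReal h2
  refine (measure_mono hsub).trans ?_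
  have h2 := h1.trans hle
  rw [Real.exp_sub, ← mul_div_assoc, ENNReal.ofReal_div_of_pos (Real.exp_pos s),
    ENNReal.le_div_iff_mul_le (Or.inl (by simp [Real.exp_pos])) (Or.inl ENNReal.ofReal_ne_top),
    mul_comm]
  exact h2

/-- The robustified samples are dilations since φ is odd, so the trace exponential of the sum
controls the very block that the estimator extracts. -/
lemma robustSum_eq_dilation (Q : Matrix (Fin d₂ × Fin d₁) (Fin d₂ × Fin d₁) ℝ) (c : ℝ)
    (Θ Θ₀ : Matrix (Fin d₁) (Fin d₂) ℝ) (X : ℕ → Matrix (Fin d₁) (Fin d₂) ℝ) (y : ℕ → ℝ)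
    (s : Finset ℕ) :
    robustSum Q c Θ Θ₀ X y s = dilation ((∑ i ∈ s, robustSample Q c Θ₀ (X i) (y i)).toBlocks₁₂ -
      ((s.card : ℝ) * c) • (Θ - Θ₀)) := by
  have h : ∑ i ∈ s, robustSample Q c Θ₀ (X i) (y i) =
      dilation (∑ i ∈ s, (robustSample Q c Θ₀ (X i) (y i)).toBlocks₁₂) := by
    rw [dilation_sum]
    refine Finset.sum_congr rfl fun i _ => ?_
    rw [robustSample, ← dilation_smul]
    exact cfc_dilation_eq influence_neg _
  rw [robustSum, Finset.sum_sub_distrib, Finset.sum_const, h, toBlocks₁₂_dilation,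
    dilation_sub (∑ i ∈ s, _), dilation_smul, mul_smul, Nat.cast_smul_eq_nsmul]

/-- The operator norm error of the robust mean. -/
lemma opNorm_robustMean_sub_le {s : Finset ℕ} {X : ℕ → Matrix (Fin d₁) (Fin d₂) ℝ} {y : ℕ → ℝ}
    {Q : Matrix (Fin d₂ × Fin d₁) (Fin d₂ × Fin d₁) ℝ} {Θ₀ : Matrix (Fin d₁) (Fin d₂) ℝ} {u : ℝ}
    (hu : 0 ≤ u) (hc : 0 < (s.card : ℝ) * scaleParam s.card Q σ R₀ δ)
    (h : (cfc Real.exp (robustSum Q (scaleParam s.card Q σ R₀ δ) Θ Θ₀ X y s)).trace ≤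
      Real.exp u) :
    opNorm (robustMean s X y Q Θ₀ σ R₀ δ - Θ) ≤
      ((s.card : ℝ) * scaleParam s.card Q σ R₀ δ)⁻¹ * u := by
  rw [robustSum_eq_dilation] at h
  have hB := opNorm_le_of_trace_exp_dilation_le hu h
  have e : robustMean s X y Q Θ₀ σ R₀ δ - Θ = ((s.card : ℝ) * scaleParam s.card Q σ R₀ δ)⁻¹ •
      ((∑ i ∈ s, robustSample Q (scaleParam s.card Q σ R₀ δ) Θ₀ (X i) (y i)).toBlocks₁₂ -
        ((s.card : ℝ) * scaleParam s.card Q σ R₀ δ) • (Θ - Θ₀)) := by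
    rw [smul_sub, smul_smul, inv_mul_cancel₀ hc.ne', one_smul, robustMean]
    simp only [robustSample]
    abel
  rw [e, opNorm_smul, abs_of_pos (inv_pos.2 hc)]
  exact mul_le_mul_of_nonneg_left hB (inv_pos.2 hc).le

/-- These identities explain the choice of ν: with v = (σ² + R₀²) B and ℓ the logarithm, n ν² v / 2
= ℓ/2, and the deviation level 2ℓ turns into the error 2ℓ/(nν) = 2√(vℓ/n). -/
lemma scaleParam_eq {n : ℕ} {Q : Matrix (Fin d₂ × Fin d₁) (Fin d₂ × Fin d₁) ℝ}
    (hn : 0 < n) (hv : 0 < (σ ^ 2 + R₀ ^ 2) * designB Q)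
    (hℓ : 0 < Real.log (2 * (d₁ + d₂) / δ)) :
    0 < (n : ℝ) * scaleParam n Q σ R₀ δ ∧
    ((n : ℝ) * scaleParam n Q σ R₀ δ)⁻¹ * (2 * Real.log (2 * (d₁ + d₂) / δ)) =
      threshold n Q σ R₀ δ ∧
    (n : ℝ) * (scaleParam n Q σ R₀ δ ^ 2 * ((σ ^ 2 + R₀ ^ 2) * designB Q) / 2) =
      Real.log (2 * (d₁ + d₂) / δ) / 2 := by
  have hn' : (0 : ℝ) < n := by exact_mod_cast hn
  rw [scaleParam, threshold]
  set ℓ := Real.log (2 * (d₁ + d₂) / δ)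
  set v := (σ ^ 2 + R₀ ^ 2) * designB Q
  have hc : 0 < √(ℓ / (v * n)) := Real.sqrt_pos.2 (by positivity)
  refine ⟨by positivity, ?_, ?_⟩
  · rw [inv_mul_eq_iff_eq_mul₀ (by positivity)]
    have : √(ℓ / (v * n)) * √(v * ℓ / n) = ℓ / n := by
      rw [← Real.sqrt_mul (by positivity)]
      have e : ℓ / (v * n) * (v * ℓ / n) = (ℓ / n) ^ 2 := by field_simp
      rw [e, Real.sqrt_sq (by positivity)]
    calc 2 * ℓ = n * (2 * (ℓ / n)) := by field_simp
      _ = n * (2 * (√(ℓ / (v * n)) * √(v * ℓ / n))) := by rw [this]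
      _ = n * √(ℓ / (v * n)) * (2 * √(v * ℓ / n)) := by ring
  · rw [Real.sq_sqrt (by positivity)]
    field_simp

/-- With probability at least `1 - δ'`, the robust mean is within `threshold` of `Θ`, provided that
the pilot estimator is accurate. -/
theorem measure_opNorm_robustMean_gt_le (hπ : IsDesign 𝒜 π) (h𝒜 : ∀ a ∈ 𝒜, opNorm a ≤ 1)
    (hη : IsSubgaussianNoise μ T σ Θ A η)
    (hL : IsLPAETC μ 𝒜 π T n₀ σ Rmax δ A (reward Θ A η)) (hn₀ : n₀ ≤ T) {a : ℕ}
    {Θ₀ : Ω → Matrix (Fin d₁) (Fin d₂) ℝ} (hΘ₀ : Measurable[history A (reward Θ A η) a] Θ₀)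
    {E : Set Ω} (hE : MeasurableSet[history A (reward Θ A η) a] E)
    (hR : ∀ ω ∈ E, ∀ x ∈ 𝒜, |frobInner (Θ - Θ₀ ω) x| ≤ R₀) {b : ℕ} (hab : a < b)
    (hb : b ≤ n₀) (hd : 0 < d₁) {δ' : ℝ} (hδ' : 0 < δ') (hδ1 : δ' ≤ 1) (hσ : 0 < σ)
    (hB : 0 < designB (covMatrix π)) :
    μ {ω | ω ∈ E ∧ threshold (b - a) (covMatrix π) σ R₀ δ' <
      opNorm (robustMean (Finset.Ico a b) (fun i => A i ω) (fun i => reward Θ A η i ω)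
        (covMatrix π) (Θ₀ ω) σ R₀ δ' - Θ)} ≤ ENNReal.ofReal (δ' / 2) := by
  have hd' : (1 : ℝ) ≤ d₁ := by exact_mod_cast hd
  have hd2 : (0 : ℝ) ≤ d₂ := Nat.cast_nonneg _
  have hD : 1 < 2 * ((d₁ : ℝ) + d₂) / δ' := by
    rw [lt_div_iff₀ hδ']
    linarith
  have hℓ := Real.log_pos hD
  have hv : 0 < (σ ^ 2 + R₀ ^ 2) * designB (covMatrix π) := by positivity
  obtain ⟨h1, h2, h3⟩ := scaleParam_eq (n := b - a) (by omega) hv hℓ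
  have hcard : (Finset.Ico a b).card = b - a := Nat.card_Ico a b
  -- At level 2ℓ the exponent is ℓ/2 − 2ℓ ≤ −ℓ, and (d₁ + d₂) e^{−ℓ} = δ'/2: half of the nominal
  -- failure rate.
  have htail := measure_trace_exp_robustSum_ge_le hπ h𝒜 hη hL hn₀ hΘ₀ hE hR
    (scaleParam (b - a) (covMatrix π) σ R₀ δ') (2 * Real.log (2 * (d₁ + d₂) / δ')) hab.le hb
  refine (measure_mono ?_).trans (htail.trans (ENNReal.ofReal_le_ofReal ?_))
  · rintro ω ⟨hω, hlt⟩
    refine ⟨hω, ?_⟩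
    by_contra hcon
    have h := opNorm_robustMean_sub_le (s := Finset.Ico a b) (σ := σ) (R₀ := R₀) (δ := δ')
      (Θ := Θ) (Θ₀ := Θ₀ ω) (X := fun i => A i ω) (y := fun i => reward Θ A η i ω)
      (Q := covMatrix π) (u := 2 * Real.log (2 * (d₁ + d₂) / δ')) (by positivity)
      (by rw [hcard]; exact h1) (by rw [hcard]; exact (not_le.1 hcon).le)
    rw [hcard, h2] at h
    exact absurd h (not_le.2 hlt)
  · rw [h3]
    have e : Real.exp (Real.log (2 * (d₁ + d₂) / δ') / 2 - 2 * Real.log (2 * (d₁ + d₂) / δ')) ≤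
        Real.exp (-Real.log (2 * (d₁ + d₂) / δ')) := Real.exp_le_exp.2 (by linarith)
    rw [Real.exp_neg, Real.exp_log (by positivity)] at e
    calc ((d₁ : ℝ) + d₂) * _ ≤ (d₁ + d₂) * (2 * ((d₁ : ℝ) + d₂) / δ')⁻¹ :=
          mul_le_mul_of_nonneg_left e (by positivity)
      _ = δ' / 2 := by field_simp

/-! ### Measurability of the estimators -/

lemma measurable_robustMean {Ω' : Type*} {m : MeasurableSpace Ω'}
    (Q : Matrix (Fin d₂ × Fin d₁) (Fin d₂ × Fin d₁) ℝ) {s : Finset ℕ}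
    {Θ₀ : Ω' → Matrix (Fin d₁) (Fin d₂) ℝ} {X : ℕ → Ω' → Matrix (Fin d₁) (Fin d₂) ℝ}
    {y : ℕ → Ω' → ℝ} (hΘ₀ : Measurable Θ₀) (hX : ∀ i ∈ s, Measurable (X i))
    (hy : ∀ i ∈ s, Measurable (y i)) (σ R₀ δ : ℝ) :
    Measurable fun ω => robustMean s (fun i => X i ω) (fun i => y i ω) Q (Θ₀ ω) σ R₀ δ := by
  refine measurable_matrix_iff.2 fun i j => ?_
  simp only [robustMean, Matrix.add_apply, Matrix.smul_apply, toBlocks₁₂, of_apply,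
    Matrix.sum_apply, smul_eq_mul]
  exact (measurable_matrix_iff.1 hΘ₀ i j).add ((Finset.measurable_sum _ fun k hk =>
    measurable_robustSample Q _ hΘ₀ (hX k hk) (hy k hk) _ _).const_mul _)

/-- Makes the pilot a measurable function of the first-half history, as the tail bound for the
second half requires. -/
lemma measurable_hardThreshold {Ω' : Type*} {m : MeasurableSpace Ω'} (τ : ℝ)
    {W : Ω' → Matrix (Fin d₁) (Fin d₂) ℝ} (hW : Measurable W) :
    Measurable fun ω => hardThreshold τ (W ω) := by
  have hW' := measurable_matrix_iff.1 hW
  have hs := (spectrallyMeasurable_indicator_sqrt (n := Fin d₂) τ).measurable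
    (W := fun ω => (W ω)ᵀ * W ω) (fun ω => by
      simpa using isHermitian_conjTranspose_mul_self (W ω)) fun i j => by
      simp only [Matrix.mul_apply, transpose_apply]
      exact Finset.measurable_sum _ fun k _ => (hW' k i).mul (hW' k j)
  refine measurable_matrix_iff.2 fun i j => ?_
  simp only [hardThreshold, Matrix.mul_apply (M := W _)]
  exact Finset.measurable_sum _ fun k _ => (hW' i k).mul (hs k j)

open scoped Matrix.Norms.L2Operator in
lemma continuous_opNorm :
    Continuous (opNorm : Matrix (Fin d₁) (Fin d₂) ℝ → ℝ) := continuous_norm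

lemma measurable_opNorm : Measurable (opNorm : Matrix (Fin d₁) (Fin d₂) ℝ → ℝ) := by
  have h : Continuous fun W : Fin d₁ → Fin d₂ → ℝ => opNorm (Matrix.of W) := continuous_opNorm
  exact h.measurable

end Tail

/-! ### Hard thresholding: operator norm error, rank, and prediction on the arms. -/

section Threshold

open Matrix

variable {d₁ d₂ : ℕ}

lemma isHermitian_gram (M : Matrix (Fin d₁) (Fin d₂) ℝ) : (Mᵀ * M).IsHermitian := by
  simpa using isHermitian_conjTranspose_mul_self M

lemma dotProduct_gram_mulVec (M : Matrix (Fin d₁) (Fin d₂) ℝ) (v : Fin d₂ → ℝ) :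
    v ⬝ᵥ (Mᵀ * M) *ᵥ v = (M *ᵥ v) ⬝ᵥ (M *ᵥ v) := by
  rw [← mulVec_mulVec, dotProduct_mulVec, vecMul_transpose]

lemma norm_toLp_sq {k : ℕ} (v : Fin k → ℝ) : ‖WithLp.toLp 2 v‖ ^ 2 = v ⬝ᵥ v :=
  (dotProduct_self_eq_norm_sq (WithLp.toLp 2 v)).symm

lemma dotProduct_mulVec_self_le {A : Matrix (Fin d₁) (Fin d₂) ℝ} {s : ℝ} (h : opNorm A ≤ s)
    (v : Fin d₂ → ℝ) : (A *ᵥ v) ⬝ᵥ (A *ᵥ v) ≤ s ^ 2 * (v ⬝ᵥ v) := by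
  rw [← norm_toLp_sq, ← norm_toLp_sq, ← mul_pow]
  refine pow_le_pow_left₀ (norm_nonneg _) ?_ 2
  exact (norm_mulVec_le_opNorm A (WithLp.toLp 2 v)).trans
    (mul_le_mul_of_nonneg_right h (norm_nonneg _))

open scoped Matrix.Norms.L2Operator in
lemma opNorm_add_le (A B : Matrix (Fin d₁) (Fin d₂) ℝ) :
    opNorm (A + B) ≤ opNorm A + opNorm B := norm_add_le A B

/-- The spectral projection used by hard thresholding. -/
noncomputable def thresholdProj (τ : ℝ) (M : Matrix (Fin d₁) (Fin d₂) ℝ) :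
    Matrix (Fin d₂) (Fin d₂) ℝ :=
  cfc (fun x : ℝ => if τ < √x then (1 : ℝ) else 0) (Mᵀ * M)

lemma thresholdProj_mul_self (τ : ℝ) (M : Matrix (Fin d₁) (Fin d₂) ℝ) :
    thresholdProj τ M * thresholdProj τ M = thresholdProj τ M := by
  rw [thresholdProj, ← cfc_mul _ _ _ (continuousOn_spectrum _) (continuousOn_spectrum _)]
  congr 1
  ext x
  split_ifs <;> simp

/-- The Gram matrix of the difference is a function of MᵀM that vanishes where √x > τ and equals x ≤
τ² on the rest of the spectrum. -/
lemma opNorm_hardThreshold_sub_le {τ : ℝ} (hτ : 0 ≤ τ) (M : Matrix (Fin d₁) (Fin d₂) ℝ) :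
    opNorm (hardThreshold τ M - M) ≤ τ := by
  have hS := isHermitian_gram M
  refine opNorm_le_of_forall hτ fun x => ?_
  refine pow_le_pow_iff_left₀ (norm_nonneg _) (by positivity) two_ne_zero |>.1 ?_
  rw [mul_pow, norm_toLp_sq, ← dotProduct_self_eq_norm_sq, ← dotProduct_gram_mulVec]
  set f : ℝ → ℝ := fun x => if τ < √x then (1 : ℝ) else 0 with hf
  have hP : (cfc f (Mᵀ * M))ᵀ = cfc f (Mᵀ * M) := by
    rw [← conjTranspose_eq_transpose_of_trivial]
    exact isHermitian_cfc f _
  have e : (hardThreshold τ M - M)ᵀ * (hardThreshold τ M - M) =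
      cfc (fun x => (f x - 1) * (x * (f x - 1))) (Mᵀ * M) := by
    have e1 : cfc (fun x => f x - 1) (Mᵀ * M) = cfc f (Mᵀ * M) - 1 := by
      rw [cfc_sub _ _ _ (continuousOn_spectrum _) (continuousOn_spectrum _), cfc_one_matrix hS]
    rw [cfc_mul _ _ _ (continuousOn_spectrum _) (continuousOn_spectrum _),
      cfc_mul _ _ _ (continuousOn_spectrum _) (continuousOn_spectrum _), cfc_id_matrix hS, e1,
      hardThreshold]
    simp only [transpose_sub, transpose_mul, hP, ← hf]
    simp only [Matrix.sub_mul, Matrix.mul_sub, Matrix.mul_assoc, Matrix.one_mul, Matrix.mul_one]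
  rw [e]
  have h := posSemidef_cfc_sub (f := fun x => (f x - 1) * (x * (f x - 1)))
    (g := fun _ => τ ^ 2 * 1) hS fun i => by
      simp only [hf]
      split_ifs with hi
      · simpa using sq_nonneg τ
      · have := (Real.sqrt_le_left hτ).1 (not_lt.1 hi)
        linarith
  rw [cfc_const_mul _ _ _ (continuousOn_spectrum _), cfc_one_matrix hS] at h
  have := h.dotProduct_mulVec_nonneg x.ofLp
  simp only [star_trivial, sub_mulVec, smul_mulVec, one_mulVec, dotProduct_sub, dotProduct_smul,
    smul_eq_mul] at this
  linarith

lemma lt_dotProduct_of_thresholdProj_mulVec {τ : ℝ} (hτ : 0 ≤ τ) {M : Matrix (Fin d₁) (Fin d₂) ℝ}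
    {v : Fin d₂ → ℝ} (hv : thresholdProj τ M *ᵥ v = v) (hv0 : v ≠ 0) :
    τ ^ 2 * (v ⬝ᵥ v) < (M *ᵥ v) ⬝ᵥ (M *ᵥ v) := by
  have hS := isHermitian_gram M
  set f : ℝ → ℝ := fun x => if τ < √x then (1 : ℝ) else 0 with hf
  -- Equal to x − τ² on the retained part of the spectrum and set to 1 elsewhere: the calculus is
  -- positive definite, yet on the range of the projection it acts as MᵀM − τ².
  set g : ℝ → ℝ := fun x => if τ < √x then x - τ ^ 2 else 1 with hg
  have hpd : (cfc g (Mᵀ * M)).PosDef := posDef_cfc hS fun i => by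
    simp only [hg]
    split_ifs with hi
    · have := (Real.lt_sqrt hτ).1 hi
      linarith
    · exact one_pos
  have hgf : cfc g (Mᵀ * M) * cfc f (Mᵀ * M) = (Mᵀ * M - τ ^ 2 • 1) * cfc f (Mᵀ * M) := by
    have e1 : cfc (fun x => x - τ ^ 2 * 1) (Mᵀ * M) = Mᵀ * M - τ ^ 2 • 1 := by
      rw [cfc_sub _ _ _ (continuousOn_spectrum _) (continuousOn_spectrum _), cfc_id_matrix hS,
        cfc_const_mul _ _ _ (continuousOn_spectrum _), cfc_one_matrix hS]
    rw [← e1, ← cfc_mul _ _ _ (continuousOn_spectrum _) (continuousOn_spectrum _),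
      ← cfc_mul _ _ _ (continuousOn_spectrum _) (continuousOn_spectrum _)]
    congr 1
    ext x
    simp only [hf, hg]
    split_ifs <;> simp
  have hpos := hpd.dotProduct_mulVec_pos hv0
  have hv' : cfc f (Mᵀ * M) *ᵥ v = v := hv
  have e2 : cfc g (Mᵀ * M) *ᵥ v = (Mᵀ * M) *ᵥ v - τ ^ 2 • v := by
    conv_lhs => rw [← hv', mulVec_mulVec, hgf, ← mulVec_mulVec, hv']
    rw [sub_mulVec, smul_mulVec, one_mulVec]
  rw [e2, star_trivial, dotProduct_sub, dotProduct_gram_mulVec, dotProduct_smul, smul_eq_mul] at hpos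
  linarith

/-- Θ is injective on the range of the projection P: a nonzero v there with Θv = 0 would satisfy
‖Mv‖ = ‖(M − Θ)v‖ ≤ τ‖v‖, against ‖Mv‖ > τ‖v‖. Hence rank P ≤ rank(ΘP) ≤ rank Θ. -/
lemma rank_hardThreshold_le {τ : ℝ} (hτ : 0 ≤ τ) {M Θ : Matrix (Fin d₁) (Fin d₂) ℝ}
    (h : opNorm (M - Θ) ≤ τ) : (hardThreshold τ M).rank ≤ Θ.rank := by
  refine (rank_mul_le_right M (thresholdProj τ M)).trans ?_
  refine le_trans ?_ (rank_mul_le_left Θ (thresholdProj τ M))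
  set P := thresholdProj τ M
  have hker : LinearMap.ker (Θ * P).mulVecLin ≤ LinearMap.ker P.mulVecLin := by
    intro v hv
    rw [LinearMap.mem_ker, mulVecLin_apply] at hv ⊢
    by_contra h0
    have hlt := lt_dotProduct_of_thresholdProj_mulVec hτ (M := M) (v := P *ᵥ v)
      (by rw [mulVec_mulVec, thresholdProj_mul_self]) h0
    have hle := dotProduct_mulVec_self_le h (P *ᵥ v)
    rw [sub_mulVec, mulVec_mulVec v Θ P, hv, sub_zero] at hle
    exact absurd hlt (not_lt.2 hle)
  have h1 := LinearMap.finrank_range_add_finrank_ker P.mulVecLin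
  have h2 := LinearMap.finrank_range_add_finrank_ker (Θ * P).mulVecLin
  have h3 := Submodule.finrank_mono hker
  rw [Matrix.rank, Matrix.rank]
  omega

lemma rank_neg_le (M : Matrix (Fin d₁) (Fin d₂) ℝ) : (-M).rank ≤ M.rank := by
  have h := rank_mul_le_right (-1 : Matrix (Fin d₁) (Fin d₁) ℝ) M
  simpa using h

lemma rank_sub_le (M N : Matrix (Fin d₁) (Fin d₂) ℝ) : (M - N).rank ≤ M.rank + N.rank := by
  rw [sub_eq_add_neg]
  refine le_trans ?_ (Nat.add_le_add_left (rank_neg_le N) _)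
  rw [Matrix.rank, mulVecLin_add]
  exact (Submodule.finrank_mono (LinearMap.range_add_le _ _)).trans
    (Submodule.finrank_add_le_finrank_add_finrank _ _)

/-- A trace duality bound for matrices of low rank. -/
lemma abs_frobInner_le_rank_mul (Δ A : Matrix (Fin d₁) (Fin d₂) ℝ) :
    |frobInner Δ A| ≤ Δ.rank * (opNorm Δ * opNorm A) := by
  have hS := isHermitian_gram Δ
  -- The trace is expanded in an eigenbasis of ΔᵀΔ. Only rank Δ of the basis vectors are not killed
  -- by Δ, and each of these contributes at most the product of the norms.
  set u : Fin d₂ → Fin d₂ → ℝ := fun i j => eigU hS j i with hu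
  have huu : ∀ i, u i ⬝ᵥ u i = 1 := fun i => by
    have h := congrFun₂ (eigU_transpose_mul hS) i i
    rwa [one_apply_eq, Matrix.mul_apply] at h
  have htr : frobInner Δ A = ∑ i, (Δ *ᵥ u i) ⬝ᵥ (A *ᵥ u i) := by
    have e : frobInner Δ A = ((Δ * eigU hS)ᵀ * (A * eigU hS)).trace := by
      rw [transpose_mul, Matrix.mul_assoc, trace_mul_comm, ← Matrix.mul_assoc, Matrix.mul_assoc,
        Matrix.mul_assoc, eigU_mul_transpose, Matrix.mul_one]
      rfl
    rw [e]
    rfl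
  have hlam : ∀ i, (Δ *ᵥ u i) ⬝ᵥ (Δ *ᵥ u i) = hS.eigenvalues i := fun i => by
    have h : (Δᵀ * Δ) *ᵥ u i = hS.eigenvalues i • u i := hS.mulVec_eigenvectorBasis i
    rw [← dotProduct_gram_mulVec, h, dotProduct_smul, huu, smul_eq_mul, mul_one]
  have hterm : ∀ i, |(Δ *ᵥ u i) ⬝ᵥ (A *ᵥ u i)| ≤
      if hS.eigenvalues i ≠ 0 then opNorm Δ * opNorm A else 0 := by
    intro i
    split_ifs with h0
    · have h1 := norm_mulVec_le_opNorm Δ (WithLp.toLp 2 (u i))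
      have h2 := norm_mulVec_le_opNorm A (WithLp.toLp 2 (u i))
      have h3 : ‖WithLp.toLp 2 (u i)‖ = 1 := by
        rw [← pow_eq_one_iff_of_nonneg (norm_nonneg _) two_ne_zero, norm_toLp_sq, huu]
      rw [h3, mul_one] at h1 h2
      have h4 := abs_real_inner_le_norm (WithLp.toLp 2 (A *ᵥ u i)) (WithLp.toLp 2 (Δ *ᵥ u i))
      rw [EuclideanSpace.inner_eq_star_dotProduct, star_trivial] at h4
      refine h4.trans ?_
      rw [mul_comm]
      exact mul_le_mul h1 h2 (norm_nonneg _) (opNorm_nonneg _)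
    · have h1 := hlam i
      rw [not_not.1 h0, dotProduct_self_eq_zero] at h1
      rw [h1, zero_dotProduct, abs_zero]
  rw [htr]
  refine (Finset.abs_sum_le_sum_abs _ _).trans ((Finset.sum_le_sum fun i _ => hterm i).trans ?_)
  rw [← Finset.sum_filter, Finset.sum_const, nsmul_eq_mul, ← rank_transpose_mul_self Δ,
    hS.rank_eq_card_non_zero_eigs, Fintype.card_subtype]

/-- The prediction error of hard thresholding on the arms. -/
lemma abs_frobInner_hardThreshold_sub_le {τ : ℝ} {M Θ a : Matrix (Fin d₁) (Fin d₂) ℝ}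
    {r : ℕ} (h : opNorm (M - Θ) ≤ τ) (hr : Θ.rank ≤ r) (ha : opNorm a ≤ 1) :
    |frobInner (Θ - hardThreshold τ M) a| ≤ 4 * r * τ := by
  have hτ : 0 ≤ τ := (opNorm_nonneg _).trans h
  -- Both matrices have rank at most r, so the difference has rank at most 2r. Its norm is at most
  -- 2τ: one τ from estimation and one from thresholding.
  have h1 : ((Θ - hardThreshold τ M).rank : ℝ) ≤ 2 * r := by
    have := rank_sub_le Θ (hardThreshold τ M)
    have := rank_hardThreshold_le hτ h
    exact_mod_cast (by omega : (Θ - hardThreshold τ M).rank ≤ 2 * r)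
  have h2 : opNorm (Θ - hardThreshold τ M) ≤ 2 * τ := by
    have e : Θ - hardThreshold τ M = (-1 : ℝ) • ((hardThreshold τ M - M) + (M - Θ)) := by
      rw [neg_smul, one_smul]
      abel
    rw [e, opNorm_smul, abs_neg, abs_one, one_mul]
    have h4 : opNorm ((hardThreshold τ M - M) + (M - Θ)) ≤
        opNorm (hardThreshold τ M - M) + opNorm (M - Θ) := opNorm_add_le _ _
    have := opNorm_hardThreshold_sub_le hτ M
    linarith
  calc _ ≤ _ := abs_frobInner_le_rank_mul _ _
    _ ≤ 2 * r * (2 * τ * 1) := by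
      have := opNorm_nonneg a
      have := opNorm_nonneg (Θ - hardThreshold τ M)
      gcongr
    _ = 4 * r * τ := by ring

end Threshold

/-! ### Lower bound on the design constant. -/

section Design

open Matrix

variable {d₁ d₂ : ℕ} {𝒜 : Set (Matrix (Fin d₁) (Fin d₂) ℝ)}
  {π : Measure (Matrix (Fin d₁) (Fin d₂) ℝ)}

/-- The quadratic form of Q at e − Q⁻¹e equals Q_pp − 2 + (Q⁻¹)_pp and is nonnegative. -/
lemma two_sub_le_inv_diag {n : Type*} [Fintype n] [DecidableEq n] {Q : Matrix n n ℝ}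
    (hQ : Q.PosDef) (p : n) : 2 - Q p p ≤ Q⁻¹ p p := by
  have hu : IsUnit Q.det := hQ.det_pos.ne'.isUnit
  set e : n → ℝ := Pi.single p 1 with he
  have h := hQ.posSemidef.dotProduct_mulVec_nonneg (e - Q⁻¹ *ᵥ e)
  have h1 : Q *ᵥ (Q⁻¹ *ᵥ e) = e := by rw [mulVec_mulVec, mul_nonsing_inv _ hu, one_mulVec]
  have hs : Qᵀ = Q := by rw [← conjTranspose_eq_transpose_of_trivial]; exact hQ.1
  have h2 : (Q⁻¹ *ᵥ e) ⬝ᵥ (Q *ᵥ e) = e ⬝ᵥ e := by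
    rw [dotProduct_mulVec, ← mulVec_transpose, hs, h1]
  rw [star_trivial, mulVec_sub, h1, sub_dotProduct, dotProduct_sub, dotProduct_sub, h2] at h
  simp only [he, single_dotProduct, mulVec_single, one_mul, dotProduct_single, mul_one,
    Pi.single_eq_same, Matrix.col_apply, MulOpposite.op_one, one_smul] at h
  linarith

/-- Arm entries are at most 1, so the diagonal of Q is at most 1 and that of Q⁻¹ at least 1. The
largest eigenvalue of the column block sum dominates one of its diagonal entries. -/
lemma one_le_designB (hπ : IsDesign 𝒜 π) (h𝒜 : ∀ a ∈ 𝒜, opNorm a ≤ 1) (hd₁ : 0 < d₁)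
    (hd₂ : 0 < d₂) : 1 ≤ designB (covMatrix π) := by
  have := hπ.isProbabilityMeasure
  have hdiag : ∀ p, covMatrix π p p ≤ 1 := by
    intro p
    have hb := hπ.bddAE_entry h𝒜 p.2 p.1
    have h : covMatrix π p p ≤ ∫ _, (1 : ℝ) ∂π := by
      refine integral_mono_ae (hb.mul hb).integrable (integrable_const _) ?_
      filter_upwards [hπ.ae_mem] with A hA
      change A p.2 p.1 * A p.2 p.1 ≤ 1
      rw [← sq, sq_le_one_iff_abs_le_one]
      exact (abs_entry_le_opNorm A _ _).trans (h𝒜 A hA)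
    simpa using h
  have hinv : ∀ p, 1 ≤ (covMatrix π)⁻¹ p p := fun p => by
    have := two_sub_le_inv_diag hπ.posDef p
    have := hdiag p
    linarith
  have h := dotProduct_mulVec_le_lambdaMax (isHermitian_sum_colBlock hπ)
    (Pi.single (⟨0, hd₁⟩ : Fin d₁) 1)
  simp only [single_dotProduct, mulVec_single, one_mul, mul_one, Matrix.col_apply,
    Pi.single_eq_same, MulOpposite.op_one, one_smul, Matrix.sum_apply, colBlock,
    submatrix_apply] at h
  refine le_trans ?_ (h.trans (le_max_left _ _))
  refine (hinv (⟨0, hd₂⟩, ⟨0, hd₁⟩)).trans (Finset.single_le_sum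
    (f := fun i => (covMatrix π)⁻¹ (i, (⟨0, hd₁⟩ : Fin d₁)) (i, ⟨0, hd₁⟩))
    (fun i _ => zero_le_one.trans (hinv _)) (Finset.mem_univ _))

lemma IsOptimalDesign.Bmin_eq (hπ : IsOptimalDesign 𝒜 π) : Bmin 𝒜 = designB (covMatrix π) := by
  refine IsLeast.csInf_eq ⟨⟨π, hπ.1, rfl⟩, ?_⟩
  rintro b ⟨π', h, rfl⟩
  exact hπ.2 π' h

end Design

/-! ### Regret of explore-then-commit. -/

section Regret

variable {d₁ d₂ : ℕ} {𝒜 : Set (Matrix (Fin d₁) (Fin d₂) ℝ)} {Ω : Type*}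
  {A : ℕ → Ω → Matrix (Fin d₁) (Fin d₂) ℝ} {Θ Θhat : Matrix (Fin d₁) (Fin d₂) ℝ} {T n₀ : ℕ}
  {Rmax ε : ℝ} {ω : Ω}

lemma frobInner_sub (Θ Θ' a : Matrix (Fin d₁) (Fin d₂) ℝ) :
    frobInner (Θ - Θ') a = frobInner Θ a - frobInner Θ' a := by
  rw [frobInner, frobInner, frobInner, Matrix.transpose_sub, Matrix.sub_mul, Matrix.trace_sub]

/-- The regret of an explore-then-commit algorithm whose estimator is accurate on the arms. -/
lemma regret_le_of_explore_commit (hn₀ : n₀ ≤ T) (hR : ∀ a ∈ 𝒜, |frobInner Θ a| ≤ Rmax)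
    (hexp : ∀ t < n₀, A t ω ∈ 𝒜)
    (hcom : ∀ t, n₀ ≤ t → t < T → A t ω ∈ 𝒜 ∧ ∀ a ∈ 𝒜, frobInner Θhat a ≤ frobInner Θhat (A t ω))
    (hε : ∀ a ∈ 𝒜, |frobInner (Θ - Θhat) a| ≤ ε) :
    regret 𝒜 Θ T A ω ≤ n₀ * (2 * Rmax) + (T - n₀ : ℕ) * (2 * ε) := by
  rw [regret, ← Finset.sum_range_add_sum_Ico _ hn₀]
  have h1 : ∀ t ∈ Finset.range n₀,
      sSup (frobInner Θ '' 𝒜) - frobInner Θ (A t ω) ≤ 2 * Rmax := by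
    intro t ht
    have hA := hexp t (Finset.mem_range.1 ht)
    have hs : sSup (frobInner Θ '' 𝒜) ≤ Rmax := by
      refine csSup_le ⟨_, _, hA, rfl⟩ ?_
      rintro _ ⟨a, ha, rfl⟩
      exact (abs_le.1 (hR a ha)).2
    have := (abs_le.1 (hR _ hA)).1
    linarith
  have h2 : ∀ t ∈ Finset.Ico n₀ T,
      sSup (frobInner Θ '' 𝒜) - frobInner Θ (A t ω) ≤ 2 * ε := by
    intro t ht
    obtain ⟨hA, hmax⟩ := hcom t (Finset.mem_Ico.1 ht).1 (Finset.mem_Ico.1 ht).2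
    have hs : sSup (frobInner Θ '' 𝒜) ≤ frobInner Θ (A t ω) + 2 * ε := by
      refine csSup_le ⟨_, _, hA, rfl⟩ ?_
      rintro _ ⟨a, ha, rfl⟩
      have e1 := (abs_le.1 (hε a ha)).2
      have e2 := (abs_le.1 (hε _ hA)).1
      rw [frobInner_sub] at e1 e2
      have := hmax a ha
      linarith
    linarith
  have s1 := Finset.sum_le_card_nsmul _ _ _ h1
  have s2 := Finset.sum_le_card_nsmul _ _ _ h2
  rw [Finset.card_range, nsmul_eq_mul] at s1
  rw [Nat.card_Ico, nsmul_eq_mul] at s2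
  exact add_le_add s1 s2

end Regret

/-! ### Arithmetic of the exploration length, with x its value before rounding and capping. -/

section Tuning

variable {σ R r B L T x : ℝ}

/-- The exploration phase is long enough for the pilot estimator to be accurate. -/
lemma exploration_long {l : ℝ} (hσ : 0 < σ) (hR : 0 < R) (hr : 1 ≤ r) (hB : 1 ≤ B) (hL : 1 ≤ L)
    (hl : L ≤ l) (hl2 : l ^ 2 = L ^ 3) (hT : 3000 * l * (r ^ 2 * B * ((σ + R) / σ) ^ 4) ≤ T)
    (hx0 : 0 ≤ x) (hx : x ^ 3 = σ ^ 2 * r ^ 2 * B * T ^ 2 / R ^ 2) :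
    1 ≤ x ∧ 3 ≤ 64 * r ^ 2 * ((σ ^ 2 + R ^ 2) * B * L) / σ ^ 2 ∧
      3 * (64 * r ^ 2 * ((σ ^ 2 + R ^ 2) * B * L) / σ ^ 2) ≤ T ∧
      3 * (64 * r ^ 2 * ((σ ^ 2 + R ^ 2) * B * L) / σ ^ 2) ≤ x := by
  set ρ := (σ + R) / σ with hρ
  have hρ1 : 1 ≤ ρ := by rw [hρ, le_div_iff₀ hσ]; linarith
  have hσρ : σ * ρ = σ + R := by rw [hρ]; field_simp
  -- The quantity 64 r² (σ² + R²) B L / σ² is the sample size at which the pilot error 8r √((σ² +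
  -- R²) B L / k) falls to σ. It is at most 64 G, and the factor 3 in the conclusion pays for
  -- halving the sample with floor.
  set G := r ^ 2 * B * L * ρ ^ 2 with hG
  have hr2 : 1 ≤ r ^ 2 := one_le_pow₀ hr
  have hG1 : 1 ≤ G := by
    rw [hG]
    exact one_le_mul_of_one_le_of_one_le (one_le_mul_of_one_le_of_one_le
      (one_le_mul_of_one_le_of_one_le hr2 hB) hL) (one_le_pow₀ hρ1)
  have hK : 64 * r ^ 2 * ((σ ^ 2 + R ^ 2) * B * L) / σ ^ 2 ≤ 64 * G := by
    rw [div_le_iff₀ (by positivity)]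
    have e : 64 * G * σ ^ 2 = 64 * r ^ 2 * ((σ + R) ^ 2 * B * L) := by
      rw [hG, ← hσρ]
      ring
    rw [e]
    gcongr
    nlinarith
  have hK3 : 3 ≤ 64 * r ^ 2 * ((σ ^ 2 + R ^ 2) * B * L) / σ ^ 2 := by
    rw [le_div_iff₀ (by positivity)]
    have e1 : 1 ≤ r ^ 2 * (B * L) := one_le_mul_of_one_le_of_one_le hr2
      (one_le_mul_of_one_le_of_one_le hB hL)
    have e2 : σ ^ 2 + R ^ 2 ≤ (r ^ 2 * (B * L)) * (σ ^ 2 + R ^ 2) :=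
      le_mul_of_one_le_left (by positivity) e1
    nlinarith [sq_nonneg R, sq_nonneg σ]
  have hl0 : 0 < l := by linarith
  have hTG : 3000 * G ≤ T := by
    refine le_trans ?_ hT
    have e1 : ρ ^ 2 ≤ ρ ^ 4 := pow_le_pow_right₀ hρ1 (by norm_num)
    calc 3000 * G = 3000 * L * (r ^ 2 * B * ρ ^ 2) := by rw [hG]; ring
      _ ≤ _ := by gcongr
  -- Cubes are compared. G³ρ² carries L³ρ⁸, which is exactly what T² supplies when T carries
  -- L^{3/2}ρ⁴. The constant works because 192³ ≤ 3000².
  have hxG : 192 * G ≤ x := by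
    refine (pow_le_pow_iff_left₀ (by positivity) hx0 three_ne_zero).1 ?_
    have hT2 : (3000 * l * (r ^ 2 * B * ρ ^ 4)) ^ 2 ≤ T ^ 2 :=
      pow_le_pow_left₀ (by positivity) hT 2
    have hRρ : R ^ 2 ≤ (σ * ρ) ^ 2 := by
      rw [hσρ]
      nlinarith
    rw [hx, le_div_iff₀ (by positivity)]
    calc (192 * G) ^ 3 * R ^ 2 ≤ (192 * G) ^ 3 * (σ * ρ) ^ 2 := by gcongr
      _ ≤ 3000 ^ 2 * G ^ 3 * (σ * ρ) ^ 2 := by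
        have : (0 : ℝ) ≤ G ^ 3 * (σ * ρ) ^ 2 := by positivity
        nlinarith
      _ = σ ^ 2 * r ^ 2 * B * (3000 * l * (r ^ 2 * B * ρ ^ 4)) ^ 2 := by
        have : (3000 * l * (r ^ 2 * B * ρ ^ 4)) ^ 2 =
          3000 ^ 2 * l ^ 2 * (r ^ 2 * B * ρ ^ 4) ^ 2 := by ring
        rw [this, hl2, hG]
        ring
      _ ≤ _ := by gcongr
  exact ⟨by linarith, hK3, by linarith, by linarith⟩

/-- The choice of the exploration length balances the exploration and the commitment regret. -/
lemma commit_regret_le (hσ : 0 < σ) (hR : 0 < R) (hr : 1 ≤ r) (hB : 1 ≤ B) (hL : 1 ≤ L)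
    (hT : 0 ≤ T) (hx0 : 0 < x) (hx : x ^ 3 = σ ^ 2 * r ^ 2 * B * T ^ 2 / R ^ 2) {m : ℝ}
    (hm : x / 2 ≤ m) :
    T * (2 * (4 * r * (2 * √((σ ^ 2 + σ ^ 2) * B * L / m)))) ≤ 32 * (√L * (R * x)) := by
  have h1 : √((σ ^ 2 + σ ^ 2) * B * L / m) ≤ √(4 * (σ ^ 2 * B * L) / x) := by
    refine Real.sqrt_le_sqrt ?_
    rw [div_le_div_iff₀ (by linarith) hx0]
    have : 0 ≤ σ ^ 2 * B * L := by positivity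
    nlinarith
  -- The balance: x³R² = σ²r²BT² turns the commitment cost into a multiple of the exploration cost R
  -- x.
  have h2 : T * r * √(4 * (σ ^ 2 * B * L) / x) = 2 * (√L * (R * x)) := by
    rw [← pow_left_inj₀ (by positivity) (by positivity) two_ne_zero, mul_pow, mul_pow, mul_pow,
      Real.sq_sqrt (by positivity), mul_pow √L, Real.sq_sqrt (by positivity)]
    rw [eq_div_iff (by positivity)] at hx
    rw [← mul_div_assoc, div_eq_iff hx0.ne']
    calc T ^ 2 * r ^ 2 * (4 * (σ ^ 2 * B * L)) = 4 * L * (σ ^ 2 * r ^ 2 * B * T ^ 2) := by ring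
      _ = _ := by rw [← hx]; ring
  calc _ = 16 * (T * r * √((σ ^ 2 + σ ^ 2) * B * L / m)) := by ring
    _ ≤ 16 * (T * r * √(4 * (σ ^ 2 * B * L) / x)) := by gcongr
    _ = _ := by rw [h2]; ring

end Tuning

/-! ### Warm start and the final regret bound. -/

section Assembly

open Matrix

variable {d₁ d₂ : ℕ} {𝒜 : Set (Matrix (Fin d₁) (Fin d₂) ℝ)}
  {π : Measure (Matrix (Fin d₁) (Fin d₂) ℝ)} {Ω : Type*} [mΩ : MeasurableSpace Ω]
  {μ : Measure Ω} [IsProbabilityMeasure μ] {A : ℕ → Ω → Matrix (Fin d₁) (Fin d₂) ℝ}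
  {η : ℕ → Ω → ℝ} {Θ : Matrix (Fin d₁) (Fin d₂) ℝ} {T n₀ r : ℕ} {σ Rmax δ : ℝ}

lemma measurable_matrix_sub_const {Ω' : Type*} {m : MeasurableSpace Ω'}
    {W : Ω' → Matrix (Fin d₁) (Fin d₂) ℝ} (hW : Measurable W) (Θ : Matrix (Fin d₁) (Fin d₂) ℝ) :
    Measurable fun ω => W ω - Θ :=
  measurable_matrix_iff.2 fun i j => (measurable_matrix_iff.1 hW i j).sub measurable_const

/-- Outside an event of probability at most `δ / 2`, the Warm-LowPopArt estimator is accurate on all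
arms, provided that the pilot estimator reaches the accuracy `σ`. -/
theorem measureReal_warmLowPopArt_le (hπ : IsDesign 𝒜 π) (h𝒜 : ∀ a ∈ 𝒜, opNorm a ≤ 1)
    (hη : IsSubgaussianNoise μ T σ Θ A η)
    (hL : IsLPAETC μ 𝒜 π T n₀ σ Rmax δ A (reward Θ A η)) (hn₀ : n₀ ≤ T) (hn : 2 ≤ n₀)
    (hr : Θ.rank ≤ r) (hR : ∀ a ∈ 𝒜, |frobInner Θ a| ≤ Rmax) (hd : 0 < d₁) (hσ : 0 < σ)
    (hδ : 0 < δ) (hδ1 : δ ≤ 1) (hB : 0 < designB (covMatrix π))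
    (hpilot : 4 * r * threshold (n₀ / 2) (covMatrix π) σ Rmax (δ / 2) ≤ σ) :
    μ.real {ω | ¬ ∀ a ∈ 𝒜, |frobInner (Θ - warmLowPopArt n₀ (fun s => A s ω)
      (fun s => reward Θ A η s ω) (covMatrix π) σ Rmax δ) a| ≤
        4 * r * threshold (n₀ - n₀ / 2) (covMatrix π) σ σ (δ / 2)} ≤ δ / 2 := by
  set Q := covMatrix π
  set k := n₀ / 2 with hk
  set τ₁ := threshold k Q σ Rmax (δ / 2)
  set τ₂ := threshold (n₀ - k) Q σ σ (δ / 2)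
  have hk0 : 0 < k := by omega
  set M₁ : Ω → Matrix (Fin d₁) (Fin d₂) ℝ := fun ω => robustMean (Finset.Ico 0 k)
    (fun s => A s ω) (fun s => reward Θ A η s ω) Q 0 σ Rmax (δ / 2) with hM₁
  set Θ₁ : Ω → Matrix (Fin d₁) (Fin d₂) ℝ := fun ω => hardThreshold τ₁ (M₁ ω) with hΘ₁
  set M₂ : Ω → Matrix (Fin d₁) (Fin d₂) ℝ := fun ω => robustMean (Finset.Ico k n₀)
    (fun s => A s ω) (fun s => reward Θ A η s ω) Q (Θ₁ ω) σ σ (δ / 2) with hM₂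
  have hwarm : ∀ ω, warmLowPopArt n₀ (fun s => A s ω) (fun s => reward Θ A η s ω) Q σ Rmax δ =
      hardThreshold τ₂ (M₂ ω) := by
    intro ω
    simp only [warmLowPopArt, lowPopArt, Finset.range_eq_Ico, Nat.card_Ico, Nat.sub_zero, ← hk]
    rfl
  have hM₁m : Measurable[history A (reward Θ A η) k] M₁ :=
    measurable_robustMean Q measurable_const
      (fun i hi => measurable_history_arm (Finset.mem_Ico.1 hi).2)
      (fun i hi => measurable_history_reward (Finset.mem_Ico.1 hi).2) σ Rmax (δ / 2)
  have hΘ₁m : Measurable[history A (reward Θ A η) k] Θ₁ := measurable_hardThreshold τ₁ hM₁m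
  set E : Set Ω := {ω | opNorm (M₁ ω - Θ) ≤ τ₁} with hE
  have hEm : MeasurableSet[history A (reward Θ A η) k] E := by
    exact measurableSet_le (measurable_opNorm.comp (measurable_matrix_sub_const hM₁m Θ))
      measurable_const
  -- The zero pilot has residual at most Rmax on every arm, so no accuracy event is needed.
  have hb₁ : μ {ω | ω ∈ Set.univ ∧ τ₁ < opNorm (M₁ ω - Θ)} ≤ ENNReal.ofReal (δ / 2 / 2) :=
    measure_opNorm_robustMean_gt_le (a := 0) (Θ₀ := fun _ => 0) (E := Set.univ) hπ h𝒜 hη hL hn₀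
      measurable_const MeasurableSet.univ (fun ω _ x hx => by rw [sub_zero]; exact hR x hx) hk0
      (by omega) hd (half_pos hδ) (by linarith) hσ hB
  -- On `E` the pilot has prediction error at most 4rτ₁ ≤ σ, which justifies R₀ = σ in the second
  -- call.
  have hb₂ : μ {ω | ω ∈ E ∧ τ₂ < opNorm (M₂ ω - Θ)} ≤ ENNReal.ofReal (δ / 2 / 2) :=
    measure_opNorm_robustMean_gt_le hπ h𝒜 hη hL hn₀ hΘ₁m hEm
      (fun ω hω x hx => (abs_frobInner_hardThreshold_sub_le hω hr (h𝒜 x hx)).trans hpilot)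
      (by omega) le_rfl hd (half_pos hδ) (by linarith) hσ hB
  have hsub : {ω | ¬ ∀ a ∈ 𝒜, |frobInner (Θ - warmLowPopArt n₀ (fun s => A s ω)
      (fun s => reward Θ A η s ω) Q σ Rmax δ) a| ≤ 4 * r * τ₂} ⊆
      {ω | ω ∈ Set.univ ∧ τ₁ < opNorm (M₁ ω - Θ)} ∪ {ω | ω ∈ E ∧ τ₂ < opNorm (M₂ ω - Θ)} := by
    intro ω hω
    by_contra hcon
    simp only [Set.mem_union, Set.mem_ofPred_eq, Set.mem_univ, true_and, not_or, not_and, not_lt,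
      hE] at hcon
    refine hω fun a ha => ?_
    rw [hwarm]
    exact abs_frobInner_hardThreshold_sub_le (hcon.2 hcon.1) hr (h𝒜 a ha)
  have hle := (measure_mono hsub).trans ((measure_union_le _ _).trans (add_le_add hb₁ hb₂))
  -- Each call runs at rate δ/2 but fails with probability at most δ/4.
  rw [← ENNReal.ofReal_add (by positivity) (by positivity), add_halves] at hle
  exact ENNReal.toReal_le_of_le_ofReal (by positivity) hle

/-- In the exploration phase the arms belong to the arm set. -/
lemma ae_mem_of_explore (hπ : IsDesign 𝒜 π)
    (hL : IsLPAETC μ 𝒜 π T n₀ σ Rmax δ A (reward Θ A η)) (hn₀ : n₀ ≤ T) :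
    ∀ᵐ ω ∂μ, ∀ t < n₀, A t ω ∈ 𝒜 := by
  rw [ae_all_iff]
  intro t
  by_cases ht : t < n₀
  · have h := hπ.ae_mem
    rw [← hL.explore_law t ht] at h
    filter_upwards [ae_of_ae_map (hL.measurable t (ht.trans_le hn₀)).aemeasurable h] with ω hω _
      using hω
  · exact ae_of_all _ fun ω h => absurd h ht

lemma one_le_log_of_pos (hd₁ : 0 < d₁) (hd₂ : 0 < d₂) (hδ : 0 < δ) (hδ1 : δ < 1) :
    1 ≤ Real.log (4 * (d₁ + d₂) / δ) := by
  have h1 : (1 : ℝ) ≤ d₁ := by exact_mod_cast hd₁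
  have h2 : (1 : ℝ) ≤ d₂ := by exact_mod_cast hd₂
  rw [Real.le_log_iff_exp_le (by positivity)]
  refine Real.exp_one_lt_three.le.trans ?_
  rw [le_div_iff₀ hδ]
  linarith

lemma threshold_half (n : ℕ) (Q : Matrix (Fin d₂ × Fin d₁) (Fin d₂ × Fin d₁) ℝ) (R₀ : ℝ) :
    threshold n Q σ R₀ (δ / 2) =
      2 * √((σ ^ 2 + R₀ ^ 2) * designB Q * Real.log (4 * (d₁ + d₂) / δ) / n) := by
  have e : 2 * ((d₁ : ℝ) + d₂) / (δ / 2) = 4 * (d₁ + d₂) / δ := by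
    rw [div_div_eq_mul_div]
    ring
  rw [threshold, e]

/-- The tuning estimates validate the pilot and bound both phases by multiples of √L · Rmax · x. The
regret bound then holds off the estimation failure event and a null set. -/
theorem regret_bound (hd₁ : 0 < d₁) (hd₂ : 0 < d₂) (hr : 1 ≤ r) (hσ : 0 < σ) (hRmax : 0 < Rmax)
    (hδ : 0 < δ) (hδ1 : δ < 1) (h𝒜 : ∀ a ∈ 𝒜, opNorm a ≤ 1) (hrank : Θ.rank ≤ r)
    (hR : ∀ a ∈ 𝒜, |frobInner Θ a| ≤ Rmax) (hπ : IsOptimalDesign 𝒜 π)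
    (hη : IsSubgaussianNoise μ T σ Θ A η)
    (hL : IsLPAETC μ 𝒜 π T (explorationLength 𝒜 T r σ Rmax) σ Rmax δ A (reward Θ A η))
    (hT : 3000 * Real.log (4 * (d₁ + d₂) / δ) ^ (3 / 2 : ℝ) *
      (r ^ 2 * Bmin 𝒜 * ((σ + Rmax) / σ) ^ 4) ≤ T) :
    1 - δ ≤ μ.real {ω | regret 𝒜 Θ T A ω ≤ 3000 * √(Real.log (4 * (d₁ + d₂) / δ)) *
      (σ ^ 2 * Rmax * r ^ 2 * Bmin 𝒜 * T ^ 2) ^ (1 / 3 : ℝ)} := by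
  have hn₀ : explorationLength 𝒜 T r σ Rmax ≤ T := min_le_left _ _
  have hB := one_le_designB hπ.1 h𝒜 hd₁ hd₂
  have hlog := one_le_log_of_pos hd₁ hd₂ hδ hδ1
  have hr' : (1 : ℝ) ≤ r := by exact_mod_cast hr
  set x : ℝ := (σ ^ 2 * r ^ 2 * designB (covMatrix π) * T ^ 2 / Rmax ^ 2) ^ (1 / 3 : ℝ) with hxdef
  have hlen : explorationLength 𝒜 T r σ Rmax = min T ⌈x⌉₊ := by
    rw [explorationLength, hπ.Bmin_eq]
  rw [hπ.Bmin_eq] at hT ⊢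
  set n₀ := explorationLength 𝒜 T r σ Rmax
  set B := designB (covMatrix π) with hBdef
  set L := Real.log (4 * (d₁ + d₂) / δ) with hLdef
  have hL0 : 0 < L := by linarith
  have hx0 : 0 ≤ x := by positivity
  have hx3 : x ^ 3 = σ ^ 2 * r ^ 2 * B * T ^ 2 / Rmax ^ 2 := by
    rw [hxdef, ← Real.rpow_natCast, ← Real.rpow_mul (by positivity)]
    norm_num
  -- The target rate is exactly Rmax · x, the order of the exploration regret.
  have hy : (σ ^ 2 * Rmax * r ^ 2 * B * T ^ 2) ^ (1 / 3 : ℝ) = Rmax * x := by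
    rw [one_div, Real.rpow_inv_eq (by positivity) (by positivity) (by norm_num),
      show (3 : ℝ) = (3 : ℕ) by norm_num, Real.rpow_natCast, mul_pow, hx3]
    field_simp
  have hl : L ≤ L ^ (3 / 2 : ℝ) := by
    conv_lhs => rw [← Real.rpow_one L]
    exact Real.rpow_le_rpow_of_exponent_le hlog (by norm_num)
  have hl2 : (L ^ (3 / 2 : ℝ)) ^ 2 = L ^ 3 := by
    rw [← Real.rpow_natCast, ← Real.rpow_mul hL0.le, ← Real.rpow_natCast]
    norm_num
  obtain ⟨hx1, hK3, hKT, hKx⟩ := exploration_long hσ hRmax hr' hB hlog hl hl2 hT hx0 hx3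
  set K := 64 * (r : ℝ) ^ 2 * ((σ ^ 2 + Rmax ^ 2) * B * L) / σ ^ 2 with hK
  have hKn : 3 * K ≤ n₀ := by
    rw [hlen, Nat.cast_min]
    exact le_min hKT (hKx.trans (Nat.le_ceil x))
  have hn9 : 9 ≤ n₀ := by
    have : (9 : ℝ) ≤ n₀ := by linarith
    exact_mod_cast this
  -- ⌊n₀/2⌋ ≥ n₀/3 as soon as n₀ ≥ 2.
  have hKm : K ≤ (n₀ / 2 : ℕ) := by
    have h1 : (n₀ : ℝ) ≤ 3 * (n₀ / 2 : ℕ) := by exact_mod_cast (by omega : n₀ ≤ 3 * (n₀ / 2))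
    linarith
  have hm0 : (0 : ℝ) < (n₀ / 2 : ℕ) := by linarith
  have hpilot : 4 * r * threshold (n₀ / 2) (covMatrix π) σ Rmax (δ / 2) ≤ σ := by
    rw [threshold_half, ← hBdef, ← hLdef]
    have h1 : √((σ ^ 2 + Rmax ^ 2) * B * L / (n₀ / 2 : ℕ)) ≤ σ / (8 * r) := by
      rw [Real.sqrt_le_left (by positivity), div_pow, div_le_div_iff₀ hm0 (by positivity)]
      rw [hK, div_le_iff₀ (by positivity)] at hKm
      linarith
    calc _ = 8 * r * √((σ ^ 2 + Rmax ^ 2) * B * L / (n₀ / 2 : ℕ)) := by ring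
      _ ≤ 8 * r * (σ / (8 * r)) := by gcongr
      _ = σ := by field_simp
  have hbad := measureReal_warmLowPopArt_le hπ.1 h𝒜 hη hL hn₀ (by omega) hrank hR hd₁ hσ hδ
    hδ1.le (by linarith) hpilot
  set ε := 4 * r * threshold (n₀ - n₀ / 2) (covMatrix π) σ σ (δ / 2) with hε
  have hsqrt : 1 ≤ √L := Real.one_le_sqrt.2 hlog
  have hfin : (n₀ : ℝ) * (2 * Rmax) + (T - n₀ : ℕ) * (2 * ε) ≤ 3000 * √L * (Rmax * x) := by
    have h1 : (n₀ : ℝ) * (2 * Rmax) ≤ 4 * (√L * (Rmax * x)) := by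
      have h2 : (n₀ : ℝ) ≤ 2 * x := by
        have h3 : (n₀ : ℝ) ≤ ⌈x⌉₊ := by
          rw [hlen]
          exact_mod_cast min_le_right _ _
        have := (Nat.ceil_lt_add_one hx0).le
        linarith
      have h4 : Rmax * x ≤ √L * (Rmax * x) := le_mul_of_one_le_left (by positivity) hsqrt
      nlinarith
    have h2 : ((T - n₀ : ℕ) : ℝ) * (2 * ε) ≤ 32 * (√L * (Rmax * x)) := by
      have hε0 : 0 ≤ ε := by
        rw [hε, threshold]
        positivity
      -- When the cap T is active there are no commitment rounds; otherwise n₀ ≥ x and the second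
      -- half has at least x/2 samples.
      rcases le_or_gt T ⌈x⌉₊ with h | h
      · have : T - n₀ = 0 := by rw [hlen]; omega
        rw [this, Nat.cast_zero, zero_mul]
        positivity
      · have hm : x / 2 ≤ (n₀ - n₀ / 2 : ℕ) := by
          have h3 : x ≤ n₀ := by
            rw [hlen, min_eq_right h.le]
            exact Nat.le_ceil x
          have h4 : (n₀ : ℝ) ≤ 2 * (n₀ - n₀ / 2 : ℕ) := by
            exact_mod_cast (by omega : n₀ ≤ 2 * (n₀ - n₀ / 2))
          linarith
        refine le_trans ?_ (commit_regret_le hσ hRmax hr' hB hlog (Nat.cast_nonneg T)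
          (by linarith) hx3 hm)
        rw [hε, threshold_half] at hε0 ⊢
        exact mul_le_mul_of_nonneg_right (by exact_mod_cast Nat.sub_le _ _)
          (mul_nonneg two_pos.le hε0)
    have : 0 ≤ √L * (Rmax * x) := by positivity
    linarith
  rw [hy]
  set S : Set Ω := {ω | regret 𝒜 Θ T A ω ≤ 3000 * √L * (Rmax * x)}
  set D : Set Ω := {ω | ¬ ∀ a ∈ 𝒜, |frobInner (Θ - warmLowPopArt n₀ (fun s => A s ω)
    (fun s => reward Θ A η s ω) (covMatrix π) σ Rmax δ) a| ≤ ε}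
  set N : Set Ω := {ω | ¬ ∀ t < n₀, A t ω ∈ 𝒜}
  have hN : μ.real N = 0 := by
    rw [measureReal_def, ae_iff.1 (ae_mem_of_explore hπ.1 hL hn₀), ENNReal.toReal_zero]
  -- Only monotonicity and subadditivity of μ are used, so no measurability of the three sets is
  -- needed. Exploration arms lie in 𝒜 only almost surely, whence the null set `N`.
  have hcover : Set.univ ⊆ S ∪ (D ∪ N) := by
    intro ω _
    by_cases h1 : ω ∈ D
    · exact Or.inr (Or.inl h1)
    by_cases h2 : ω ∈ N
    · exact Or.inr (Or.inr h2)
    · exact Or.inl ((regret_le_of_explore_commit hn₀ hR (not_not.1 h2)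
        (fun t ht htT => hL.commit t ht htT ω) (not_not.1 h1)).trans hfin)
  have h1 : (1 : ℝ) ≤ μ.real (S ∪ (D ∪ N)) := by
    rw [← probReal_univ (μ := μ)]
    exact measureReal_mono hcover
  have h2 := measureReal_union_le (μ := μ) S (D ∪ N)
  have h3 := measureReal_union_le (μ := μ) D N
  linarith

end Assembly

end LowRankBandit

theorem mainTheorem5 :
    ∃ C : ℝ, 0 < C ∧
      ∀ (d₁ d₂ r T : ℕ) (σ Rmax δ : ℝ)
        (𝒜 : Set (Matrix (Fin d₁) (Fin d₂) ℝ)) (Θstar : Matrix (Fin d₁) (Fin d₂) ℝ)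
        (π : MeasureTheory.Measure (Matrix (Fin d₁) (Fin d₂) ℝ))
        (Ω : Type*) [MeasurableSpace Ω] (μ : MeasureTheory.Measure Ω)
        [MeasureTheory.IsProbabilityMeasure μ]
        (A : ℕ → Ω → Matrix (Fin d₁) (Fin d₂) ℝ) (η : ℕ → Ω → ℝ),
        0 < d₁ → 0 < d₂ → 1 ≤ r → 0 < σ → 0 < Rmax → 0 < δ → δ < 1 →
        (∀ a ∈ 𝒜, LowRankBandit.opNorm a ≤ 1) →
        Θstar.rank ≤ r →
        (∀ a ∈ 𝒜, |LowRankBandit.frobInner Θstar a| ≤ Rmax) →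
        LowRankBandit.IsOptimalDesign 𝒜 π →
        LowRankBandit.IsSubgaussianNoise μ T σ Θstar A η →
        LowRankBandit.IsLPAETC μ 𝒜 π T (LowRankBandit.explorationLength 𝒜 T r σ Rmax) σ Rmax δ A
          (LowRankBandit.reward Θstar A η) →
        C * Real.log (4 * (d₁ + d₂) / δ) ^ (3 / 2 : ℝ) *
          (r ^ 2 * LowRankBandit.Bmin 𝒜 * ((σ + Rmax) / σ) ^ 4) ≤ T →
        1 - δ ≤ μ.real {ω | LowRankBandit.regret 𝒜 Θstar T A ω ≤
          C * √(Real.log (4 * (d₁ + d₂) / δ)) *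
            (σ ^ 2 * Rmax * r ^ 2 * LowRankBandit.Bmin 𝒜 * T ^ 2) ^ (1 / 3 : ℝ)} := by
  -- The value is dictated by the horizon condition; the regret bound alone would need only 4 + 32.
  refine ⟨3000, by norm_num, ?_⟩
  intro d₁ d₂ r T σ Rmax δ 𝒜 Θstar π Ω _ μ _ A η hd₁ hd₂ hr hσ hR hδ hδ1 h𝒜 hrank hRmax hπ hη hL hT
  exact LowRankBandit.regret_bound hd₁ hd₂ hr hσ hR hδ hδ1 h𝒜 hrank hRmax hπ hη hL hT
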